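/- Let $l>0$, $I=(-l,l)$, $H=L^2(I)$ with norm $\|\cdot\|_H$, and let $V=H^1_0(I)$ (the closure of the smooth functions on $\bar I$ vanishing at $\pm l$) with the norm $\|v\|_V=(\int_I|v|^2+\int_I|v'|^2)^{1/2}$. Let $c\ge 0$, and let $A$ be the self-adjoint operator $Au=-u_{xxxx}-u_{xx}-cu$ on $H$ with domain the set of $u\in H^4(I)$ such that $u(\pm l)=0$ and, as second boundary condition, either $u_x(\pm l)=0$ (clamped) or $u_{xx}(\pm l)=0$ (hinged); the result holds for each of the two choices. Let $S(t)=e^{tA}$, $t\ge0$, be the strongly continuous semigroup generated by $A$. Let $C_1,C_2>0$ be constants with $$\|v\|_{L^4(I)}\le C_1C_2\,\|v\|_H^{1/2}\,\|v\|_V^{1/2}\qquad\text{for all }v\in V$$ (for example, constants with $\|v\|_{L^4}\le C_1\|v\|_{H^{1/2}}$ and $\|v\|_{H^{1/2}}\le C_2\|v\|_{L^2}^{1/2}\|v\|_{H^1}^{1/2}$). Let $T>0$ and $E=L^4(0,T;L^4(I))$. Let $w$ be a $Q$-Wiener process with values in $H$ ($Q$ symmetric, nonnegative, trace class) on a probability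 space $(\Omega,\mathcal F,\mathbb P)$, and let $w_A(t)=\int_0^tS(t-s)\,dw(s)$, $t\in[0,T]$, denote the version of the stochastic convolution with paths that are almost surely continuous with values in $L^4(I)$. Let $F:E\to E$ be the continuous extension of the map $F_0:C^1([0,T];V)\to E$, $$(F_0u)(t)=\int_0^tS(t-s)\big[-u(s)u_x(s)+c\,u(s)\big]\,ds .$$ Then, $\mathbb P$-almost surely, the following holds for every $u_0\in H$ and every solution $y\in E$ of $$y(t)=S(t)u_0+F(y+w_A)(t),\qquad t\in[0,T],$$ where the equation is understood in $E$. The function $y$ has a (necessarily unique) representative in $C([0,T];H)$, again denoted by $y$; moreover $y\in L^2(0,T;V)$, and $$\sup_{t\in[0,T]}\|y(t)\|_H^2\le\|u_0\|_H^2\,e^{\int_0^Tf(s)\,ds}+\int_0^Te^{\int_0^Tf(s)\,ds}\,g(\tau)\,d\tau ,$$ $$\int_0^T\|y(t)\|_V^2\,dt\le\|u_0\|_H^2+\sup_{s\in[0,T]}\|y(s)\|_H^2\int_0^Tf(\tau)\,d\tau+\int_0^Tg(\tau)\,d\tau ,$$ where $$f(t)=\tfrac12\Big(2c+\big(2+\tfrac34C_1C_2\big)^2+C_1C_2\,\|w_A(t)\|_{L^4(I)}^4\Big),\qquad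 g(t)=c\,\|w_A(t)\|_H^2+\tfrac14\,\|w_A(t)\|_{L^4(I)}^4 .$$ -/

import Mathlib

open MeasureTheory ProbabilityTheory Filter Topology Set
open scoped ENNReal NNReal

namespace KS

noncomputable section

/-- Lebesgue measure on the interval `I = (-l, l)`. -/
abbrev mu (l : ℝ) : Measure ℝ := volume.restrict (Ioo (-l) l)

/-- The space `H = L²(I)`. -/
abbrev H (l : ℝ) : Type := Lp ℝ 2 (mu l)

instance (l : ℝ) : MeasurableSpace (H l) := borel (H l)

instance (l : ℝ) : BorelSpace (H l) := ⟨rfl⟩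

/-- The pairs `(φ, φ')` in `L²(I) × L²(I)`, where `φ` is smooth up to the endpoints of `I` and
vanishes at both endpoints. -/
def smoothPairs (l : ℝ) : Submodule ℝ (WithLp 2 (H l × H l)) where
  carrier := {p | ∃ φ : ℝ → ℝ, ContDiff ℝ (⊤ : ℕ∞) φ ∧ φ (-l) = 0 ∧ φ l = 0 ∧
    p.fst =ᵐ[mu l] φ ∧ p.snd =ᵐ[mu l] deriv φ}
  zero_mem' := by
    refine ⟨fun _ => 0, contDiff_const, rfl, rfl, ?_, ?_⟩
    · exact Lp.coeFn_zero ℝ 2 (mu l)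
    · have h : deriv (fun _ : ℝ => (0 : ℝ)) = 0 := by ext x; simp
      rw [h]
      exact Lp.coeFn_zero ℝ 2 (mu l)
  add_mem' := by
    rintro p q ⟨φ, hφ, h1, h2, h3, h4⟩ ⟨ψ, hψ, k1, k2, k3, k4⟩
    refine ⟨fun x => φ x + ψ x, hφ.add hψ, by simp [h1, k1], by simp [h2, k2], ?_, ?_⟩
    · filter_upwards [Lp.coeFn_add p.fst q.fst, h3, k3] with x hx hx1 hx2
      rw [WithLp.add_fst, hx, Pi.add_apply, hx1, hx2]
    · filter_upwards [Lp.coeFn_add p.snd q.snd, h4, k4] with x hx hx1 hx2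
      rw [WithLp.add_snd, hx, Pi.add_apply, hx1, hx2,
        deriv_fun_add (hφ.differentiable (by simp) x) (hψ.differentiable (by simp) x)]
  smul_mem' := by
    rintro a p ⟨φ, hφ, h1, h2, h3, h4⟩
    refine ⟨fun x => a * φ x, contDiff_const.mul hφ, by simp [h1], by simp [h2], ?_, ?_⟩
    · filter_upwards [Lp.coeFn_smul a p.fst, h3] with x hx hx1
      rw [WithLp.smul_fst, hx, Pi.smul_apply, hx1, smul_eq_mul]
    · filter_upwards [Lp.coeFn_smul a p.snd, h4] with x hx hx1
      rw [WithLp.smul_snd, hx, Pi.smul_apply, hx1, smul_eq_mul,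
        deriv_const_mul _ (hφ.differentiable (by simp) x)]

/-- The space `V = H₀¹(I)`: the closure of the smooth functions vanishing at the endpoints in the
norm `(∫ |v|² + ∫ |v'|²)^(1/2)`. An element is stored as the pair `(v, v')` of the function and
its weak derivative, so that the norm of `V l` is exactly that norm. -/
def V (l : ℝ) : Submodule ℝ (WithLp 2 (H l × H l)) := (smoothPairs l).topologicalClosure

/-- The function in `L²(I)` underlying an element of `V`. -/
def Vfn {l : ℝ} (v : V l) : H l := v.1.fst

/-- The weak derivative of an element of `V`. -/
def Vdx {l : ℝ} (v : V l) : H l := v.1.snd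

lemma smoothPairs_bound {l : ℝ} {p : WithLp 2 (H l × H l)} (hp : p ∈ smoothPairs l) :
    ∀ᵐ x ∂(mu l), ‖p.fst x‖ ≤ (mu l).real univ ^ (1 / 2 : ℝ) * ‖p.snd‖ := by
  obtain ⟨φ, hφ, h1, -, h3, h4⟩ := hp
  have hd : Continuous (deriv φ) := hφ.continuous_deriv (by simp)
  have hmem : MemLp (deriv φ) 2 (mu l) := (memLp_congr_ae h4).1 (Lp.memLp p.snd)
  have hL1 : (∫ x in Ioo (-l) l, ‖deriv φ x‖) ≤ (mu l).real univ ^ (1 / 2 : ℝ) * ‖p.snd‖ := by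
    have e1 := eLpNorm_le_eLpNorm_mul_rpow_measure_univ (p := 1) (q := 2) (μ := mu l)
      (by norm_num) hmem.aestronglyMeasurable
    have e2 : ‖p.snd‖ = (eLpNorm (deriv φ) 2 (mu l)).toReal := by
      rw [Lp.norm_def, eLpNorm_congr_ae h4]
    rw [integral_norm_eq_lintegral_enorm hd.aestronglyMeasurable, ← eLpNorm_one_eq_lintegral_enorm,
      e2, mul_comm]
    have e3 : (mu l).real univ ^ (1 / 2 : ℝ) = ((mu l) univ ^ (1 / 2 : ℝ)).toReal := by
      rw [Measure.real, ENNReal.toReal_rpow]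
    rw [e3, ← ENNReal.toReal_mul]
    refine ENNReal.toReal_mono ?_ ?_
    · exact ENNReal.mul_ne_top hmem.eLpNorm_ne_top
        (ENNReal.rpow_ne_top_of_nonneg (by norm_num) (measure_ne_top _ _))
    · refine e1.trans (le_of_eq ?_)
      norm_num
  filter_upwards [h3, ae_restrict_mem measurableSet_Ioo] with x hx hxI
  rw [hx]
  refine le_trans ?_ hL1
  have hftc : ∫ s in (-l)..x, deriv φ s = φ x - φ (-l) :=
    intervalIntegral.integral_deriv_eq_sub
      (fun s _ => hφ.differentiable (by simp) s) (hd.intervalIntegrable _ _)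
  rw [h1, sub_zero] at hftc
  rw [← hftc]
  refine (intervalIntegral.norm_integral_le_integral_norm hxI.1.le).trans ?_
  rw [intervalIntegral.integral_of_le hxI.1.le, ← integral_Icc_eq_integral_Ioc,
    ← integral_Icc_eq_integral_Ioo]
  refine setIntegral_mono_set ?_ ?_ ?_
  · exact hd.norm.continuousOn.integrableOn_Icc
  · exact Eventually.of_forall fun _ => norm_nonneg _
  · exact (Icc_subset_Icc_right hxI.2.le).eventuallyLE

lemma Vfn_bound {l : ℝ} (v : V l) :
    ∀ᵐ x ∂(mu l), ‖Vfn v x‖ ≤ (mu l).real univ ^ (1 / 2 : ℝ) * ‖Vdx v‖ := by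
  obtain ⟨p, hp, hlim⟩ := mem_closure_iff_seq_limit.1
    (show (v : WithLp 2 (H l × H l)) ∈ closure (smoothPairs l : Set _) from v.2)
  have hf : Tendsto (fun n => (p n).fst) atTop (𝓝 (Vfn v)) :=
    ((WithLp.fstL 2 ℝ (H l) (H l)).continuous.tendsto _).comp hlim
  have hs : Tendsto (fun n => (p n).snd) atTop (𝓝 (Vdx v)) :=
    ((WithLp.sndL 2 ℝ (H l) (H l)).continuous.tendsto _).comp hlim
  obtain ⟨ns, hns, hae⟩ := (tendstoInMeasure_of_tendsto_Lp hf).exists_seq_tendsto_ae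
  have hall : ∀ᵐ x ∂(mu l), ∀ n,
      ‖(p n).fst x‖ ≤ (mu l).real univ ^ (1 / 2 : ℝ) * ‖(p n).snd‖ :=
    ae_all_iff.2 fun n => smoothPairs_bound (hp n)
  filter_upwards [hae, hall] with x hx hb
  exact le_of_tendsto_of_tendsto' hx.norm
    ((hs.norm.const_mul _).comp hns.tendsto_atTop) fun n => hb (ns n)

/-- For `v ∈ V` the function `-v v' + c v` is square integrable, as `v` is bounded. -/
lemma memLp_nonlinearity {l : ℝ} (c : ℝ) (v : V l) :
    MemLp (fun x => -((Vfn v) x * (Vdx v) x) + c * (Vfn v) x) 2 (mu l) := by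
  have h1 : MemLp ((Vdx v) : ℝ → ℝ) 2 (mu l) := Lp.memLp _
  have h2 : MemLp ((Vfn v) : ℝ → ℝ) 2 (mu l) := Lp.memLp _
  refine MemLp.add (MemLp.neg ?_) (h2.const_mul c)
  exact h1.mul (p := ∞) (q := 2) (memLp_top_of_bound h2.aestronglyMeasurable _ (Vfn_bound v))

/-- `G₀(v) = -v vₓ + c v` as an element of `H`, for `v ∈ V`. -/
def G0 {l : ℝ} (c : ℝ) (v : V l) : H l := (memLp_nonlinearity c v).toLp

/-- Two choices of the second boundary condition at each endpoint, next to `u = 0`. -/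
inductive BC : Type
  | clamped
  | hinged

/-- The order of the derivative that vanishes at the endpoints: `u' = 0` for the clamped and
`u'' = 0` for the hinged condition. -/
def BC.order : BC → ℕ
  | BC.clamped => 1
  | BC.hinged => 2

/-- The graph of `A u = -u'''' - u'' - c u` in `L²(I)`: `u` has a representative `φ` of class `C³`
whose third derivative is absolutely continuous with derivative `g ∈ L²(I)` (so `u ∈ H⁴(I)` and
`u'''' = g`), `φ` and its derivative of order `bc.order` vanish at both endpoints, and
`w = -g - φ'' - c φ`. -/
def IsA (l c : ℝ) (bc : BC) (u w : H l) : Prop :=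
  ∃ (φ : ℝ → ℝ) (g : H l), ContDiff ℝ 3 φ ∧
    (∀ x ∈ Icc (-l) l, iteratedDeriv 3 φ x = iteratedDeriv 3 φ (-l) + ∫ s in (-l)..x, g s) ∧
    φ (-l) = 0 ∧ φ l = 0 ∧
    iteratedDeriv bc.order φ (-l) = 0 ∧ iteratedDeriv bc.order φ l = 0 ∧
    u =ᵐ[mu l] φ ∧ w =ᵐ[mu l] fun x => -g x - iteratedDeriv 2 φ x - c * φ x

/-- `S(t) = e^{tA}`, `t ≥ 0`: the strongly continuous semigroup whose infinitesimal generator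
has the graph `A` (values of `S` at negative times are irrelevant). -/
structure IsSemigroup {l : ℝ} (A : H l → H l → Prop) (S : ℝ → H l →L[ℝ] H l) : Prop where
  zero : S 0 = ContinuousLinearMap.id ℝ (H l)
  add : ∀ s t, 0 ≤ s → 0 ≤ t → S (s + t) = (S s).comp (S t)
  strong : ∀ u, Tendsto (fun t => S t u) (𝓝[>] 0) (𝓝 u)
  generator : ∀ u w, A u w ↔ Tendsto (fun t : ℝ => t⁻¹ • (S t u - u)) (𝓝[>] 0) (𝓝 w)

/-- The `L⁴(I)` norm, in `[0, ∞]`. -/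
def L4e {l : ℝ} (u : H l) : ℝ≥0∞ := eLpNorm u 4 (mu l)

/-- The `L⁴(I)` norm of an element of `L⁴(I)`, as a real number. -/
def L4 {l : ℝ} (u : H l) : ℝ := (L4e u).toReal

/-- The fourth power of the distance of `u` and `v` in `E = L⁴(0, T; L⁴(I))`. -/
def distE {l : ℝ} (T : ℝ) (u v : ℝ → H l) : ℝ≥0∞ := ∫⁻ t in Ioo 0 T, L4e (u t - v t) ^ 4

/-- Membership in `E = L⁴(0, T; L⁴(I))`. -/
def InE {l : ℝ} (T : ℝ) (u : ℝ → H l) : Prop :=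
  AEStronglyMeasurable u (volume.restrict (Ioo 0 T)) ∧ distE T u 0 < ∞

/-- `(F₀ v)(t) = ∫₀ᵗ S(t - s) (G₀ v)(s) ds`. -/
def F0 {l : ℝ} (S : ℝ → H l →L[ℝ] H l) (c : ℝ) (v : ℝ → V l) (t : ℝ) : H l :=
  ∫ s in (0 : ℝ)..t, S (t - s) (G0 c (v s))

/-- `z = F(u)`, where `F : E → E` is the continuous extension of `F₀ : C¹([0, T]; V) → E`:
`z` is the limit in `E` of `F₀ vₙ` for functions `vₙ ∈ C¹([0, T]; V)` that tend to `u` in `E`. -/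
def IsF {l : ℝ} (S : ℝ → H l →L[ℝ] H l) (c T : ℝ) (u z : ℝ → H l) : Prop :=
  InE T u ∧ InE T z ∧ ∃ v : ℕ → ℝ → V l, (∀ n, ContDiffOn ℝ 1 (v n) (Icc 0 T)) ∧
    Tendsto (fun n => distE T (fun t => Vfn (v n t)) u) atTop (𝓝 0) ∧
    Tendsto (fun n => distE T (F0 S c (v n)) z) atTop (𝓝 0)

/-- `y ∈ E` solves `y(t) = S(t) u₀ + F(y + w)(t)` on `[0, T]`, as an equation in `E`. -/
def IsSolution {l : ℝ} (S : ℝ → H l →L[ℝ] H l) (c T : ℝ) (u₀ : H l) (w y : ℝ → H l) : Prop :=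
  InE T y ∧ ∃ z, IsF S c T (fun t => y t + w t) z ∧
    ∀ᵐ t ∂(volume.restrict (Ioo 0 T)), y t = S t u₀ + z t

/-- `W` is a `Q`-Wiener process with values in `H`, on the time interval `[0, ∞)`. -/
structure IsQWiener {l : ℝ} {Ω : Type*} [MeasurableSpace Ω] (P : Measure Ω)
    (Q : H l →L[ℝ] H l) (W : ℝ → Ω → H l) : Prop where
  positive : Q.IsPositive
  trace : ∀ b : HilbertBasis ℕ ℝ (H l), Summable fun i => inner ℝ (Q (b i)) (b i)
  measurable : ∀ t, 0 ≤ t → Measurable (W t)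
  zero : ∀ᵐ ω ∂P, W 0 ω = 0
  continuous : ∀ᵐ ω ∂P, ContinuousOn (fun t => W t ω) (Ici 0)
  indep : HasIndepIncrements (fun (t : ℝ≥0) ω => W t ω) P
  /-- The increment `W(t) - W(s)` has the centred Gaussian law with covariance `(t - s) Q`. -/
  gaussian : ∀ s t, 0 ≤ s → s ≤ t → ∀ h : H l,
    P.map (fun ω => inner ℝ h (W t ω - W s ω)) =
      gaussianReal 0 (Real.toNNReal ((t - s) * inner ℝ (Q h) h))

/-- Continuity of a path `[0, T] → L⁴(I)`. -/
def ContinuousInL4 {l : ℝ} (T : ℝ) (w : ℝ → H l) : Prop :=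
  ∀ t ∈ Icc 0 T, L4e (w t) < ∞ ∧ Tendsto (fun s => L4e (w s - w t)) (𝓝[Icc 0 T] t) (𝓝 0)

/-- `wA` is the version, continuous with values in `L⁴(I)`, of the stochastic convolution
`w_A(t) = ∫₀ᵗ S(t - s) dW(s)` on `[0, T]`. The stochastic integral (its integrand is
deterministic and strongly continuous) is the limit in `L²(Ω; H)` of the Itô sums
`∑ S(t - sᵢ) (W(sᵢ₊₁) - W(sᵢ))` over the partitions `sᵢ = i t / n`. -/
structure IsStochasticConvolution {l : ℝ} {Ω : Type*} [MeasurableSpace Ω] (P : Measure Ω)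
    (S : ℝ → H l →L[ℝ] H l) (T : ℝ) (W wA : ℝ → Ω → H l) : Prop where
  measurable : ∀ t ∈ Icc 0 T, AEStronglyMeasurable (wA t) P
  integral : ∀ t ∈ Icc 0 T, Tendsto (fun n : ℕ => ∫⁻ ω,
    ‖(∑ i ∈ Finset.range n,
        S (t - i * t / n) (W ((i + 1) * t / n) ω - W (i * t / n) ω)) - wA t ω‖ₑ ^ 2 ∂P)
    atTop (𝓝 0)
  continuous : ∀ᵐ ω ∂P, ContinuousInL4 T (fun t => wA t ω)

/-- `f(t) = ½ (2 c + (2 + ¾ C₁ C₂)² + C₁ C₂ ‖w(t)‖_{L⁴}⁴)`. -/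
def fCoef {l : ℝ} (c C₁ C₂ : ℝ) (w : ℝ → H l) (t : ℝ) : ℝ :=
  1 / 2 * (2 * c + (2 + 3 / 4 * (C₁ * C₂)) ^ 2 + C₁ * C₂ * L4 (w t) ^ 4)

/-- `g(t) = c ‖w(t)‖_H² + ¼ ‖w(t)‖_{L⁴}⁴`. -/
def gCoef {l : ℝ} (c : ℝ) (w : ℝ → H l) (t : ℝ) : ℝ :=
  c * ‖w t‖ ^ 2 + 1 / 4 * L4 (w t) ^ 4

end

end KS

/-!
The argument is pathwise: it applies to every path `w` of the stochastic convolution that is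
continuous with values in `L⁴`.

A solution `y ∈ E` is the limit in `E` of the mild solutions with forcing `G₀(v n)`, where `v n` are
paths in `V` that tend to `y + w` in `E`. Averaging a mild solution over the semigroup, that is,
applying `ε⁻¹ ∫₀^ε S(r) dr`, gives a classical solution `z n` with values in the domain of `A`
(`exists_classical`), for which the energy balance holds (`IsClassical.energy`). In this balance the
quadratic form of `A` is bounded by `-(b - 2) ‖z'‖² + (b² / 8 - 2 c) ‖z‖²` with a free number `b`
(`IsA.exists_V`); here either choice of the second boundary condition annihilates `z' z''` at the
endpoints.
The nonlinearity is `⟪G₀(v), z⟫ = ½ ∫ v² z' + c ⟪v, z⟫` (`inner_G0`), which makes sense for `v ∈ L⁴`.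

The energy balance of `z n - z m` shows that `z n` is a Cauchy sequence in `C([0, T]; H)` and in
`L²(0, T; V)` (`IsClassical.norm_sub_le`), so that the limits are the continuous representative `Y`
of `y` and a representative `V'` with values in `V` (`exists_limit`). As `‖u‖₄⁴ ≤ 2 ‖u‖³ ‖u'‖` on
`V`, the sequence converges in `E` too. Hence `v n - z n - w` tends to zero in `E`
(`tendsto_integral_L4_error`), and with it the integral of the `defect`, the part of the forcing by
which the energy balance of `z n` differs from that of a solution (`tendsto_integral_defect`).

The two estimates of the theorem come from two pointwise inequalities in the limit, both with the
constant `κ = min (C₁ C₂) 1`, which is admissible in the interpolation inequality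
(`L4_pow_le_min`). With `b = 3 + 3 κ / 2` one has `d/dt ‖y‖² ≤ f ‖y‖² + g` (`energy_rate_le`), and
Grönwall's inequality gives the bound of the supremum. The bound in `L²(0, T; V)` comes from
`½ d/dt ‖y‖² + ‖y‖_V² ≤ f ‖y‖² + g` (`half_energy_rate_add_le`), which gives it with
`½ ‖u₀‖²` in place of `‖u₀‖²`. This inequality needs a lower bound of `κ`. If `l ≥ 1/4` then
`κ ≥ 1/2`, as a test function with support in `[-1/4, 1/4]` shows (`one_half_le_of_interpolation`);
on shorter intervals Poincaré's inequality replaces it.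
-/

namespace KS

noncomputable section

/-! ### The `L⁴` norm -/

lemma L4e_neg {l : ℝ} (u : H l) : L4e (-u) = L4e u := by
  rw [L4e, eLpNorm_congr_ae (Lp.coeFn_neg u), eLpNorm_neg, L4e]

lemma L4e_add_le {l : ℝ} (u v : H l) : L4e (u + v) ≤ L4e u + L4e v := by
  rw [L4e, eLpNorm_congr_ae (Lp.coeFn_add u v)]
  exact eLpNorm_add_le (Lp.aestronglyMeasurable u) (Lp.aestronglyMeasurable v) (by norm_num)

lemma L4e_sub_le {l : ℝ} (u v : H l) : L4e (u - v) ≤ L4e u + L4e v := by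
  rw [sub_eq_add_neg, ← L4e_neg v]
  exact L4e_add_le u (-v)

lemma L4e_sub_comm {l : ℝ} (u v : H l) : L4e (u - v) = L4e (v - u) := by
  rw [← neg_sub, L4e_neg]

lemma L4e_add_lt_top {l : ℝ} {u v : H l} (hu : L4e u < ∞) (hv : L4e v < ∞) : L4e (u + v) < ∞ :=
  (L4e_add_le u v).trans_lt (ENNReal.add_lt_top.2 ⟨hu, hv⟩)

lemma L4e_sub_lt_top {l : ℝ} {u v : H l} (hu : L4e u < ∞) (hv : L4e v < ∞) : L4e (u - v) < ∞ :=
  (L4e_sub_le u v).trans_lt (ENNReal.add_lt_top.2 ⟨hu, hv⟩)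

lemma L4_nonneg {l : ℝ} (u : H l) : 0 ≤ L4 u := ENNReal.toReal_nonneg

lemma ofReal_L4 {l : ℝ} {u : H l} (hu : L4e u < ∞) : ENNReal.ofReal (L4 u) = L4e u :=
  ENNReal.ofReal_toReal hu.ne

lemma L4_add_le {l : ℝ} {u v : H l} (hu : L4e u < ∞) (hv : L4e v < ∞) :
    L4 (u + v) ≤ L4 u + L4 v := by
  rw [L4, L4, L4, ← ENNReal.toReal_add hu.ne hv.ne]
  exact ENNReal.toReal_mono (ENNReal.add_lt_top.2 ⟨hu, hv⟩).ne (L4e_add_le u v)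

lemma L4_sub_comm {l : ℝ} (u v : H l) : L4 (u - v) = L4 (v - u) := by
  rw [L4, L4e_sub_comm, L4]

lemma abs_L4_sub_le {l : ℝ} {u v : H l} (hu : L4e u < ∞) (hv : L4e v < ∞) :
    |L4 u - L4 v| ≤ L4 (u - v) := by
  have h1 := L4_add_le (L4e_sub_lt_top hu hv) hv
  have h2 := L4_add_le (L4e_sub_lt_top hv hu) hu
  rw [sub_add_cancel] at h1 h2
  rw [L4_sub_comm v u] at h2
  exact abs_le.2 ⟨by linarith, by linarith⟩

/-- On the bounded interval the `L²` norm is controlled by the `L⁴` norm. -/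
lemma exists_enorm_le_L4e (l : ℝ) : ∃ K : ℝ≥0, ∀ u : H l, ‖u‖ₑ ≤ K * L4e u := by
  have hfin : (mu l) univ ^ (1 / (2 : ℝ) - 1 / 4) ≠ ∞ :=
    ENNReal.rpow_ne_top_of_nonneg (by norm_num) (measure_ne_top _ _)
  refine ⟨((mu l) univ ^ (1 / (2 : ℝ) - 1 / 4)).toNNReal, fun u => ?_⟩
  rw [ENNReal.coe_toNNReal hfin, mul_comm, Lp.enorm_def, L4e]
  have := eLpNorm_le_eLpNorm_mul_rpow_measure_univ (p := 2) (q := 4) (μ := mu l)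
    (by norm_num) (Lp.aestronglyMeasurable u)
  simpa using this

lemma exists_norm_le_L4 (l : ℝ) : ∃ K : ℝ, 0 ≤ K ∧ ∀ u : H l, L4e u < ∞ → ‖u‖ ≤ K * L4 u := by
  obtain ⟨K, hK⟩ := exists_enorm_le_L4e l
  refine ⟨K, K.2, fun u hu => ?_⟩
  have h := ENNReal.toReal_mono (ENNReal.mul_lt_top ENNReal.coe_lt_top hu).ne (hK u)
  rwa [toReal_enorm, ENNReal.toReal_mul] at h

/-- The `L⁴` norm is lower semicontinuous on `L²`, by Fatou's lemma, and hence measurable. -/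
lemma measurable_L4e (l : ℝ) : Measurable (L4e : H l → ℝ≥0∞) := by
  refine LowerSemicontinuous.measurable (lowerSemicontinuous_iff_isClosed_preimage.2 fun a => ?_)
  refine IsSeqClosed.isClosed fun u v hu huv => ?_
  obtain ⟨ns, -, hae⟩ := (tendstoInMeasure_of_tendsto_Lp huv).exists_seq_tendsto_ae
  refine (Lp.eLpNorm_lim_le_liminf_eLpNorm (p := 4)
    (fun n => Lp.aestronglyMeasurable (u (ns n))) v hae).trans ?_
  exact (liminf_le_liminf (Eventually.of_forall fun n => hu (ns n))).trans (by simp)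

lemma memLp_four {l : ℝ} {u : H l} (hu : L4e u < ∞) : MemLp u 4 (mu l) :=
  ⟨Lp.aestronglyMeasurable u, hu⟩

instance holderTriple_four_four_two : ENNReal.HolderTriple 4 4 2 where
  inv_add_inv_eq_inv := by
    rw [← ENNReal.toReal_eq_toReal_iff' (by simp) (by simp)]
    rw [ENNReal.toReal_add (by simp) (by simp)]
    norm_num

lemma memLp_mul {l : ℝ} {u v : H l} (hu : L4e u < ∞) (hv : L4e v < ∞) :
    MemLp (fun x => u x * v x) 2 (mu l) :=
  (memLp_four hv).mul (p := 4) (q := 4) (memLp_four hu)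

/-- The integral `∫ u v z` over the interval, for `u, v ∈ L⁴` and `z ∈ L²`. -/
def triple {l : ℝ} (u v z : H l) : ℝ := ∫ x, u x * v x * z x ∂(mu l)

lemma integrable_triple {l : ℝ} {u v : H l} (hu : L4e u < ∞) (hv : L4e v < ∞) (z : H l) :
    Integrable (fun x => u x * v x * z x) (mu l) :=
  (memLp_mul hu hv).integrable_mul (Lp.memLp z)

lemma triple_eq_inner {l : ℝ} {u v : H l} (hu : L4e u < ∞) (hv : L4e v < ∞) (z : H l) :
    triple u v z = inner ℝ (memLp_mul hu hv).toLp z := by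
  rw [L2.inner_def, triple]
  refine integral_congr_ae ?_
  filter_upwards [(memLp_mul hu hv).coeFn_toLp] with x hx
  rw [hx]
  simp [mul_comm]

/-- Hölder's inequality with the exponents `4, 4, 2`. -/
lemma abs_triple_le {l : ℝ} {u v : H l} (hu : L4e u < ∞) (hv : L4e v < ∞) (z : H l) :
    |triple u v z| ≤ L4 u * L4 v * ‖z‖ := by
  rw [triple_eq_inner hu hv]
  refine (abs_real_inner_le_norm _ _).trans ?_
  gcongr
  rw [Lp.norm_toLp, L4, L4, ← ENNReal.toReal_mul]
  refine ENNReal.toReal_mono (ENNReal.mul_lt_top hu hv).ne ?_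
  exact eLpNorm_smul_le_mul_eLpNorm (p := 4) (q := 4) (r := 2) (f := v) (φ := u)
    (Lp.aestronglyMeasurable v) (Lp.aestronglyMeasurable u)

lemma triple_comm {l : ℝ} (u v z : H l) : triple u v z = triple v u z := by
  simp only [triple, mul_comm]

lemma triple_add_left {l : ℝ} {u u' v : H l} (hu : L4e u < ∞) (hu' : L4e u' < ∞)
    (hv : L4e v < ∞) (z : H l) : triple (u + u') v z = triple u v z + triple u' v z := by
  rw [triple, triple, triple, ← integral_add (integrable_triple hu hv z)
    (integrable_triple hu' hv z)]
  refine integral_congr_ae ?_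
  filter_upwards [Lp.coeFn_add u u'] with x hx
  rw [hx, Pi.add_apply]
  ring

lemma triple_sub_left {l : ℝ} {u u' v : H l} (hu : L4e u < ∞) (hu' : L4e u' < ∞)
    (hv : L4e v < ∞) (z : H l) : triple (u - u') v z = triple u v z - triple u' v z := by
  have := triple_add_left (L4e_sub_lt_top hu hu') hu' hv z
  rw [sub_add_cancel] at this
  linarith

lemma L4e_pow_eq {l : ℝ} (u : H l) : L4e u ^ 4 = ∫⁻ x, ‖u x‖ₑ ^ 4 ∂(mu l) := by
  have := eLpNorm_nnreal_pow_eq_lintegral (f := u) (p := 4) (μ := mu l) (by norm_num)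
  rw [show (((4 : ℝ≥0) : ℝ)) = ((4 : ℕ) : ℝ) by norm_num] at this
  simp only [ENNReal.rpow_natCast] at this
  exact this

lemma L4_pow_eq {l : ℝ} (u : H l) : L4 u ^ 4 = ∫ x, u x ^ 4 ∂(mu l) := by
  rw [integral_eq_lintegral_of_nonneg_ae (f := fun x => u x ^ 4)
    (Eventually.of_forall fun x => by positivity) ((Lp.aestronglyMeasurable u).pow 4), L4,
    ← ENNReal.toReal_pow, L4e_pow_eq]
  congr 1
  refine lintegral_congr fun x => ?_
  rw [← ofReal_norm, ← ENNReal.ofReal_pow (norm_nonneg _), ← norm_pow, Real.norm_of_nonneg]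
  positivity

/-! ### The space `V` -/

lemma norm_V_sq {l : ℝ} (v : V l) : ‖v‖ ^ 2 = ‖Vfn v‖ ^ 2 + ‖Vdx v‖ ^ 2 :=
  WithLp.prod_norm_sq_eq_of_L2 v.1

lemma norm_Vfn_le {l : ℝ} (v : V l) : ‖Vfn v‖ ≤ ‖v‖ :=
  abs_le_of_sq_le_sq' (by rw [norm_V_sq]; nlinarith [sq_nonneg ‖Vdx v‖]) (norm_nonneg _) |>.2

lemma norm_Vdx_le {l : ℝ} (v : V l) : ‖Vdx v‖ ≤ ‖v‖ :=
  abs_le_of_sq_le_sq' (by rw [norm_V_sq]; nlinarith [sq_nonneg ‖Vfn v‖]) (norm_nonneg _) |>.2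

lemma Vfn_sub {l : ℝ} (v w : V l) : Vfn (v - w) = Vfn v - Vfn w := rfl

lemma Vdx_sub {l : ℝ} (v w : V l) : Vdx (v - w) = Vdx v - Vdx w := rfl

lemma continuous_Vfn {l : ℝ} : Continuous (Vfn : V l → H l) :=
  (WithLp.fstL 2 ℝ (H l) (H l)).continuous.comp continuous_subtype_val

lemma continuous_Vdx {l : ℝ} : Continuous (Vdx : V l → H l) :=
  (WithLp.sndL 2 ℝ (H l) (H l)).continuous.comp continuous_subtype_val

instance (l : ℝ) : CompleteSpace (V l) :=
  (smoothPairs l).isClosed_topologicalClosure.completeSpace_coe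

/-- A closed property of pairs `(v, v')` that holds for the smooth functions vanishing at the
endpoints holds on `V`. -/
lemma V_induction {l : ℝ} {s : Set (WithLp 2 (H l × H l))} (hs : IsClosed s)
    (h : ∀ p ∈ smoothPairs l, p ∈ s) (v : V l) : v.1 ∈ s :=
  hs.closure_subset_iff.2 h v.2

lemma memLp_of_continuous {l : ℝ} {φ : ℝ → ℝ} (hφ : Continuous φ) (p : ℝ≥0∞) :
    MemLp φ p (mu l) := by
  obtain ⟨B, hB⟩ := (isCompact_Icc (a := -l) (b := l)).exists_bound_of_continuousOn
    hφ.continuousOn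
  refine MemLp.of_bound hφ.aestronglyMeasurable B ?_
  filter_upwards [ae_restrict_mem measurableSet_Ioo] with x hx
  exact hB x (Ioo_subset_Icc_self hx)

lemma integral_mu_eq {l : ℝ} (hl : 0 < l) (φ : ℝ → ℝ) :
    ∫ x, φ x ∂(mu l) = ∫ x in (-l)..l, φ x := by
  rw [intervalIntegral.integral_of_le (by linarith), integral_Ioc_eq_integral_Ioo]

lemma integral_deriv_smooth {l : ℝ} (hl : 0 < l) {φ : ℝ → ℝ} (hφ : ContDiff ℝ 1 φ) :
    ∫ x, deriv φ x ∂(mu l) = φ l - φ (-l) := by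
  rw [integral_mu_eq hl]
  exact intervalIntegral.integral_deriv_eq_sub (fun s _ => hφ.differentiable (by simp) s)
    ((hφ.continuous_deriv le_rfl).intervalIntegrable _ _)

/-- A function of class `C¹` that vanishes at the endpoints belongs to `V`: approximate its
derivative uniformly by polynomials, correct the mean value, and integrate. -/
lemma exists_V_of_contDiff {l : ℝ} (hl : 0 < l) {φ : ℝ → ℝ} (hφ : ContDiff ℝ 1 φ)
    (h1 : φ (-l) = 0) (h2 : φ l = 0) :
    ∃ v : V l, Vfn v =ᵐ[mu l] φ ∧ Vdx v =ᵐ[mu l] deriv φ := by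
  have hd : Continuous (deriv φ) := hφ.continuous_deriv le_rfl
  set a : H l := (memLp_of_continuous hφ.continuous 2).toLp with ha
  set b : H l := (memLp_of_continuous hd 2).toLp with hb
  have key : WithLp.toLp 2 (a, b) ∈ closure (smoothPairs l : Set (WithLp 2 (H l × H l))) := by
    have happrox : ∀ n : ℕ, ∃ χ : ℝ → ℝ, ContDiff ℝ (⊤ : ℕ∞) χ ∧ ∫ x in (-l)..l, χ x = 0 ∧
        ∀ x ∈ Icc (-l) l, |χ x - deriv φ x| ≤ 2 * (1 / ((n : ℝ) + 1)) := by
      intro n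
      have hε : 0 < 1 / ((n : ℝ) + 1) := by positivity
      obtain ⟨q, hq⟩ := exists_polynomial_near_of_continuousOn (-l) l (deriv φ) hd.continuousOn
        (1 / ((n : ℝ) + 1)) hε
      set m : ℝ := (2 * l)⁻¹ * ∫ x in (-l)..l, q.eval x with hm
      have hmle : |m| ≤ 1 / ((n : ℝ) + 1) := by
        have e1 : ∫ x in (-l)..l, q.eval x = ∫ x in (-l)..l, (q.eval x - deriv φ x) := by
          rw [intervalIntegral.integral_sub (q.continuous.intervalIntegrable _ _)
            (hd.intervalIntegrable _ _), ← integral_mu_eq hl (deriv φ), integral_deriv_smooth hl hφ,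
            h1, h2]
          simp
        have e2 : ‖∫ x in (-l)..l, (q.eval x - deriv φ x)‖ ≤ 1 / ((n : ℝ) + 1) * |l - -l| := by
          refine intervalIntegral.norm_integral_le_of_norm_le_const fun x hx => ?_
          rw [uIoc_of_le (by linarith)] at hx
          exact (hq x (Ioc_subset_Icc_self hx)).le
        rw [hm, e1, abs_mul, abs_of_pos (by positivity)]
        rw [show l - -l = 2 * l by ring, abs_of_pos (by positivity : 0 < 2 * l),
          Real.norm_eq_abs] at e2
        calc (2 * l)⁻¹ * |∫ x in (-l)..l, (q.eval x - deriv φ x)|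
            ≤ (2 * l)⁻¹ * (1 / ((n : ℝ) + 1) * (2 * l)) := by gcongr
          _ = 1 / ((n : ℝ) + 1) := by field_simp
      have hqs : ContDiff ℝ (⊤ : ℕ∞) fun x => q.eval x := by
        simpa using Polynomial.contDiff_aeval (R := ℝ) (𝕜 := ℝ) q _
      refine ⟨fun x => q.eval x - m, hqs.sub contDiff_const, ?_, fun x hx => ?_⟩
      · rw [intervalIntegral.integral_sub (q.continuous.intervalIntegrable _ _)
          (continuous_const.intervalIntegrable _ _), intervalIntegral.integral_const, hm]
        simp only [smul_eq_mul]
        field_simp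
        ring
      · have := hq x hx
        calc |q.eval x - m - deriv φ x| = |(q.eval x - deriv φ x) - m| := by ring_nf
          _ ≤ |q.eval x - deriv φ x| + |m| := abs_sub _ _
          _ ≤ _ := by linarith
    choose χ hχs hχ0 hχ using happrox
    set Φ : ℕ → ℝ → ℝ := fun n x => ∫ s in (-l)..x, χ n s with hΦ
    have hder : ∀ n x, HasDerivAt (Φ n) (χ n x) x := fun n x =>
      intervalIntegral.integral_hasDerivAt_right ((hχs n).continuous.intervalIntegrable _ _)
        ((hχs n).continuous.stronglyMeasurableAtFilter _ _) (hχs n).continuous.continuousAt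
    have hderiv : ∀ n, deriv (Φ n) = χ n := fun n => funext fun x => (hder n x).deriv
    have hsm : ∀ n, ContDiff ℝ (⊤ : ℕ∞) (Φ n) := fun n => by
      rw [contDiff_infty_iff_deriv]
      exact ⟨fun x => (hder n x).differentiableAt, by rw [hderiv]; exact hχs n⟩
    have hΦφ : ∀ n, ∀ x ∈ Icc (-l) l, |Φ n x - φ x| ≤ 2 * (1 / ((n : ℝ) + 1)) * (2 * l) := by
      intro n x hx
      have e1 : φ x = ∫ s in (-l)..x, deriv φ s := by
        rw [intervalIntegral.integral_deriv_eq_sub (fun s _ => hφ.differentiable (by simp) s)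
          (hd.intervalIntegrable _ _), h1, sub_zero]
      rw [e1, hΦ]
      simp only
      rw [← intervalIntegral.integral_sub ((hχs n).continuous.intervalIntegrable _ _)
        (hd.intervalIntegrable _ _)]
      rw [← Real.norm_eq_abs]
      refine (intervalIntegral.norm_integral_le_of_norm_le_const
        (C := 2 * (1 / ((n : ℝ) + 1))) fun s hs => ?_).trans ?_
      · rw [uIoc_of_le hx.1] at hs
        exact hχ n s ⟨hs.1.le, hs.2.trans hx.2⟩
      · gcongr
        rw [abs_of_nonneg (by linarith [hx.1])]
        linarith [hx.2]
    have hlim0 : Tendsto (fun n : ℕ => 1 / ((n : ℝ) + 1)) atTop (𝓝 0) :=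
      tendsto_one_div_add_atTop_nhds_zero_nat
    have hconv : ∀ (ψ : ℕ → ℝ → ℝ) (ψ' : ℝ → ℝ) (hψ : ∀ n, Continuous (ψ n))
        (hψ' : Continuous ψ') (B : ℝ),
        (∀ n, ∀ x ∈ Icc (-l) l, |ψ n x - ψ' x| ≤ 2 * (1 / ((n : ℝ) + 1)) * B) → 0 ≤ B →
        Tendsto (fun n => ((memLp_of_continuous (l := l) (hψ n) 2).toLp : H l)) atTop
          (𝓝 (memLp_of_continuous hψ' 2).toLp) := by
      intro ψ ψ' hψ hψ' B hB hB0
      rw [tendsto_iff_norm_sub_tendsto_zero]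
      refine squeeze_zero (fun n => norm_nonneg _)
        (g := fun n : ℕ => (measureUnivNNReal (mu l) : ℝ) ^ ((2 : ℝ≥0∞).toReal)⁻¹ *
          (2 * (1 / ((n : ℝ) + 1)) * B)) (fun n => ?_) ?_
      · refine Lp.norm_le_of_ae_bound (by positivity) ?_
        filter_upwards [Lp.coeFn_sub (memLp_of_continuous (l := l) (hψ n) 2).toLp
          (memLp_of_continuous hψ' 2).toLp, (memLp_of_continuous (l := l) (hψ n) 2).coeFn_toLp,
          (memLp_of_continuous (l := l) hψ' 2).coeFn_toLp,
          ae_restrict_mem measurableSet_Ioo] with x hx hx1 hx2 hxI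
        rw [hx, Pi.sub_apply, hx1, hx2]
        exact hB n x (Ioo_subset_Icc_self hxI)
      · simpa using ((hlim0.const_mul 2).mul_const B).const_mul
          ((measureUnivNNReal (mu l) : ℝ) ^ ((2 : ℝ≥0∞).toReal)⁻¹)
    refine mem_closure_of_tendsto (f := fun n : ℕ => WithLp.toLp 2
      ((memLp_of_continuous (l := l) (hsm n).continuous 2).toLp,
        (memLp_of_continuous (l := l) (hχs n).continuous 2).toLp)) (b := atTop) ?_ ?_
    · refine ((WithLp.prod_continuous_toLp 2 (H l) (H l)).tendsto _).comp ?_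
      exact (hconv Φ φ (fun n => (hsm n).continuous) hφ.continuous (2 * l) hΦφ
        (by positivity)).prodMk_nhds (hconv χ (deriv φ) (fun n => (hχs n).continuous) hd 1
          (fun n x hx => by simpa using hχ n x hx) zero_le_one)
    · refine Eventually.of_forall fun n => ?_
      refine ⟨Φ n, hsm n, ?_, ?_, ?_, ?_⟩
      · simp [hΦ]
      · exact hχ0 n
      · exact (memLp_of_continuous (hsm n).continuous 2).coeFn_toLp
      · rw [hderiv]
        exact (memLp_of_continuous (hχs n).continuous 2).coeFn_toLp
  exact ⟨⟨WithLp.toLp 2 (a, b), key⟩, (memLp_of_continuous hφ.continuous 2).coeFn_toLp,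
    (memLp_of_continuous hd 2).coeFn_toLp⟩

/-! ### Integration by parts and embeddings of `V` -/

lemma inner_eq_integral {l : ℝ} (u v : H l) : inner ℝ u v = ∫ x, u x * v x ∂(mu l) := by
  rw [L2.inner_def]
  simp [mul_comm]

lemma integrable_mul_H {l : ℝ} (u v : H l) : Integrable (fun x => u x * v x) (mu l) :=
  (Lp.memLp u).integrable_mul (Lp.memLp v)

/-- Multiplication by a continuous function, as a bounded operator on `L²(I)`. -/
def mulCont {l : ℝ} {φ : ℝ → ℝ} (hφ : Continuous φ) : H l →L[ℝ] H l :=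
  (ContinuousLinearMap.mul ℝ ℝ).holderL (mu l) ∞ 2 2 (memLp_of_continuous (l := l) hφ ∞).toLp

lemma coeFn_mulCont {l : ℝ} {φ : ℝ → ℝ} (hφ : Continuous φ) (u : H l) :
    mulCont hφ u =ᵐ[mu l] fun x => φ x * u x := by
  filter_upwards [(ContinuousLinearMap.mul ℝ ℝ).coeFn_holder (r := 2)
    (memLp_of_continuous (l := l) hφ ∞).toLp u,
    (memLp_of_continuous (l := l) hφ ∞).coeFn_toLp] with x hx hx1
  rw [mulCont, ContinuousLinearMap.holderL_apply_apply, hx, hx1]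
  simp

lemma inner_mulCont {l : ℝ} {φ : ℝ → ℝ} (hφ : Continuous φ) (u v : H l) :
    inner ℝ u (mulCont hφ v) = ∫ x, u x * v x * φ x ∂(mu l) := by
  rw [inner_eq_integral]
  refine integral_congr_ae ?_
  filter_upwards [coeFn_mulCont hφ v] with x hx
  rw [hx]
  ring

/-- The pairing of `v'` with a `C¹` function `ψ`, by integration by parts; `ψ` need not vanish
at the endpoints, as `v` does. -/
lemma inner_Vdx_toLp {l : ℝ} (hl : 0 < l) {ψ : ℝ → ℝ} (hψ : ContDiff ℝ 1 ψ) (v : V l) :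
    inner ℝ (Vdx v) (memLp_of_continuous (l := l) hψ.continuous 2).toLp =
      - inner ℝ (Vfn v) (memLp_of_continuous (l := l) (hψ.continuous_deriv le_rfl) 2).toLp := by
  set a : H l := (memLp_of_continuous (l := l) hψ.continuous 2).toLp
  set b : H l := (memLp_of_continuous (l := l) (hψ.continuous_deriv le_rfl) 2).toLp
  refine V_induction (s := {p | inner ℝ p.snd a = - inner ℝ p.fst b}) ?_ ?_ v
  · have c1 : Continuous fun p : WithLp 2 (H l × H l) => p.fst :=
      (WithLp.fstL 2 ℝ (H l) (H l)).continuous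
    have c2 : Continuous fun p : WithLp 2 (H l × H l) => p.snd :=
      (WithLp.sndL 2 ℝ (H l) (H l)).continuous
    exact isClosed_eq (c2.inner continuous_const) (c1.inner continuous_const).neg
  · rintro p ⟨φ, hφ, h1, h2, h3, h4⟩
    have hφ1 : ContDiff ℝ 1 φ := hφ.of_le (by exact_mod_cast le_top)
    have e := integral_deriv_smooth hl (hφ1.mul hψ)
    have hi1 : Integrable (fun x => p.snd x * a x) (mu l) := integrable_mul_H _ _
    have hi2 : Integrable (fun x => p.fst x * b x) (mu l) := integrable_mul_H _ _
    rw [mem_ofPred_eq, eq_neg_iff_add_eq_zero, inner_eq_integral, inner_eq_integral,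
      ← integral_add hi1 hi2]
    simp only [h1, h2, zero_mul, sub_zero] at e
    rw [← e]
    refine integral_congr_ae ?_
    filter_upwards [h3, h4, (memLp_of_continuous (l := l) hψ.continuous 2).coeFn_toLp,
      (memLp_of_continuous (l := l) (hψ.continuous_deriv le_rfl) 2).coeFn_toLp] with x e1 e2 e3 e4
    rw [e1, e2, e3, e4]
    exact ((hφ1.differentiable (by simp) x).hasDerivAt.mul
      (hψ.differentiable (by simp) x).hasDerivAt).deriv.symm

/-- An element of `V` is determined by the underlying function. -/
lemma Vfn_injective {l : ℝ} (hl : 0 < l) : Function.Injective (Vfn : V l → H l) := by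
  have key : ∀ v : V l, Vfn v = 0 → v = 0 := by
    intro v hv
    have hd : Vdx v = 0 := by
      rw [Lp.eq_zero_iff_ae_eq_zero]
      refine ae_eq_zero_of_integral_contDiff_smul_eq_zero
        (((Lp.memLp (Vdx v)).integrable (by norm_num)).locallyIntegrable) fun ψ hψ _ => ?_
      have hψ1 : ContDiff ℝ 1 ψ := hψ.of_le (by exact_mod_cast le_top)
      have h := inner_Vdx_toLp hl hψ1 v
      rw [hv, inner_zero_left, neg_zero, inner_eq_integral] at h
      rw [← h]
      refine integral_congr_ae ?_
      filter_upwards [(memLp_of_continuous (l := l) hψ1.continuous 2).coeFn_toLp] with x hx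
      rw [hx, smul_eq_mul, mul_comm]
    have hn : ‖v‖ ^ 2 = 0 := by rw [norm_V_sq, hv, hd]; simp
    exact norm_eq_zero.1 (pow_eq_zero_iff two_ne_zero |>.1 hn)
  intro v w hvw
  exact sub_eq_zero.1 (key _ (by rw [Vfn_sub, hvw, sub_self]))

/-- Agmon's inequality `‖v‖²_∞ ≤ 2 ‖v‖ ‖v'‖` on `V`. -/
lemma ae_sq_Vfn_le {l : ℝ} (v : V l) :
    ∀ᵐ x ∂(mu l), (Vfn v) x ^ 2 ≤ 2 * ‖Vfn v‖ * ‖Vdx v‖ := by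
  refine V_induction (s := {p : WithLp 2 (H l × H l) |
    ∀ᵐ x ∂(mu l), p.fst x ^ 2 ≤ 2 * ‖p.fst‖ * ‖p.snd‖}) ?_ ?_ v
  · refine IsSeqClosed.isClosed fun p q hp hpq => ?_
    have hf : Tendsto (fun n => (p n).fst) atTop (𝓝 q.fst) :=
      ((WithLp.fstL 2 ℝ (H l) (H l)).continuous.tendsto _).comp hpq
    have hs : Tendsto (fun n => (p n).snd) atTop (𝓝 q.snd) :=
      ((WithLp.sndL 2 ℝ (H l) (H l)).continuous.tendsto _).comp hpq
    obtain ⟨ns, hns, hae⟩ := (tendstoInMeasure_of_tendsto_Lp hf).exists_seq_tendsto_ae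
    have hall : ∀ᵐ x ∂(mu l), ∀ n, (p n).fst x ^ 2 ≤ 2 * ‖(p n).fst‖ * ‖(p n).snd‖ :=
      ae_all_iff.2 fun n => hp n
    filter_upwards [hae, hall] with x hx hb
    exact le_of_tendsto_of_tendsto' (hx.pow 2)
      (((hf.norm.const_mul 2).mul hs.norm).comp hns.tendsto_atTop) fun n => hb (ns n)
  · rintro p ⟨φ, hφ, h1, h2, h3, h4⟩
    have hφ1 : ContDiff ℝ 1 φ := hφ.of_le (by exact_mod_cast le_top)
    have hd : Continuous (deriv φ) := hφ1.continuous_deriv le_rfl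
    have hc := hφ1.continuous
    have hint : ∫ s in Ioo (-l) l, |φ s * deriv φ s| ≤ ‖p.fst‖ * ‖p.snd‖ := by
      have e1 : ∫ s in Ioo (-l) l, |φ s * deriv φ s| = inner ℝ |p.fst| |p.snd| := by
        rw [inner_eq_integral]
        refine integral_congr_ae ?_
        filter_upwards [h3, h4, Lp.coeFn_abs p.fst, Lp.coeFn_abs p.snd] with x e1 e2 e3 e4
        rw [e3, e4, e1, e2, abs_mul]
      rw [e1]
      refine (real_inner_le_norm _ _).trans ?_
      rw [norm_abs_eq_norm, norm_abs_eq_norm]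
    filter_upwards [h3, ae_restrict_mem measurableSet_Ioo] with x hx hxI
    rw [hx]
    have e2 : φ x ^ 2 = ∫ s in (-l)..x, 2 * (φ s * deriv φ s) := by
      have := intervalIntegral.integral_eq_sub_of_hasDerivAt (a := -l) (b := x)
        (f := fun s => φ s ^ 2) (f' := fun s => 2 * (φ s * deriv φ s)) (fun s _ => by
          have := (hφ1.differentiable (by simp) s).hasDerivAt.fun_pow 2
          refine this.congr_deriv ?_
          norm_num
          ring) ((continuous_const.mul (hc.mul hd)).intervalIntegrable _ _)
      rw [this, h1]
      ring
    have e3 : ∫ s in (-l)..x, (φ s * deriv φ s) ≤ ∫ s in Ioo (-l) l, |φ s * deriv φ s| := by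
      refine (le_abs_self _).trans
        ((intervalIntegral.abs_integral_le_integral_abs hxI.1.le).trans ?_)
      rw [intervalIntegral.integral_of_le hxI.1.le, ← integral_Icc_eq_integral_Ioc,
        ← integral_Icc_eq_integral_Ioo]
      refine setIntegral_mono_set ?_ ?_ ?_
      · exact (hc.mul hd).abs.continuousOn.integrableOn_Icc
      · exact Eventually.of_forall fun _ => abs_nonneg _
      · exact (Icc_subset_Icc_right hxI.2.le).eventuallyLE
    rw [e2, intervalIntegral.integral_const_mul]
    nlinarith [e3.trans hint]

/-- `‖v‖₄⁴ ≤ 2 ‖v‖³ ‖v'‖` on `V`. -/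
lemma L4e_Vfn_pow_le {l : ℝ} (v : V l) :
    L4e (Vfn v) ^ 4 ≤ ENNReal.ofReal (2 * ‖Vfn v‖ ^ 3 * ‖Vdx v‖) := by
  have h2 : ‖Vfn v‖ₑ ^ 2 = ∫⁻ x, ‖Vfn v x‖ₑ ^ 2 ∂(mu l) := by
    have := eLpNorm_nnreal_pow_eq_lintegral (f := Vfn v) (p := 2) (μ := mu l) (by norm_num)
    rw [show (((2 : ℝ≥0) : ℝ)) = ((2 : ℕ) : ℝ) by norm_num] at this
    simp only [ENNReal.rpow_natCast] at this
    rw [Lp.enorm_def]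
    exact this
  have hle : ∀ᵐ x ∂(mu l), ‖Vfn v x‖ₑ ^ 4 ≤
      ENNReal.ofReal (2 * ‖Vfn v‖ * ‖Vdx v‖) * ‖Vfn v x‖ₑ ^ 2 := by
    filter_upwards [ae_sq_Vfn_le v] with x hx
    rw [show (4 : ℕ) = 2 + 2 from rfl, pow_add]
    gcongr
    rw [← ofReal_norm, ← ENNReal.ofReal_pow (norm_nonneg _), Real.norm_eq_abs, sq_abs]
    exact ENNReal.ofReal_le_ofReal hx
  rw [L4e_pow_eq]
  refine (lintegral_mono_ae hle).trans (le_of_eq ?_)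
  rw [lintegral_const_mul' _ _ ENNReal.ofReal_ne_top, ← h2, ← ofReal_norm,
    ← ENNReal.ofReal_pow (norm_nonneg _), ← ENNReal.ofReal_mul (by positivity)]
  congr 1
  ring

lemma L4e_Vfn_lt_top {l : ℝ} (v : V l) : L4e (Vfn v) < ∞ := by
  by_contra! h
  have := L4e_Vfn_pow_le v
  rw [top_le_iff.1 h, ENNReal.top_pow (by norm_num), top_le_iff] at this
  exact ENNReal.ofReal_ne_top this

lemma L4_Vfn_pow_le {l : ℝ} (v : V l) :
    L4 (Vfn v) ^ 4 ≤ 2 * ‖Vfn v‖ ^ 3 * ‖Vdx v‖ := by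
  have := ENNReal.toReal_mono ENNReal.ofReal_ne_top (L4e_Vfn_pow_le v)
  rwa [ENNReal.toReal_pow, ENNReal.toReal_ofReal (by positivity)] at this

/-- Poincaré's inequality. -/
lemma norm_Vfn_le_Vdx {l : ℝ} (hl : 0 < l) (v : V l) : ‖Vfn v‖ ≤ 2 * l * ‖Vdx v‖ := by
  have hm : (mu l).real univ = 2 * l := by
    rw [Measure.real, Measure.restrict_apply_univ, Real.volume_Ioo, ENNReal.toReal_ofReal]
    all_goals linarith
  have h := Lp.norm_le_of_ae_bound (by positivity) (Vfn_bound v)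
  have h2 : ((2 : ℝ≥0∞).toReal)⁻¹ = 1 / 2 := by norm_num
  have h3 : (measureUnivNNReal (mu l) : ℝ) = 2 * l := hm
  rw [h2, h3, hm, ← mul_assoc, ← Real.rpow_add (by linarith)] at h
  norm_num at h
  exact h

/-! ### The nonlinearity tested against `V` -/

/-- For `v ∈ V` and a `C¹` function `φ` vanishing at the endpoints, `∫ (v² φ)' = 0`. -/
lemma integral_Vfn_sq_mul {l : ℝ} (hl : 0 < l) {φ : ℝ → ℝ} (hφ : ContDiff ℝ 1 φ)
    (h1 : φ (-l) = 0) (h2 : φ l = 0) (v : V l) :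
    2 * inner ℝ (Vdx v) (mulCont hφ.continuous (Vfn v)) +
      inner ℝ (Vfn v) (mulCont (hφ.continuous_deriv le_rfl) (Vfn v)) = 0 := by
  have hd : Continuous (deriv φ) := hφ.continuous_deriv le_rfl
  refine V_induction (s := {p : WithLp 2 (H l × H l) |
    2 * inner ℝ p.snd (mulCont hφ.continuous p.fst) +
      inner ℝ p.fst (mulCont hd p.fst) = 0}) ?_ ?_ v
  · have c1 : Continuous fun p : WithLp 2 (H l × H l) => p.fst :=
      (WithLp.fstL 2 ℝ (H l) (H l)).continuous
    have c2 : Continuous fun p : WithLp 2 (H l × H l) => p.snd :=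
      (WithLp.sndL 2 ℝ (H l) (H l)).continuous
    exact isClosed_eq ((continuous_const.mul (c2.inner ((mulCont _).continuous.comp c1))).add
      (c1.inner ((mulCont _).continuous.comp c1))) continuous_const
  · rintro p ⟨ψ, hψ, k1, k2, k3, k4⟩
    have hψ1 : ContDiff ℝ 1 ψ := hψ.of_le (by exact_mod_cast le_top)
    have e := integral_deriv_smooth hl ((hψ1.pow 2).mul hφ)
    simp only [h1, h2, mul_zero, sub_zero] at e
    have i1 : Integrable (fun x => p.snd x * p.fst x * φ x) (mu l) := by
      refine (integrable_mul_H p.snd (mulCont hφ.continuous p.fst)).congr ?_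
      filter_upwards [coeFn_mulCont hφ.continuous p.fst] with x hx
      rw [hx]
      ring
    have i2 : Integrable (fun x => p.fst x * p.fst x * deriv φ x) (mu l) := by
      refine (integrable_mul_H p.fst (mulCont hd p.fst)).congr ?_
      filter_upwards [coeFn_mulCont hd p.fst] with x hx
      rw [hx]
      ring
    rw [mem_ofPred_eq, inner_mulCont, inner_mulCont, ← integral_const_mul,
      ← integral_add (i1.const_mul 2) i2, ← e]
    refine integral_congr_ae ?_
    filter_upwards [k3, k4] with x e1 e2
    rw [e1, e2]
    have := ((hψ1.differentiable (by simp) x).hasDerivAt.fun_pow 2).mul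
      (hφ.differentiable (by simp) x).hasDerivAt
    refine Eq.trans ?_ this.deriv.symm
    norm_num
    ring

/-- The product `v v'`, which is square integrable for `v ∈ V`. -/
lemma memLp_Vfn_mul_Vdx {l : ℝ} (v : V l) :
    MemLp (fun x => (Vfn v) x * (Vdx v) x) 2 (mu l) :=
  (Lp.memLp (Vdx v)).mul (p := ∞) (q := 2)
    (memLp_top_of_bound (Lp.aestronglyMeasurable (Vfn v)) _ (Vfn_bound v))

/-- `∫ (v² y)' = 0` for `v, y ∈ V`. -/
lemma two_mul_inner_add_triple {l : ℝ} (hl : 0 < l) (v y : V l) :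
    2 * inner ℝ (memLp_Vfn_mul_Vdx v).toLp (Vfn y) + triple (Vfn v) (Vfn v) (Vdx y) = 0 := by
  have h4 := L4e_Vfn_lt_top v
  rw [triple_eq_inner h4 h4]
  refine V_induction (s := {p : WithLp 2 (H l × H l) |
    2 * inner ℝ (memLp_Vfn_mul_Vdx v).toLp p.fst + inner ℝ (memLp_mul h4 h4).toLp p.snd = 0})
    ?_ ?_ y
  · have c1 : Continuous fun p : WithLp 2 (H l × H l) => p.fst :=
      (WithLp.fstL 2 ℝ (H l) (H l)).continuous
    have c2 : Continuous fun p : WithLp 2 (H l × H l) => p.snd :=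
      (WithLp.sndL 2 ℝ (H l) (H l)).continuous
    exact isClosed_eq ((continuous_const.mul (continuous_const.inner c1)).add
      (continuous_const.inner c2)) continuous_const
  · rintro p ⟨φ, hφ, h1, h2, h3, h4'⟩
    have hφ1 : ContDiff ℝ 1 φ := hφ.of_le (by exact_mod_cast le_top)
    have e := integral_Vfn_sq_mul hl hφ1 h1 h2 v
    rw [inner_mulCont, inner_mulCont] at e
    rw [mem_ofPred_eq, inner_eq_integral, inner_eq_integral, ← e]
    congr 1
    · congr 1
      refine integral_congr_ae ?_
      filter_upwards [h3, (memLp_Vfn_mul_Vdx v).coeFn_toLp] with x e1 e2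
      rw [e1, e2]
      ring
    · refine integral_congr_ae ?_
      filter_upwards [h4', (memLp_mul h4 h4).coeFn_toLp] with x e1 e2
      rw [e1, e2]

lemma inner_G0 {l : ℝ} (hl : 0 < l) (c : ℝ) (v y : V l) :
    inner ℝ (G0 c v) (Vfn y) =
      1 / 2 * triple (Vfn v) (Vfn v) (Vdx y) + c * inner ℝ (Vfn v) (Vfn y) := by
  have e : G0 c v = -(memLp_Vfn_mul_Vdx v).toLp + c • Vfn v := by
    refine Lp.ext ?_
    filter_upwards [(memLp_nonlinearity c v).coeFn_toLp, (memLp_Vfn_mul_Vdx v).coeFn_toLp,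
      Lp.coeFn_add (-(memLp_Vfn_mul_Vdx v).toLp) (c • Vfn v),
      Lp.coeFn_neg (memLp_Vfn_mul_Vdx v).toLp, Lp.coeFn_smul c (Vfn v)] with x e1 e2 e3 e4 e5
    rw [G0, e1, e3, Pi.add_apply, e4, e5, Pi.neg_apply, e2, Pi.smul_apply, smul_eq_mul]
  have := two_mul_inner_add_triple hl v y
  rw [e, inner_add_left, inner_neg_left, real_inner_smul_left]
  linarith

/-- The term `∫ v² v'` vanishes for `v ∈ V`. -/
lemma triple_self_Vdx {l : ℝ} (hl : 0 < l) (v : V l) : triple (Vfn v) (Vfn v) (Vdx v) = 0 := by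
  have := two_mul_inner_add_triple hl v v
  have e : inner ℝ (memLp_Vfn_mul_Vdx v).toLp (Vfn v) = triple (Vfn v) (Vfn v) (Vdx v) := by
    rw [inner_eq_integral, triple]
    refine integral_congr_ae ?_
    filter_upwards [(memLp_Vfn_mul_Vdx v).coeFn_toLp] with x e2
    rw [e2]
    ring
  rw [e] at this
  linarith

/-- `v ↦ -v v' + c v` is continuous from `V` to `H`, as `V` embeds into the bounded functions. -/
lemma continuous_G0 {l : ℝ} (c : ℝ) : Continuous (G0 c : V l → H l) := by
  set K : ℝ := (mu l).real univ ^ (1 / 2 : ℝ) with hK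
  have hK0 : 0 ≤ K := by positivity
  have hbound : ∀ v w : V l, ‖G0 c v - G0 c w‖ ≤
      K * ‖v - w‖ * ‖v‖ + K * ‖w‖ * ‖v - w‖ + |c| * ‖v - w‖ := by
    intro v w
    have hm : ∀ a b : V l, MemLp (fun x => (Vfn a) x * (Vdx b) x) 2 (mu l) := fun a b =>
      (Lp.memLp (Vdx b)).mul (p := ∞) (q := 2)
        (memLp_top_of_bound (Lp.aestronglyMeasurable (Vfn a)) _ (Vfn_bound a))
    have hn : ∀ a b : V l, ‖(hm a b).toLp‖ ≤ K * ‖a‖ * ‖b‖ := by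
      intro a b
      have : ‖(hm a b).toLp‖ ≤ K * ‖Vdx a‖ * ‖Vdx b‖ := by
        refine Lp.norm_le_mul_norm_of_ae_le_mul ?_
        filter_upwards [(hm a b).coeFn_toLp, Vfn_bound a] with x e1 e2
        rw [e1, norm_mul]
        gcongr
      refine this.trans ?_
      gcongr
      · exact norm_Vdx_le a
      · exact norm_Vdx_le b
    have e : G0 c v - G0 c w =
        -(hm (v - w) v).toLp - (hm w (v - w)).toLp + c • Vfn (v - w) := by
      refine Lp.ext ?_
      filter_upwards [(memLp_nonlinearity c v).coeFn_toLp, (memLp_nonlinearity c w).coeFn_toLp,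
        (hm (v - w) v).coeFn_toLp, (hm w (v - w)).coeFn_toLp, Lp.coeFn_sub (G0 c v) (G0 c w),
        Lp.coeFn_add (-(hm (v - w) v).toLp - (hm w (v - w)).toLp) (c • Vfn (v - w)),
        Lp.coeFn_sub (-(hm (v - w) v).toLp) (hm w (v - w)).toLp,
        Lp.coeFn_neg (hm (v - w) v).toLp, Lp.coeFn_smul c (Vfn (v - w)),
        Lp.coeFn_sub (Vfn v) (Vfn w), Lp.coeFn_sub (Vdx v) (Vdx w)]
        with x e1 e2 e3 e4 e5 e6 e7 e8 e9 e10 e11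
      rw [e5, e6, Pi.sub_apply, Pi.add_apply, e7, Pi.sub_apply, e8, Pi.neg_apply, e9,
        Pi.smul_apply, e3, e4, Vfn_sub, Vdx_sub, e10, e11, G0, G0, e1, e2]
      simp only [Pi.sub_apply, smul_eq_mul]
      ring
    rw [e]
    refine (norm_add_le _ _).trans (add_le_add ((norm_sub_le _ _).trans (add_le_add ?_ ?_)) ?_)
    · rw [norm_neg]; exact hn _ _
    · exact hn _ _
    · rw [norm_smul, Real.norm_eq_abs]
      gcongr
      exact norm_Vfn_le _
  rw [continuous_iff_continuousAt]
  intro w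
  rw [ContinuousAt, tendsto_iff_norm_sub_tendsto_zero]
  refine squeeze_zero (fun _ => norm_nonneg _) (fun v => hbound v w) ?_
  have h0 : Tendsto (fun v : V l => ‖v - w‖) (𝓝 w) (𝓝 0) :=
    tendsto_iff_norm_sub_tendsto_zero.1 tendsto_id
  have h1 : Tendsto (fun v : V l => ‖v‖) (𝓝 w) (𝓝 ‖w‖) := continuous_norm.tendsto w
  simpa using (((h0.const_mul K).mul h1).add (h0.const_mul (K * ‖w‖))).add (h0.const_mul |c|)

/-! ### The energy of the operator `A` -/

/-- Integration by parts against a function with a square integrable weak derivative. -/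
lemma integral_mul_primitive {l : ℝ} (hl : 0 < l) (g : H l) {G φ : ℝ → ℝ}
    (hG : ∀ x ∈ Icc (-l) l, G x = G (-l) + ∫ s in (-l)..x, g s) (hφ : ContDiff ℝ 1 φ)
    (h1 : φ (-l) = 0) (h2 : φ l = 0) :
    ∫ x in (-l)..l, φ x * g x = - ∫ x in (-l)..l, deriv φ x * G x := by
  have hll : -l ≤ l := by linarith
  have hd : Continuous (deriv φ) := hφ.continuous_deriv le_rfl
  have hg : IntervalIntegrable g volume (-l) l := by
    rw [intervalIntegrable_iff_integrableOn_Ioo_of_le hll]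
    exact (Lp.memLp g).integrable (by norm_num)
  set P : ℝ → ℝ := fun x => ∫ s in (-l)..x, g s with hP
  have hPac : AbsolutelyContinuousOnInterval P (-l) l :=
    hg.absolutelyContinuousOnInterval_intervalIntegral (c := -l) (by simp)
  have hφac : AbsolutelyContinuousOnInterval φ (-l) l := by
    obtain ⟨K, hK⟩ := (hφ.contDiffOn (s := uIcc (-l) l)).exists_lipschitzOnWith one_ne_zero
      (convex_uIcc _ _) isCompact_uIcc
    exact hK.absolutelyContinuousOnInterval
  have hparts := hφac.integral_mul_deriv_eq_deriv_mul hPac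
  have e1 : ∫ x in (-l)..l, φ x * deriv P x = ∫ x in (-l)..l, φ x * g x := by
    refine intervalIntegral.integral_congr_ae ?_
    filter_upwards [hg.ae_hasDerivAt_integral] with x hx hxI
    rw [(hx (uIoc_subset_uIcc hxI) (-l) (by simp)).deriv]
  rw [e1, h1, h2] at hparts
  have e2 : ∫ x in (-l)..l, deriv φ x * G x =
      ∫ x in (-l)..l, (deriv φ x * G (-l) + deriv φ x * P x) := by
    refine intervalIntegral.integral_congr fun x hx => ?_
    rw [uIcc_of_le hll] at hx
    simp only [hP]
    rw [hG x hx]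
    ring
  have e3 : ∫ x in (-l)..l, deriv φ x = 0 := by
    rw [← integral_mu_eq hl, integral_deriv_smooth hl hφ, h1, h2, sub_zero]
  rw [e2, intervalIntegral.integral_add ((hd.fun_mul continuous_const).intervalIntegrable _ _)
    (hPac.continuousOn.intervalIntegrable.continuousOn_mul hd.continuousOn),
    intervalIntegral.integral_mul_const, e3, hparts]
  ring

/-- The quadratic form of `A`. As `‖v'‖² = -⟪v, v''⟫`, the square of `√2 v'' + b v / √8` gives
`-2 ‖v''‖² ≤ -b ‖v'‖² + b² ‖v‖² / 8`; the number `b` is free. -/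
lemma IsA.exists_V {l c : ℝ} (hl : 0 < l) {bc : BC} {u w : H l} (h : IsA l c bc u w) :
    ∃ v : V l, Vfn v = u ∧ ∀ b : ℝ, 2 * inner ℝ w u ≤
      -(b - 2) * ‖Vdx v‖ ^ 2 + (b ^ 2 / 8 - 2 * c) * ‖u‖ ^ 2 := by
  obtain ⟨φ, g, hφ, hg, h1, h2, h3, h4, hu, hw⟩ := h
  set φ1 := deriv φ with hφ1
  set φ2 := deriv φ1 with hφ2
  have c1 : ContDiff ℝ 2 φ1 :=
    ((contDiff_succ_iff_deriv (n := 2)).1 (by simpa using! hφ)).2.2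
  have c2 : ContDiff ℝ 1 φ2 :=
    ((contDiff_succ_iff_deriv (n := 1)).1 (by simpa using! c1)).2.2
  have i2 : iteratedDeriv 2 φ = φ2 := by rw [iteratedDeriv_succ, iteratedDeriv_one]
  have i3 : iteratedDeriv 3 φ = deriv φ2 := by rw [iteratedDeriv_succ, i2]
  rw [i3] at hg
  have k0 : Continuous φ := hφ.continuous
  have k1 : Continuous φ1 := c1.continuous
  have k2 : Continuous φ2 := c2.continuous
  have k3 : Continuous (deriv φ2) := c2.continuous_deriv le_rfl
  have d0 : ContDiff ℝ 1 φ := hφ.of_le (by norm_num)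
  have d1 : ContDiff ℝ 1 φ1 := c1.of_le (by norm_num)
  -- both boundary conditions annihilate the boundary term `φ' φ''`
  have hb : ∀ x, x = -l ∨ x = l → φ1 x * φ2 x = 0 := by
    have i1 : iteratedDeriv 1 φ = φ1 := iteratedDeriv_one
    cases bc
    · simp only [BC.order, i1] at h3 h4
      rintro x (rfl | rfl) <;> simp [h3, h4]
    · simp only [BC.order, i2] at h3 h4
      rintro x (rfl | rfl) <;> simp [h3, h4]
  obtain ⟨v, hv1, hv2⟩ := exists_V_of_contDiff hl d0 h1 h2
  refine ⟨v, Lp.ext (hv1.trans hu.symm), fun b => ?_⟩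
  have ibp : ∀ {α β : ℝ → ℝ}, ContDiff ℝ 1 α → ContDiff ℝ 1 β → α (-l) * β (-l) = 0 →
      α l * β l = 0 → ∫ x, deriv α x * β x ∂(mu l) = - ∫ x, α x * deriv β x ∂(mu l) := by
    intro α β hα hβ hm hp
    rw [eq_neg_iff_add_eq_zero, ← integral_add]
    · have e := integral_deriv_smooth hl (hα.mul hβ)
      rw [hm, hp, sub_zero] at e
      rw [← e]
      refine integral_congr_ae (Eventually.of_forall fun x => ?_)
      exact ((hα.differentiable (by simp) x).hasDerivAt.mul
        (hβ.differentiable (by simp) x).hasDerivAt).deriv.symm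
    · exact (memLp_of_continuous ((hα.continuous_deriv le_rfl).mul hβ.continuous) 1).integrable
        le_rfl
    · exact (memLp_of_continuous (hα.continuous.mul (hβ.continuous_deriv le_rfl)) 1).integrable
        le_rfl
  have hint : ∀ {α : ℝ → ℝ}, Continuous α → Integrable α (mu l) := fun hα =>
    (memLp_of_continuous hα 1).integrable le_rfl
  have eq1 : ∫ x, φ1 x * φ1 x ∂(mu l) = - ∫ x, φ x * φ2 x ∂(mu l) :=
    ibp d0 d1 (by simp [h1]) (by simp [h2])
  have eq2 : ∫ x, φ x * g x ∂(mu l) = ∫ x, φ2 x * φ2 x ∂(mu l) := by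
    rw [integral_mu_eq hl, integral_mul_primitive hl g hg d0 h1 h2, ← integral_mu_eq hl,
      ibp d1 c2 (hb _ (Or.inl rfl)) (hb _ (Or.inr rfl))]
  have nu : ‖u‖ ^ 2 = ∫ x, φ x * φ x ∂(mu l) := by
    rw [← real_inner_self_eq_norm_sq, inner_eq_integral]
    exact integral_congr_ae (by filter_upwards [hu] with x hx; rw [hx])
  have nv : ‖Vdx v‖ ^ 2 = ∫ x, φ1 x * φ1 x ∂(mu l) := by
    rw [← real_inner_self_eq_norm_sq, inner_eq_integral]
    exact integral_congr_ae (by filter_upwards [hv2] with x hx; rw [hx])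
  have hgφ : Integrable (fun x => φ x * g x) (mu l) :=
    (memLp_of_continuous k0 2).integrable_mul (Lp.memLp g)
  have ew : inner ℝ w u = - ∫ x, φ2 x * φ2 x ∂(mu l) - ∫ x, φ x * φ2 x ∂(mu l) -
      c * ∫ x, φ x * φ x ∂(mu l) := by
    rw [← eq2, ← integral_neg, ← integral_const_mul,
      ← integral_sub hgφ.fun_neg (hint (k0.fun_mul k2)),
      ← integral_sub (show Integrable (fun x => -(φ x * g x) - φ x * φ2 x) (mu l) from
        hgφ.fun_neg.sub (hint (k0.fun_mul k2))) ((hint (k0.fun_mul k0)).const_mul c),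
      inner_eq_integral]
    refine integral_congr_ae ?_
    filter_upwards [hu, hw] with x e1 e2
    rw [e1, e2, i2]
    ring
  have hsq : 0 ≤ 2 * (∫ x, φ2 x * φ2 x ∂(mu l)) + b * (∫ x, φ x * φ2 x ∂(mu l)) +
      b ^ 2 / 8 * ∫ x, φ x * φ x ∂(mu l) := by
    rw [← integral_const_mul, ← integral_const_mul, ← integral_const_mul,
      ← integral_add ((hint (k2.fun_mul k2)).const_mul 2) ((hint (k0.fun_mul k2)).const_mul b),
      ← integral_add
        (((hint (k2.fun_mul k2)).const_mul 2).fun_add ((hint (k0.fun_mul k2)).const_mul b))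
        ((hint (k0.fun_mul k0)).const_mul (b ^ 2 / 8))]
    refine integral_nonneg fun x => ?_
    simp only [Pi.zero_apply]
    nlinarith [sq_nonneg (φ2 x + b / 4 * φ x)]
  rw [nu, nv, ew, eq1]
  linarith

/-! ### The constant of the interpolation inequality -/

lemma hasDerivAt_max_zero_sq (t : ℝ) : HasDerivAt (fun s : ℝ => max s 0 ^ 2) (2 * max t 0) t := by
  rcases lt_trichotomy t 0 with h | rfl | h
  · rw [max_eq_right h.le, mul_zero]
    refine (hasDerivAt_const t (0 : ℝ)).congr_of_eventuallyEq ?_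
    filter_upwards [Iio_mem_nhds h] with s hs
    rw [max_eq_right (le_of_lt hs)]
    norm_num
  · rw [max_self, mul_zero, hasDerivAt_iff_isLittleO]
    refine (Asymptotics.isBigO_of_le' (c := 1) (g := fun s : ℝ => ‖s - 0‖ ^ 2) _
      fun s => ?_).trans_isLittleO (Asymptotics.isLittleO_pow_sub_sub (0 : ℝ) one_lt_two)
    rcases le_total s 0 with hs | hs
    · simp [hs, sq_nonneg]
    · simp [hs]
  · rw [max_eq_left h.le]
    have h2 : HasDerivAt (fun s : ℝ => s ^ 2) (2 * t) t := by simpa using hasDerivAt_pow 2 t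
    refine h2.congr_of_eventuallyEq ?_
    filter_upwards [Ioi_mem_nhds h] with s hs
    rw [max_eq_left (le_of_lt hs)]

lemma integral_one_sub_sq_pow (n : ℕ) (a : ℝ) : ∫ x in (-a)..a, (1 - 16 * x ^ 2) ^ n =
    ∑ k ∈ Finset.range (n + 1),
      (n.choose k : ℝ) * (-16) ^ k * (2 * a ^ (2 * k + 1) / (2 * k + 1)) := by
  have h : ∀ x : ℝ, (1 - 16 * x ^ 2) ^ n =
      ∑ k ∈ Finset.range (n + 1), (n.choose k : ℝ) * (-16) ^ k * x ^ (2 * k) := by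
    intro x
    rw [sub_eq_neg_add, add_pow]
    refine Finset.sum_congr rfl fun k _ => ?_
    rw [one_pow, neg_mul_eq_neg_mul, mul_pow, ← pow_mul]
    ring
  simp_rw [h]
  rw [intervalIntegral.integral_finsetSum
    fun k _ => Continuous.intervalIntegrable (by fun_prop) _ _]
  refine Finset.sum_congr rfl fun k _ => ?_
  rw [intervalIntegral.integral_const_mul, integral_pow, Odd.neg_pow ⟨k, rfl⟩]
  push_cast
  ring

/-- A bump concentrated on `(-1/4, 1/4)` shows that the constant of the interpolation inequality
is at least `1/2` on every interval that contains `(-1/4, 1/4)`. -/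
lemma one_half_le_of_interpolation {l κ : ℝ} (hl : 1 / 4 ≤ l) (hκ : 0 ≤ κ)
    (h : ∀ v : V l, L4 (Vfn v) ^ 4 ≤ κ ^ 4 * ‖Vfn v‖ ^ 2 * ‖v‖ ^ 2) : 1 / 2 ≤ κ := by
  have hl0 : 0 < l := by linarith
  set φ : ℝ → ℝ := fun x => max (1 - 16 * x ^ 2) 0 ^ 2 with hφ
  set φ' : ℝ → ℝ := fun x => 2 * max (1 - 16 * x ^ 2) 0 * (-32 * x) with hφ'
  have hd : ∀ x, HasDerivAt φ (φ' x) x := fun x => by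
    have h1 : HasDerivAt (fun x : ℝ => 1 - 16 * x ^ 2) (-32 * x) x := by
      have := ((hasDerivAt_pow 2 x).const_mul 16).const_sub 1
      refine this.congr_deriv ?_
      norm_num
      ring
    exact (hasDerivAt_max_zero_sq _).comp x h1
  have hdφ : deriv φ = φ' := funext fun x => (hd x).deriv
  have hc : ContDiff ℝ 1 φ := by
    rw [contDiff_one_iff_deriv, hdφ]
    exact ⟨fun x => (hd x).differentiableAt, by fun_prop⟩
  have hzero : ∀ x : ℝ, x ∉ Ioo (-(1 / 4) : ℝ) (1 / 4) → max (1 - 16 * x ^ 2) 0 = 0 := by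
    intro x hx
    refine max_eq_right ?_
    by_contra! hcon
    exact hx ⟨by nlinarith, by nlinarith⟩
  obtain ⟨v, hv1, hv2⟩ := exists_V_of_contDiff hl0 hc
    (by simp only [hφ]; rw [hzero (-l) fun hx => by linarith [hx.1]]; simp)
    (by simp only [hφ]; rw [hzero l fun hx => by linarith [hx.2]]; simp)
  have hint : ∀ F G : ℝ → ℝ, (∀ x, x ∉ Ioo (-(1 / 4) : ℝ) (1 / 4) → F x = 0) →
      (∀ x ∈ Ioo (-(1 / 4) : ℝ) (1 / 4), F x = G x) →
      ∫ x, F x ∂(mu l) = ∫ x in (-(1 / 4) : ℝ)..(1 / 4), G x := by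
    intro F G hF hG
    rw [intervalIntegral.integral_of_le (by norm_num), integral_Ioc_eq_integral_Ioo,
      ← setIntegral_congr_fun measurableSet_Ioo hG]
    exact setIntegral_eq_of_subset_of_forall_sdiff_eq_zero measurableSet_Ioo
      (Ioo_subset_Ioo (by linarith) hl) fun x hx => hF x hx.2
  have hpos : ∀ x ∈ Ioo (-(1 / 4) : ℝ) (1 / 4), max (1 - 16 * x ^ 2) 0 = 1 - 16 * x ^ 2 :=
    fun x hx => max_eq_left (by nlinarith [hx.1, hx.2])
  have e4 : L4 (Vfn v) ^ 4 = 16384 / 109395 := by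
    rw [L4_pow_eq, integral_congr_ae (g := fun x => φ x ^ 4)
      (by filter_upwards [hv1] with x hx; rw [hx]),
      hint _ (fun x => (1 - 16 * x ^ 2) ^ 8) (fun x hx => by simp [hφ, hzero x hx])
        (fun x hx => by simp only [hφ, hpos x hx]; ring), integral_one_sub_sq_pow]
    norm_num [Finset.sum_range_succ, Nat.choose]
  have e0 : ‖Vfn v‖ ^ 2 = 64 / 315 := by
    rw [← real_inner_self_eq_norm_sq, inner_eq_integral,
      integral_congr_ae (g := fun x => φ x * φ x)
      (by filter_upwards [hv1] with x hx; rw [hx]),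
      hint _ (fun x => (1 - 16 * x ^ 2) ^ 4) (fun x hx => by simp [hφ, hzero x hx])
        (fun x hx => by simp only [hφ, hpos x hx]; ring), integral_one_sub_sq_pow]
    norm_num [Finset.sum_range_succ, Nat.choose]
  have e1 : ‖Vdx v‖ ^ 2 = 1024 / 105 := by
    rw [← real_inner_self_eq_norm_sq, inner_eq_integral,
      integral_congr_ae (g := fun x => φ' x * φ' x)
      (by filter_upwards [hv2] with x hx; rw [hx, hdφ]),
      hint _ (fun x => 4096 * x ^ 2 - 131072 * x ^ 4 + 1048576 * x ^ 6)
        (fun x hx => by simp [hφ', hzero x hx])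
        (fun x hx => by simp only [hφ', hpos x hx]; ring),
      intervalIntegral.integral_add (Continuous.intervalIntegrable (by fun_prop) _ _)
        (Continuous.intervalIntegrable (by fun_prop) _ _),
      intervalIntegral.integral_sub (Continuous.intervalIntegrable (by fun_prop) _ _)
        (Continuous.intervalIntegrable (by fun_prop) _ _)]
    simp only [intervalIntegral.integral_const_mul, integral_pow]
    norm_num
  have := h v
  rw [norm_V_sq, e4, e0, e1] at this
  by_contra! hcon
  have h16 : κ ^ 4 ≤ (1 / 2) ^ 4 := by gcongr
  norm_num at this h16
  linarith

/-- The interpolation inequality holds with the constant `min C 1`, because `‖v‖₄⁴ ≤ 2 ‖v‖³ ‖v'‖`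
gives it with the constant `1`. -/
lemma L4_pow_le_min {l C : ℝ} (hC0 : 0 ≤ C) (hC : ∀ v : V l,
      L4e (Vfn v) ≤ ENNReal.ofReal (C * ‖Vfn v‖ ^ (1 / 2 : ℝ) * ‖v‖ ^ (1 / 2 : ℝ))) (v : V l) :
    L4 (Vfn v) ^ 4 ≤ min C 1 ^ 4 * ‖Vfn v‖ ^ 2 * ‖v‖ ^ 2 := by
  rcases min_choice C 1 with h | h
  · rw [h]
    have h1 : L4 (Vfn v) ≤ C * ‖Vfn v‖ ^ (1 / 2 : ℝ) * ‖v‖ ^ (1 / 2 : ℝ) := by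
      have := ENNReal.toReal_mono ENNReal.ofReal_ne_top (hC v)
      rwa [ENNReal.toReal_ofReal (by positivity)] at this
    have h2 : ∀ a : ℝ, 0 ≤ a → (a ^ (1 / 2 : ℝ)) ^ 4 = a ^ 2 := fun a ha => by
      rw [← Real.rpow_natCast, ← Real.rpow_mul ha]
      norm_num
    calc L4 (Vfn v) ^ 4 ≤ (C * ‖Vfn v‖ ^ (1 / 2 : ℝ) * ‖v‖ ^ (1 / 2 : ℝ)) ^ 4 :=
          pow_le_pow_left₀ (L4_nonneg _) h1 4
      _ = _ := by rw [mul_pow, mul_pow, h2 _ (norm_nonneg _), h2 _ (norm_nonneg _)]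
  · rw [h, one_pow, one_mul, norm_V_sq]
    refine (L4_Vfn_pow_le v).trans ?_
    have := mul_nonneg (sq_nonneg ‖Vfn v‖) (sq_nonneg (‖Vfn v‖ - ‖Vdx v‖))
    nlinarith

/-! ### The pointwise differential inequalities -/

/-- The inequality of arithmetic and geometric means for `a, b, d, d`. -/
lemma amgm_four {a b d : ℝ} (ha : 0 ≤ a) (hb : 0 ≤ b) (hd : 0 ≤ d) :
    256 * (a * b * d ^ 2) ≤ (a + b + 2 * d) ^ 4 := by
  have h1 : 4 * (a * b) ≤ (a + b) ^ 2 := by nlinarith [sq_nonneg (a - b)]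
  have h2 : 8 * ((a + b) * d) ≤ (a + b + 2 * d) ^ 2 := by nlinarith [sq_nonneg (a + b - 2 * d)]
  calc 256 * (a * b * d ^ 2) = 64 * (4 * (a * b)) * d ^ 2 := by ring
    _ ≤ 64 * (a + b) ^ 2 * d ^ 2 := by gcongr
    _ = (8 * ((a + b) * d)) ^ 2 := by ring
    _ ≤ ((a + b + 2 * d) ^ 2) ^ 2 := by gcongr
    _ = _ := by ring

/-- Young's inequality for the term `‖z‖₄ ‖w‖₄ ‖z'‖`, after interpolation of `‖z‖₄`. The weights
have to satisfy `1 ≤ 256 α β γ²`, for the inequality of arithmetic and geometric means. -/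
lemma young_interpolation {κ p q X W α β γ : ℝ} (hκ : 0 ≤ κ)
    (hα : 0 ≤ α) (hβ : 0 ≤ β) (hγ : 0 ≤ γ) (h : 1 ≤ 256 * (α * β * γ ^ 2))
    (hX : X ^ 4 ≤ κ ^ 4 * p ^ 2 * (p ^ 2 + q ^ 2)) :
    X * W * q ≤ κ * (α * (p ^ 2 * W ^ 4) + β * (p ^ 2 + q ^ 2) + 2 * (γ * q ^ 2)) := by
  have hB : 0 ≤ κ * (α * (p ^ 2 * W ^ 4) + β * (p ^ 2 + q ^ 2) + 2 * (γ * q ^ 2)) := by positivity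
  refine le_of_pow_le_pow_left₀ (n := 4) (by norm_num) hB ?_
  have h0 : 0 ≤ κ ^ 4 * ((p ^ 2 * W ^ 4) * (p ^ 2 + q ^ 2) * (q ^ 2) ^ 2) := by positivity
  calc (X * W * q) ^ 4 = X ^ 4 * (W ^ 4 * q ^ 4) := by ring
    _ ≤ κ ^ 4 * p ^ 2 * (p ^ 2 + q ^ 2) * (W ^ 4 * q ^ 4) := by gcongr
    _ = κ ^ 4 * ((p ^ 2 * W ^ 4) * (p ^ 2 + q ^ 2) * (q ^ 2) ^ 2) := by ring
    _ ≤ 256 * (α * β * γ ^ 2) * (κ ^ 4 * ((p ^ 2 * W ^ 4) * (p ^ 2 + q ^ 2) * (q ^ 2) ^ 2)) := by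
        nlinarith
    _ = κ ^ 4 * (256 * ((α * (p ^ 2 * W ^ 4)) * (β * (p ^ 2 + q ^ 2)) * (γ * q ^ 2) ^ 2)) := by
        ring
    _ ≤ κ ^ 4 * (α * (p ^ 2 * W ^ 4) + β * (p ^ 2 + q ^ 2) + 2 * (γ * q ^ 2)) ^ 4 := by
        gcongr
        exact amgm_four (by positivity) (by positivity) (by positivity)
    _ = _ := by ring

/-- The part of the energy balance at `z ∈ V` that comes from the nonlinearity `½ (z + w)²` tested
against `z'`, for `w ∈ L⁴`. As `∫ z² z' = 0`, it is `∫ (z + w)² z'`. -/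
def noiseTerm {l : ℝ} (z : V l) (w : H l) : ℝ :=
  2 * triple (Vfn z) w (Vdx z) + triple w w (Vdx z)

lemma noiseTerm_le {l κ α β γ σ : ℝ} (hκ : 0 ≤ κ)
    (hint : ∀ v : V l, L4 (Vfn v) ^ 4 ≤ κ ^ 4 * ‖Vfn v‖ ^ 2 * ‖v‖ ^ 2)
    (hα : 0 ≤ α) (hβ : 0 ≤ β) (hγ : 0 ≤ γ) (h : 1 ≤ 256 * (α * β * γ ^ 2)) (hσ : 0 < σ)
    (z : V l) {w : H l} (hw : L4e w < ∞) :
    noiseTerm z w ≤ 2 * (κ * (α * (‖Vfn z‖ ^ 2 * L4 w ^ 4) + β * (‖Vfn z‖ ^ 2 + ‖Vdx z‖ ^ 2) +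
      2 * (γ * ‖Vdx z‖ ^ 2))) + σ * ‖Vdx z‖ ^ 2 + 1 / (4 * σ) * L4 w ^ 4 := by
  have h1 := (le_abs_self _).trans (abs_triple_le (L4e_Vfn_lt_top z) hw (Vdx z))
  have h2 := (le_abs_self _).trans (abs_triple_le hw hw (Vdx z))
  have hX := hint z
  rw [norm_V_sq] at hX
  have h3 := young_interpolation (W := L4 w) hκ hα hβ hγ h hX
  have h4 : L4 w * L4 w * ‖Vdx z‖ ≤ σ * ‖Vdx z‖ ^ 2 + 1 / (4 * σ) * L4 w ^ 4 := by
    have : 0 ≤ σ * (‖Vdx z‖ - 1 / (2 * σ) * L4 w ^ 2) ^ 2 := by positivity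
    have e : σ * (‖Vdx z‖ - 1 / (2 * σ) * L4 w ^ 2) ^ 2 =
        σ * ‖Vdx z‖ ^ 2 - L4 w * L4 w * ‖Vdx z‖ + 1 / (4 * σ) * L4 w ^ 4 := by
      field_simp
      ring
    linarith
  rw [noiseTerm]
  linarith

/-- The differential inequality `d/dt ‖z‖² ≤ f ‖z‖² + g`; the left-hand side is the upper bound of
the energy balance that results from the estimate of the quadratic form of `A` with the parameter
`b`. The choice `b = 3 + 3κ/2` makes the `‖z'‖²` terms cancel. -/
lemma energy_rate_le {l κ c : ℝ} (hc : 0 ≤ c) (hκ : 0 ≤ κ) (hκ1 : κ ≤ 1)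
    (hint : ∀ v : V l, L4 (Vfn v) ^ 4 ≤ κ ^ 4 * ‖Vfn v‖ ^ 2 * ‖v‖ ^ 2)
    (z : V l) {w : H l} (hw : L4e w < ∞) :
    -((3 + 3 / 2 * κ) - 2) * ‖Vdx z‖ ^ 2 + ((3 + 3 / 2 * κ) ^ 2 / 8 - 2 * c) * ‖Vfn z‖ ^ 2 +
      noiseTerm z w + 2 * c * ‖Vfn z‖ ^ 2 + 2 * c * inner ℝ w (Vfn z) ≤
    1 / 2 * (2 * c + (2 + 3 / 4 * κ) ^ 2 + κ * L4 w ^ 4) * ‖Vfn z‖ ^ 2 +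
      (c * ‖w‖ ^ 2 + 1 / 4 * L4 w ^ 4) := by
  have h1 := noiseTerm_le (α := 1 / 4) (β := 1 / 4) (γ := 1 / 4) (σ := 1) hκ hint (by norm_num)
    (by norm_num) (by norm_num) (by norm_num) one_pos z hw
  have h2 : 2 * inner ℝ w (Vfn z) ≤ ‖w‖ ^ 2 + ‖Vfn z‖ ^ 2 := by
    have := real_inner_le_norm w (Vfn z)
    nlinarith [sq_nonneg (‖w‖ - ‖Vfn z‖)]
  have h3 := mul_le_mul_of_nonneg_left h2 hc
  have h4 : 0 ≤ (1 - κ) * ‖Vfn z‖ ^ 2 := mul_nonneg (by linarith) (sq_nonneg _)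
  nlinarith [sq_nonneg ‖Vfn z‖]

/-- The differential inequality `½ d/dt ‖z‖² + ‖z‖²_V ≤ f ‖z‖² + g`. The factor `½` matters: the
inequality with `d/dt ‖z‖²` in place of its half is not available with this `f`. If the interval is
long then `κ ≥ ½`, and `b = 9/2 + 6κ/5` makes the `‖z'‖²` terms cancel; if it is short then
Poincaré's inequality makes them dominate. -/
lemma half_energy_rate_add_le {l κ c : ℝ} (hl : 0 < l) (hc : 0 ≤ c) (hκ : 0 ≤ κ) (hκ1 : κ ≤ 1)
    (hint : ∀ v : V l, L4 (Vfn v) ^ 4 ≤ κ ^ 4 * ‖Vfn v‖ ^ 2 * ‖v‖ ^ 2) :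
    ∃ b : ℝ, ∀ (z : V l) {w : H l}, L4e w < ∞ →
    1 / 2 * (-(b - 2) * ‖Vdx z‖ ^ 2 + (b ^ 2 / 8 - 2 * c) * ‖Vfn z‖ ^ 2 +
      noiseTerm z w + 2 * c * ‖Vfn z‖ ^ 2 + 2 * c * inner ℝ w (Vfn z)) + ‖z‖ ^ 2 ≤
    1 / 2 * (2 * c + (2 + 3 / 4 * κ) ^ 2 + κ * L4 w ^ 4) * ‖Vfn z‖ ^ 2 +
      (c * ‖w‖ ^ 2 + 1 / 4 * L4 w ^ 4) := by
  have key : ∀ (z : V l) {w : H l}, L4e w < ∞ → 1 / 2 * noiseTerm z w + c * inner ℝ w (Vfn z) ≤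
      κ * (1 / 2 * (‖Vfn z‖ ^ 2 * L4 w ^ 4) + 1 / 5 * (‖Vfn z‖ ^ 2 + ‖Vdx z‖ ^ 2) +
        2 / 5 * ‖Vdx z‖ ^ 2) + 1 / 4 * ‖Vdx z‖ ^ 2 + 1 / 4 * L4 w ^ 4 +
      c * (‖w‖ ^ 2 + ‖Vfn z‖ ^ 2) := by
    intro z w hw
    have h1 := noiseTerm_le (α := 1 / 2) (β := 1 / 5) (γ := 1 / 5) (σ := 1 / 2) hκ hint
      (by norm_num) (by norm_num) (by norm_num) (by norm_num) (by norm_num) z hw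
    have h2 : inner ℝ w (Vfn z) ≤ ‖w‖ ^ 2 + ‖Vfn z‖ ^ 2 := by
      have := real_inner_le_norm w (Vfn z)
      nlinarith [sq_nonneg (‖w‖ - ‖Vfn z‖), sq_nonneg ‖w‖, sq_nonneg ‖Vfn z‖]
    have h3 := mul_le_mul_of_nonneg_left h2 hc
    linarith
  rcases le_total (1 / 4) l with h | h
  · have hκ2 := one_half_le_of_interpolation h hκ hint
    refine ⟨9 / 2 + 6 / 5 * κ, fun z w hw => ?_⟩
    have h1 := key z hw
    rw [norm_V_sq]
    have h2 : 0 ≤ (κ - 1 / 2) * ‖Vfn z‖ ^ 2 := mul_nonneg (by linarith) (sq_nonneg _)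
    have h3 : 0 ≤ κ ^ 2 * ‖Vfn z‖ ^ 2 := by positivity
    nlinarith
  · refine ⟨10, fun z w hw => ?_⟩
    have h1 := key z hw
    rw [norm_V_sq]
    have h2 : 4 * ‖Vfn z‖ ^ 2 ≤ ‖Vdx z‖ ^ 2 := by
      have : ‖Vfn z‖ ≤ 1 / 2 * ‖Vdx z‖ :=
        (norm_Vfn_le_Vdx hl z).trans (by gcongr; linarith)
      nlinarith [norm_nonneg (Vfn z), norm_nonneg (Vdx z)]
    have h3 : 0 ≤ (1 - κ) * ‖Vdx z‖ ^ 2 := mul_nonneg (by linarith) (sq_nonneg _)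
    have h4 : 0 ≤ (1 - κ) * ‖Vfn z‖ ^ 2 := mul_nonneg (by linarith) (sq_nonneg _)
    have h5 : 0 ≤ κ * ‖Vfn z‖ ^ 2 := by positivity
    have h6 : 0 ≤ κ ^ 2 * ‖Vfn z‖ ^ 2 := by positivity
    nlinarith

/-! ### The semigroup and the mild solutions -/

section Semigroup

variable {l : ℝ} {A : H l → H l → Prop} {S : ℝ → H l →L[ℝ] H l}

/-- A strongly continuous semigroup is bounded near `0`, by the uniform boundedness principle. -/
lemma IsSemigroup.exists_bound_near_zero (hS : IsSemigroup A S) :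
    ∃ δ > 0, ∃ M, 1 ≤ M ∧ ∀ t ∈ Icc 0 δ, ‖S t‖ ≤ M := by
  by_contra! hcon
  have h : ∀ n : ℕ, ∃ t ∈ Icc (0 : ℝ) (1 / ((n : ℝ) + 1)), (n : ℝ) + 1 < ‖S t‖ := fun n =>
    hcon _ (by positivity) _ (by linarith [n.cast_nonneg (α := ℝ)])
  choose t ht hn using h
  have hlim : Tendsto t atTop (𝓝[≥] 0) := by
    refine tendsto_nhdsWithin_iff.2 ⟨?_, Eventually.of_forall fun n => (ht n).1⟩
    exact squeeze_zero (fun n => (ht n).1) (fun n => (ht n).2)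
      tendsto_one_div_add_atTop_nhds_zero_nat
  have hpt : ∀ u, ∃ B, ∀ n, ‖S (t n) u‖ ≤ B := by
    intro u
    have hc : ContinuousWithinAt (fun s => S s u) (Ici 0) 0 := by
      rw [← continuousWithinAt_Ioi_iff_Ici, ContinuousWithinAt, hS.zero]
      exact hS.strong u
    obtain ⟨B, hB⟩ := (hc.tendsto.comp hlim).norm.bddAbove_range
    exact ⟨B, fun n => hB ⟨n, rfl⟩⟩
  obtain ⟨B, hB⟩ := banach_steinhaus hpt
  obtain ⟨n, hnB⟩ := exists_nat_gt B
  linarith [hB n, hn n]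

lemma IsSemigroup.exists_bound (hS : IsSemigroup A S) (B : ℝ) :
    ∃ M, ∀ t ∈ Icc 0 B, ‖S t‖ ≤ M := by
  obtain ⟨δ, hδ, M, hM, h⟩ := hS.exists_bound_near_zero
  have key : ∀ n : ℕ, ∀ t ∈ Icc 0 (n * δ), ‖S t‖ ≤ M ^ (n + 1) := by
    intro n
    induction n with
    | zero =>
      intro t ht
      simp only [Nat.cast_zero, zero_mul] at ht
      simpa using h t ⟨ht.1, ht.2.trans hδ.le⟩
    | succ n ih =>
      intro t ht
      push_cast at ht
      have h0 : 0 ≤ t - min t δ := sub_nonneg.2 (min_le_left _ _)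
      have h1 : t - min t δ ≤ n * δ := by
        rcases min_choice t δ with h | h <;> rw [h]
        · simp only [sub_self]; positivity
        · linarith [ht.2]
      have h2 : 0 ≤ min t δ := le_min ht.1 hδ.le
      have e := hS.add (min t δ) (t - min t δ) h2 h0
      rw [add_sub_cancel] at e
      rw [e, pow_succ']
      refine (ContinuousLinearMap.opNorm_comp_le _ _).trans ?_
      gcongr
      · exact h _ ⟨h2, min_le_right _ _⟩
      · exact ih _ ⟨h0, h1⟩
  obtain ⟨n, hn⟩ := exists_nat_gt (B / δ)
  exact ⟨M ^ (n + 1), fun t ht => key n t ⟨ht.1, ht.2.trans ((div_lt_iff₀ hδ).1 hn).le⟩⟩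

/-- The semigroup, extended to negative times by the identity, is jointly continuous in the time
and the vector. -/
lemma IsSemigroup.continuous (hS : IsSemigroup A S) :
    Continuous fun p : ℝ × H l => S (max p.1 0) p.2 := by
  have hz : ∀ u, ContinuousWithinAt (fun s => S s u) (Ici 0) 0 := fun u => by
    rw [← continuousWithinAt_Ioi_iff_Ici, ContinuousWithinAt, hS.zero]
    exact hS.strong u
  have hdiff : ∀ (M : ℝ) (s t : ℝ) (u : H l), 0 ≤ s → s ≤ t → ‖S s‖ ≤ M →
      ‖S t u - S s u‖ ≤ M * ‖S (t - s) u - u‖ := by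
    intro M s t u hs hst hM
    have e := hS.add s (t - s) hs (sub_nonneg.2 hst)
    rw [add_sub_cancel] at e
    rw [e, ContinuousLinearMap.comp_apply, ← map_sub]
    exact (S s).le_of_opNorm_le hM _
  rw [continuous_iff_continuousAt]
  rintro ⟨t₀, u₀⟩
  obtain ⟨M, hM⟩ := hS.exists_bound (max t₀ 0 + 1)
  have hM' : ∀ᶠ p : ℝ × H l in 𝓝 (t₀, u₀), ‖S (max p.1 0)‖ ≤ M := by
    have hc : ContinuousAt (fun p : ℝ × H l => max p.1 0) (t₀, u₀) := by fun_prop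
    filter_upwards [hc (Iio_mem_nhds (show max t₀ 0 < max t₀ 0 + 1 by linarith))] with p hp
    exact hM _ ⟨le_max_right _ _, le_of_lt hp⟩
  have hab : Tendsto (fun p : ℝ × H l => |max p.1 0 - max t₀ 0|) (𝓝 (t₀, u₀)) (𝓝[≥] 0) := by
    refine tendsto_nhdsWithin_iff.2 ⟨?_, Eventually.of_forall fun _ => mem_Ici.2 (abs_nonneg _)⟩
    have hc : ContinuousAt (fun p : ℝ × H l => |max p.1 0 - max t₀ 0|) (t₀, u₀) := by fun_prop
    simpa [ContinuousAt] using hc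
  have hlim : Tendsto (fun p : ℝ × H l =>
      M * ‖p.2 - u₀‖ + M * ‖S |max p.1 0 - max t₀ 0| u₀ - u₀‖) (𝓝 (t₀, u₀)) (𝓝 0) := by
    have h1 : Tendsto (fun p : ℝ × H l => ‖p.2 - u₀‖) (𝓝 (t₀, u₀)) (𝓝 0) := by
      have hc : ContinuousAt (fun p : ℝ × H l => ‖p.2 - u₀‖) (t₀, u₀) := by fun_prop
      simpa [ContinuousAt] using hc
    have h2 : Tendsto (fun p : ℝ × H l => ‖S |max p.1 0 - max t₀ 0| u₀ - u₀‖)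
        (𝓝 (t₀, u₀)) (𝓝 0) := by
      have h3 := (hz u₀).tendsto.comp hab
      rw [hS.zero] at h3
      exact tendsto_iff_norm_sub_tendsto_zero.1 h3
    simpa using (h1.const_mul M).add (h2.const_mul M)
  rw [ContinuousAt, tendsto_iff_norm_sub_tendsto_zero]
  refine squeeze_zero' (Eventually.of_forall fun _ => norm_nonneg _) ?_ hlim
  filter_upwards [hM'] with p hp
  have e : S (max p.1 0) p.2 - S (max t₀ 0) u₀ =
      S (max p.1 0) (p.2 - u₀) + (S (max p.1 0) u₀ - S (max t₀ 0) u₀) := by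
    rw [map_sub]
    abel
  rw [e]
  refine (norm_add_le _ _).trans (add_le_add ((S _).le_of_opNorm_le hp _) ?_)
  rcases le_total (max p.1 0) (max t₀ 0) with h | h
  · rw [norm_sub_rev, abs_sub_comm, abs_of_nonneg (sub_nonneg.2 h)]
    exact hdiff M _ _ _ (le_max_right _ _) h hp
  · rw [abs_of_nonneg (sub_nonneg.2 h)]
    exact hdiff M _ _ _ (le_max_right _ _) h (hM _ ⟨le_max_right _ _, by linarith⟩)

lemma IsSemigroup.map_max_add (hS : IsSemigroup A S) {s t : ℝ} (hs : 0 ≤ s) (ht : 0 ≤ t)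
    (u : H l) : S s (S (max t 0) u) = S (max (s + t) 0) u := by
  rw [max_eq_left ht, max_eq_left (add_nonneg hs ht), hS.add s t hs ht]
  rfl

/-- The mild solution `S(t) u₀ + ∫₀ᵗ S(t - s) h(s) ds` of `y' = A y + h`, `y(0) = u₀`. The maximum
with `0` does not matter for `0 ≤ s ≤ t`; it makes the integrand continuous in `(t, s)`. -/
def mild (S : ℝ → H l →L[ℝ] H l) (u₀ : H l) (h : ℝ → H l) (t : ℝ) : H l :=
  S (max t 0) u₀ + ∫ s in (0 : ℝ)..t, S (max (t - s) 0) (h s)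

lemma IsSemigroup.continuous_comp (hS : IsSemigroup A S) {X : Type*} [TopologicalSpace X]
    {f : X → ℝ} {g : X → H l} (hf : Continuous f) (hg : Continuous g) :
    Continuous fun x => S (max (f x) 0) (g x) :=
  hS.continuous.comp (hf.prodMk hg)

lemma IsSemigroup.continuous_mild (hS : IsSemigroup A S) (u₀ : H l) {h : ℝ → H l}
    (hh : Continuous h) : Continuous (mild S u₀ h) := by
  refine (hS.continuous_comp continuous_id continuous_const).add ?_
  refine intervalIntegral.continuous_parametric_intervalIntegral_of_continuous
    (f := fun t s => S (max (t - s) 0) (h s)) ?_ continuous_id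
  exact hS.continuous_comp (continuous_fst.sub continuous_snd) (hh.comp continuous_snd)

lemma mild_zero (hS : IsSemigroup A S) (u₀ : H l) (h : ℝ → H l) : mild S u₀ h 0 = u₀ := by
  simp [mild, hS.zero]

/-- The increment of the forcing term of a mild solution. -/
lemma IsSemigroup.mild_add (hS : IsSemigroup A S) (u₀ : H l) {h : ℝ → H l} (hh : Continuous h)
    {t δ : ℝ} (ht : 0 ≤ t) (hδ : 0 ≤ δ) : mild S u₀ h (t + δ) =
      S δ (mild S u₀ h t) + ∫ r in (0 : ℝ)..δ, S (max (δ - r) 0) (h (t + r)) := by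
  have hc : ∀ a : ℝ, Continuous fun s => S (max (a - s) 0) (h s) := fun a =>
    hS.continuous_comp (continuous_const.sub continuous_id) hh
  have e1 : ∫ s in (0 : ℝ)..(t + δ), S (max (t + δ - s) 0) (h s) =
      (∫ s in (0 : ℝ)..t, S (max (t + δ - s) 0) (h s)) +
        ∫ s in t..(t + δ), S (max (t + δ - s) 0) (h s) :=
    (intervalIntegral.integral_add_adjacent_intervals ((hc _).intervalIntegrable _ _)
      ((hc _).intervalIntegrable _ _)).symm
  have e2 : ∫ s in (0 : ℝ)..t, S (max (t + δ - s) 0) (h s) =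
      S δ (∫ s in (0 : ℝ)..t, S (max (t - s) 0) (h s)) := by
    rw [← (S δ).intervalIntegral_comp_comm ((hc _).intervalIntegrable _ _)]
    refine intervalIntegral.integral_congr fun s hs => ?_
    rw [uIcc_of_le ht] at hs
    rw [hS.map_max_add hδ (sub_nonneg.2 hs.2)]
    congr 3
    ring
  have e3 : ∫ s in t..(t + δ), S (max (t + δ - s) 0) (h s) =
      ∫ r in (0 : ℝ)..δ, S (max (δ - r) 0) (h (t + r)) := by
    have := intervalIntegral.integral_comp_add_left (a := 0) (b := δ)
      (fun s => S (max (t + δ - s) 0) (h s)) t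
    rw [add_zero] at this
    rw [← this]
    refine intervalIntegral.integral_congr fun s _ => ?_
    congr 3
    ring
  rw [mild, mild, map_add, hS.map_max_add hδ ht, e1, e2, e3, add_comm δ t, add_assoc]

/-- The mean `ε⁻¹ ∫₀^ε S(r) u dr`, which belongs to the domain of the generator. -/
def mollify (hS : IsSemigroup A S) (ε : ℝ) : H l →L[ℝ] H l where
  toFun u := ε⁻¹ • ∫ r in (0 : ℝ)..ε, S (max r 0) u
  map_add' u v := by
    have hc : ∀ u, IntervalIntegrable (fun r => S (max r 0) u) volume 0 ε := fun u =>
      (hS.continuous_comp continuous_id continuous_const).intervalIntegrable _ _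
    simp only [map_add]
    rw [intervalIntegral.integral_add (hc u) (hc v), smul_add]
  map_smul' a u := by
    simp only [map_smul, RingHom.id_apply]
    rw [intervalIntegral.integral_smul, smul_comm]
  cont := by
    have hc : Continuous fun u : H l => ∫ r in (0 : ℝ)..ε, S (max r 0) u :=
      intervalIntegral.continuous_parametric_intervalIntegral_of_continuous
        (f := fun (u : H l) (r : ℝ) => S (max r 0) u)
        (hS.continuous_comp (X := H l × ℝ) continuous_snd continuous_fst) continuous_const
    exact hc.const_smul (ε⁻¹ : ℝ)

lemma mollify_apply (hS : IsSemigroup A S) (ε : ℝ) (u : H l) :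
    mollify hS ε u = ε⁻¹ • ∫ r in (0 : ℝ)..ε, S (max r 0) u := rfl

lemma map_mollify (hS : IsSemigroup A S) {ε δ : ℝ} (hε : 0 ≤ ε) (hδ : 0 ≤ δ) (u : H l) :
    S δ (mollify hS ε u) = ε⁻¹ • ((∫ r in (0 : ℝ)..(ε + δ), S (max r 0) u) -
      ∫ r in (0 : ℝ)..δ, S (max r 0) u) := by
  have hc : Continuous fun r => S (max r 0) u := hS.continuous_comp continuous_id continuous_const
  rw [mollify_apply, map_smul, ← (S δ).intervalIntegral_comp_comm (hc.intervalIntegrable _ _),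
    intervalIntegral.integral_interval_sub_left (hc.intervalIntegrable _ _)
      (hc.intervalIntegrable _ _)]
  congr 1
  have := intervalIntegral.integral_comp_add_right (a := 0) (b := ε)
    (fun r => S (max r 0) u) δ
  rw [zero_add] at this
  rw [← this]
  refine intervalIntegral.integral_congr fun r hr => ?_
  rw [uIcc_of_le hε] at hr
  rw [hS.map_max_add hδ hr.1, add_comm]

lemma mollify_map (hS : IsSemigroup A S) {ε δ : ℝ} (hε : 0 ≤ ε) (hδ : 0 ≤ δ) (u : H l) :
    mollify hS ε (S δ u) = S δ (mollify hS ε u) := by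
  have hc : Continuous fun r => S (max r 0) u := hS.continuous_comp continuous_id continuous_const
  rw [mollify_apply, mollify_apply, map_smul,
    ← (S δ).intervalIntegral_comp_comm (hc.intervalIntegrable _ _)]
  congr 1
  refine intervalIntegral.integral_congr fun r hr => ?_
  rw [uIcc_of_le hε] at hr
  rw [hS.map_max_add hδ hr.1, max_eq_left hr.1, max_eq_left (add_nonneg hδ hr.1), add_comm,
    hS.add r δ hr.1 hδ]
  rfl

/-- The orbit of a mean is differentiable at time `0`. -/
lemma hasDerivWithinAt_map_mollify (hS : IsSemigroup A S) {ε : ℝ} (hε : 0 < ε) (u : H l) :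
    HasDerivWithinAt (fun δ => S (max δ 0) (mollify hS ε u)) (ε⁻¹ • (S ε u - u)) (Ici 0) 0 := by
  have hc : Continuous fun r => S (max r 0) u := hS.continuous_comp continuous_id continuous_const
  have hder : ∀ t, HasDerivAt (fun s => ∫ r in (0 : ℝ)..s, S (max r 0) u) (S (max t 0) u) t :=
    fun t => intervalIntegral.integral_hasDerivAt_right (hc.intervalIntegrable _ _)
      (hc.stronglyMeasurableAtFilter _ _) hc.continuousAt
  have h1 : HasDerivAt (fun δ => ∫ r in (0 : ℝ)..(ε + δ), S (max r 0) u) (S ε u) 0 := by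
    have := (hder (ε + 0)).scomp 0 ((hasDerivAt_id (0 : ℝ)).const_add ε)
    rw [one_smul, add_zero, max_eq_left hε.le] at this
    exact this
  have h2 := hder 0
  rw [max_self, hS.zero] at h2
  refine ((h1.sub h2).const_smul ε⁻¹).hasDerivWithinAt.congr (fun δ hδ => ?_) ?_
  · simp only [Pi.smul_apply, Pi.sub_apply]
    rw [max_eq_left hδ, map_mollify hS hε.le hδ]
  · simp only [Pi.smul_apply, Pi.sub_apply]
    rw [max_self, map_mollify hS hε.le le_rfl]

lemma generator_mollify (hS : IsSemigroup A S) {ε : ℝ} (hε : 0 < ε) (u : H l) :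
    A (mollify hS ε u) (ε⁻¹ • (S ε u - u)) := by
  rw [hS.generator]
  have h := (hasDerivWithinAt_map_mollify hS hε u).Ioi_of_Ici
  rw [hasDerivWithinAt_iff_tendsto_slope' (by simp)] at h
  refine h.congr' ?_
  filter_upwards [self_mem_nhdsWithin] with t ht
  rw [slope_def_module, max_self, sub_zero, max_eq_left (le_of_lt ht), hS.zero]
  rfl

/-- The mean of a mild solution is a classical solution, with the mean of the forcing. -/
lemma hasDerivWithinAt_mollify_mild (hS : IsSemigroup A S) {ε : ℝ} (hε : 0 < ε) (u₀ : H l)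
    {h : ℝ → H l} (hh : Continuous h) {t : ℝ} (ht : 0 ≤ t) :
    HasDerivWithinAt (fun s => mollify hS ε (mild S u₀ h s))
      (ε⁻¹ • (S ε (mild S u₀ h t) - mild S u₀ h t) + mollify hS ε (h t)) (Ici t) t := by
  set R : ℝ → H l := fun δ => ∫ r in (0 : ℝ)..δ, S (max (δ - r) 0) (h (t + r)) with hR
  have hRd : HasDerivAt R (h t) 0 := by
    have hc : Continuous fun p : ℝ × ℝ => S (max (p.1 - p.2) 0) (h (t + p.2)) :=
      hS.continuous_comp (continuous_fst.sub continuous_snd)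
        (hh.comp (continuous_const.add continuous_snd))
    rw [hasDerivAt_iff_isLittleO, Asymptotics.isLittleO_iff]
    intro η hη
    have h0 : S (max ((0 : ℝ) - 0) 0) (h (t + 0)) = h t := by simp [hS.zero]
    have hnear := hc.continuousAt (x := (0, 0)) (Metric.closedBall_mem_nhds _ hη)
    simp only [h0] at hnear
    obtain ⟨d, hd, hball⟩ := Metric.mem_nhds_iff.1 hnear
    filter_upwards [Metric.ball_mem_nhds (0 : ℝ) hd] with δ hδ
    have hcδ : Continuous fun r => S (max (δ - r) 0) (h (t + r)) :=
      hc.comp (continuous_const.prodMk continuous_id)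
    have e : R δ - R 0 - (δ - 0) • h t =
        ∫ r in (0 : ℝ)..δ, (S (max (δ - r) 0) (h (t + r)) - h t) := by
      rw [intervalIntegral.integral_sub (hcδ.intervalIntegrable _ _)
        (continuous_const.intervalIntegrable _ _), intervalIntegral.integral_const]
      simp [hR]
    rw [e]
    refine intervalIntegral.norm_integral_le_of_norm_le_const fun r hr => ?_
    have hδ' : |δ| < d := by simpa using hδ
    have hr' : |r| < d := by
      rcases abs_lt.1 hδ' with ⟨k1, k2⟩
      rcases mem_uIoc.1 hr with ⟨k3, k4⟩ | ⟨k3, k4⟩ <;> exact abs_lt.2 ⟨by linarith, by linarith⟩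
    have hmem : ((δ, r) : ℝ × ℝ) ∈ Metric.ball ((0, 0) : ℝ × ℝ) d := by
      rw [Metric.mem_ball, Prod.dist_eq]
      simpa using ⟨hδ', hr'⟩
    simpa [dist_eq_norm] using hball hmem
  set Z := mollify hS ε (mild S u₀ h t) with hZ
  have h1 : HasDerivWithinAt (fun s => S (max (s - t) 0) Z)
      (ε⁻¹ • (S ε (mild S u₀ h t) - mild S u₀ h t)) (Ici t) t := by
    have h2 : HasDerivWithinAt (fun δ => S (max δ 0) Z)
        (ε⁻¹ • (S ε (mild S u₀ h t) - mild S u₀ h t)) (Ici 0) (t - t) := by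
      rw [sub_self]
      exact hasDerivWithinAt_map_mollify hS hε (mild S u₀ h t)
    have := h2.scomp (h := fun s => s - t) t
      (((hasDerivAt_id t).sub_const t).hasDerivWithinAt (s := Ici t))
      (fun s hs => sub_nonneg.2 (mem_Ici.1 hs))
    rw [one_smul] at this
    exact this
  have h2 : HasDerivWithinAt (fun s => mollify hS ε (R (s - t))) (mollify hS ε (h t)) (Ici t) t := by
    have hRd' : HasDerivAt R (h t) (t - t) := by rwa [sub_self]
    have := hRd'.scomp (h := fun s => s - t) t ((hasDerivAt_id t).sub_const t)
    rw [one_smul] at this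
    exact ((mollify hS ε).hasFDerivAt.comp_hasDerivAt t this).hasDerivWithinAt
  refine (h1.add h2).congr (fun s hs => ?_) ?_
  · have hs' : 0 ≤ s - t := sub_nonneg.2 hs
    have e := hS.mild_add u₀ hh ht hs'
    rw [add_sub_cancel] at e
    rw [e, map_add, mollify_map hS hε.le hs']
    simp only [Pi.add_apply]
    rw [max_eq_left hs']
  · have e := hS.mild_add u₀ hh ht (le_refl (0 : ℝ))
    rw [add_zero] at e
    simp only [Pi.add_apply, hR]
    simp [hS.zero, hZ]

/-- The means converge to the identity, uniformly along a continuous path. -/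
lemma exists_mollify_close (hS : IsSemigroup A S) {f : ℝ → H l} (hf : Continuous f) (T : ℝ)
    {η : ℝ} (hη : 0 < η) :
    ∃ ε₀ > 0, ∀ ε, 0 < ε → ε ≤ ε₀ → ∀ t ∈ Icc 0 T, ‖mollify hS ε (f t) - f t‖ ≤ η := by
  have hev : ∀ᶠ r in 𝓝 (0 : ℝ), ∀ t ∈ Icc 0 T, ‖S (max r 0) (f t) - f t‖ < η := by
    refine isCompact_Icc.eventually_forall_of_forall_eventually fun t _ => ?_
    have hc : Continuous fun p : ℝ × ℝ => ‖S (max p.1 0) (f p.2) - f p.2‖ :=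
      ((hS.continuous_comp continuous_fst (hf.comp continuous_snd)).sub
        (hf.comp continuous_snd)).norm
    have h0 : ‖S (max (0 : ℝ) 0) (f t) - f t‖ < η := by simpa [hS.zero] using hη
    exact hc.continuousAt (x := (0, t)) (Iio_mem_nhds h0)
  obtain ⟨d, hd, hball⟩ := Metric.eventually_nhds_iff.1 hev
  refine ⟨d / 2, by positivity, fun ε hε hεd t ht => ?_⟩
  have hc : Continuous fun r => S (max r 0) (f t) :=
    hS.continuous_comp continuous_id continuous_const
  have e : mollify hS ε (f t) - f t = ε⁻¹ • ∫ r in (0 : ℝ)..ε, (S (max r 0) (f t) - f t) := by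
    rw [intervalIntegral.integral_sub (hc.intervalIntegrable _ _)
      (continuous_const.intervalIntegrable _ _), intervalIntegral.integral_const, smul_sub,
      sub_zero, smul_smul, inv_mul_cancel₀ hε.ne', one_smul, mollify_apply]
  have h1 : ‖∫ r in (0 : ℝ)..ε, (S (max r 0) (f t) - f t)‖ ≤ η * |ε - 0| := by
    refine intervalIntegral.norm_integral_le_of_norm_le_const fun r hr => ?_
    rw [uIoc_of_le hε.le] at hr
    refine (hball ?_ t ht).le
    rw [Real.dist_eq, sub_zero, abs_of_pos hr.1]
    linarith [hr.2]
  rw [sub_zero, abs_of_pos hε] at h1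
  rw [e, norm_smul, norm_inv, Real.norm_of_nonneg hε.le]
  calc ε⁻¹ * ‖∫ r in (0 : ℝ)..ε, (S (max r 0) (f t) - f t)‖ ≤ ε⁻¹ * (η * ε) := by gcongr
    _ = η := by field_simp

lemma IsSemigroup.generator_sub (hS : IsSemigroup A S) {u u' w w' : H l} (h : A u w)
    (h' : A u' w') : A (u - u') (w - w') := by
  rw [hS.generator] at h h' ⊢
  refine (h.sub h').congr fun t => ?_
  rw [← smul_sub, map_sub]
  congr 1
  abel

end Semigroup

/-! ### Regularized solutions and their energy -/

/-- A path `z` in `V` that solves `z' = a + k`, where `a(t) = A z(t)`, from the right on `[0, ∞)`: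
a classical solution of the linear equation with forcing `k`. -/
structure IsClassical {l : ℝ} (A : H l → H l → Prop) (z : ℝ → V l) (a k : ℝ → H l) : Prop where
  continuous : Continuous z
  continuous_generator : Continuous a
  continuous_forcing : Continuous k
  generator : ∀ t, A (Vfn (z t)) (a t)
  hasDeriv : ∀ t, 0 ≤ t → HasDerivWithinAt (fun s => Vfn (z s)) (a t + k t) (Ici t) t

section Energy

variable {l c : ℝ} {bc : BC} {S : ℝ → H l →L[ℝ] H l}

/-- The estimate of the quadratic form of `A` at an element of the domain that is given as an
element of `V`. -/
lemma IsA.inner_le (hl : 0 < l) {v : V l} {w : H l} (h : IsA l c bc (Vfn v) w) (b : ℝ) :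
    2 * inner ℝ w (Vfn v) ≤
      -(b - 2) * ‖Vdx v‖ ^ 2 + (b ^ 2 / 8 - 2 * c) * ‖Vfn v‖ ^ 2 := by
  obtain ⟨v', hv', hb⟩ := h.exists_V hl
  rw [Vfn_injective hl hv'] at hb
  exact hb b

/-- The mollified mild solutions are classical solutions close to the mild solution. -/
lemma exists_classical (hl : 0 < l) (hc : 0 ≤ c) (hS : IsSemigroup (IsA l c bc) S) (u₀ : H l)
    {h : ℝ → H l} (hh : Continuous h) (T : ℝ) {η : ℝ} (hη : 0 < η) :
    ∃ (z : ℝ → V l) (a k : ℝ → H l), IsClassical (IsA l c bc) z a k ∧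
      ∀ t ∈ Icc 0 T, ‖Vfn (z t) - mild S u₀ h t‖ ≤ η ∧ ‖k t - h t‖ ≤ η := by
  have hy := hS.continuous_mild u₀ hh
  obtain ⟨ε₁, hε₁, h1⟩ := exists_mollify_close hS hy T hη
  obtain ⟨ε₂, hε₂, h2⟩ := exists_mollify_close hS hh T hη
  set ε := min ε₁ ε₂ with hεdef
  have hε : 0 < ε := lt_min hε₁ hε₂
  set a : ℝ → H l := fun t => ε⁻¹ • (S ε (mild S u₀ h t) - mild S u₀ h t) with ha
  have hgen : ∀ t, IsA l c bc (mollify hS ε (mild S u₀ h t)) (a t) := fun t =>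
    generator_mollify hS hε _
  choose z hz _ using fun t => (hgen t).exists_V hl
  have hac : Continuous a := (((S ε).continuous.comp hy).sub hy).const_smul ε⁻¹
  have hZc : Continuous fun t => mollify hS ε (mild S u₀ h t) := (mollify hS ε).continuous.comp hy
  have hZ : (fun t => Vfn (z t)) = fun t => mollify hS ε (mild S u₀ h t) := funext hz
  refine ⟨z, a, fun t => mollify hS ε (h t), ⟨?_, hac, (mollify hS ε).continuous.comp hh,
    fun t => by rw [hz]; exact hgen t, fun t ht => ?_⟩, fun t ht => ⟨?_, ?_⟩⟩
  · have hbound : ∀ s t, ‖z t - z s‖ ^ 2 ≤ 2 * ‖Vfn (z t) - Vfn (z s)‖ ^ 2 +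
        ‖a t - a s‖ * ‖Vfn (z t) - Vfn (z s)‖ := by
      intro s t
      have hg : IsA l c bc (Vfn (z t - z s)) (a t - a s) := by
        rw [Vfn_sub, hz, hz]
        exact hS.generator_sub (hgen t) (hgen s)
      have e := hg.inner_le hl 4
      have e2 := neg_abs_le (inner ℝ (a t - a s) (Vfn (z t - z s)))
      have e3 := abs_real_inner_le_norm (a t - a s) (Vfn (z t - z s))
      rw [norm_V_sq]
      rw [Vfn_sub] at e e2 e3 ⊢
      nlinarith [mul_nonneg hc (sq_nonneg ‖Vfn (z t) - Vfn (z s)‖)]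
    rw [continuous_iff_continuousAt]
    intro s
    have hlim : Tendsto (fun t => 2 * ‖Vfn (z t) - Vfn (z s)‖ ^ 2 +
        ‖a t - a s‖ * ‖Vfn (z t) - Vfn (z s)‖) (𝓝 s) (𝓝 0) := by
      have hcZ : Continuous fun t => Vfn (z t) := by rw [hZ]; exact hZc
      have : Continuous fun t => 2 * ‖Vfn (z t) - Vfn (z s)‖ ^ 2 +
          ‖a t - a s‖ * ‖Vfn (z t) - Vfn (z s)‖ := by fun_prop
      simpa using this.tendsto s
    rw [ContinuousAt, tendsto_iff_norm_sub_tendsto_zero]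
    have hsq : Tendsto (fun t => ‖z t - z s‖ ^ 2) (𝓝 s) (𝓝 0) :=
      squeeze_zero (fun _ => sq_nonneg _) (fun t => hbound s t) hlim
    simpa [Real.sqrt_sq (norm_nonneg _)] using hsq.sqrt
  · rw [hZ]
    exact hasDerivWithinAt_mollify_mild hS hε u₀ hh ht
  · rw [hz]
    exact h1 ε hε (min_le_left _ _) t ht
  · exact h2 ε hε (min_le_right _ _) t ht

lemma IsClassical.sub (hS : IsSemigroup (IsA l c bc) S) {z z' : ℝ → V l} {a a' k k' : ℝ → H l}
    (h : IsClassical (IsA l c bc) z a k) (h' : IsClassical (IsA l c bc) z' a' k') :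
    IsClassical (IsA l c bc) (fun t => z t - z' t) (fun t => a t - a' t)
      (fun t => k t - k' t) where
  continuous := h.continuous.sub h'.continuous
  continuous_generator := h.continuous_generator.sub h'.continuous_generator
  continuous_forcing := h.continuous_forcing.sub h'.continuous_forcing
  generator t := hS.generator_sub (h.generator t) (h'.generator t)
  hasDeriv t ht := by
    refine ((h.hasDeriv t ht).sub (h'.hasDeriv t ht)).congr_deriv ?_
    abel

/-- The energy inequality of a classical solution; the number `b` is free. -/
lemma IsClassical.energy (hl : 0 < l) {z : ℝ → V l} {a k : ℝ → H l}
    (h : IsClassical (IsA l c bc) z a k) (b : ℝ) {t : ℝ} (ht : 0 ≤ t) :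
    ‖Vfn (z t)‖ ^ 2 ≤ ‖Vfn (z 0)‖ ^ 2 + ∫ s in (0 : ℝ)..t,
      (-(b - 2) * ‖Vdx (z s)‖ ^ 2 + (b ^ 2 / 8 - 2 * c) * ‖Vfn (z s)‖ ^ 2 +
        2 * inner ℝ (k s) (Vfn (z s))) := by
  have cz : Continuous fun s => Vfn (z s) := continuous_Vfn.comp h.continuous
  have cd : Continuous fun s => Vdx (z s) := continuous_Vdx.comp h.continuous
  have ca := h.continuous_generator
  have ck := h.continuous_forcing
  have hder : ∀ s ∈ Ioo 0 t, HasDerivWithinAt (fun s => ‖Vfn (z s)‖ ^ 2)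
      (2 * inner ℝ (Vfn (z s)) (a s + k s)) (Ioi s) s := fun s hs =>
    (h.hasDeriv s hs.1.le).norm_sq.Ioi_of_Ici
  have e := intervalIntegral.integral_eq_sub_of_hasDeriv_right_of_le ht
    (cz.norm.pow 2).continuousOn hder
    ((continuous_const.mul (cz.inner (ca.add ck))).intervalIntegrable _ _)
  have hle : ∫ s in (0 : ℝ)..t, 2 * inner ℝ (Vfn (z s)) (a s + k s) ≤ ∫ s in (0 : ℝ)..t,
      (-(b - 2) * ‖Vdx (z s)‖ ^ 2 + (b ^ 2 / 8 - 2 * c) * ‖Vfn (z s)‖ ^ 2 +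
        2 * inner ℝ (k s) (Vfn (z s))) := by
    refine intervalIntegral.integral_mono_on ht
      ((continuous_const.mul (cz.inner (ca.add ck))).intervalIntegrable _ _)
      (Continuous.intervalIntegrable (by fun_prop) _ _) fun s _ => ?_
    have := (h.generator s).inner_le hl b
    rw [real_inner_comm, inner_add_left]
    linarith
  simp only [Pi.pow_apply] at e
  linarith

end Energy

/-- Grönwall's inequality in integral form, for continuous functions, with a constant majorant. -/
lemma gronwall_integral {T K : ℝ} {φ f : ℝ → ℝ} (hφ : ContinuousOn φ (Icc 0 T))
    (hf : ContinuousOn f (Icc 0 T)) (hf0 : ∀ t ∈ Icc 0 T, 0 ≤ f t) (hK : 0 ≤ K)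
    (h : ∀ t ∈ Icc 0 T, φ t ≤ K + ∫ s in (0 : ℝ)..t, f s * φ s) {t : ℝ} (ht : t ∈ Icc 0 T) :
    φ t ≤ K * Real.exp (∫ s in (0 : ℝ)..T, f s) := by
  have hT : 0 ≤ T := ht.1.trans ht.2
  have hfφ : ContinuousOn (fun s => f s * φ s) (Icc 0 T) := hf.mul hφ
  have hprim : ∀ {g : ℝ → ℝ}, ContinuousOn g (Icc 0 T) →
      ContinuousOn (fun t => ∫ s in (0 : ℝ)..t, g s) (Icc 0 T) := fun hg => by
    have := intervalIntegral.continuousOn_primitive_interval (μ := volume) (a := 0) (b := T)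
      (by rw [uIcc_of_le hT]; exact hg.integrableOn_Icc)
    rwa [uIcc_of_le hT] at this
  have hder : ∀ {g : ℝ → ℝ}, ContinuousOn g (Icc 0 T) → ∀ t ∈ Ioo 0 T,
      HasDerivAt (fun t => ∫ s in (0 : ℝ)..t, g s) (g t) t := fun {g} hg t ht => by
    have hgo : ContinuousOn g (Ioo 0 T) := hg.mono Ioo_subset_Icc_self
    refine intervalIntegral.integral_hasDerivAt_right ?_
      (hgo.stronglyMeasurableAtFilter isOpen_Ioo t ht) (hgo.continuousAt (Ioo_mem_nhds ht.1 ht.2))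
    refine (hg.mono ?_).intervalIntegrable
    rw [uIcc_of_le ht.1.le]
    exact Icc_subset_Icc_right ht.2.le
  set U : ℝ → ℝ := fun t => K + ∫ s in (0 : ℝ)..t, f s * φ s with hU
  set F : ℝ → ℝ := fun t => ∫ s in (0 : ℝ)..t, f s with hF
  have hanti : AntitoneOn (fun t => U t * Real.exp (-F t)) (Icc 0 T) := by
    have hd : ∀ t ∈ Ioo 0 T, HasDerivAt (fun t => U t * Real.exp (-F t))
        (f t * φ t * Real.exp (-F t) + U t * (Real.exp (-F t) * -f t)) t := fun t ht =>
      ((hder hfφ t ht).const_add K).mul ((hder hf t ht).neg.exp)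
    refine antitoneOn_of_deriv_nonpos (convex_Icc 0 T)
      ((continuousOn_const.add (hprim hfφ)).mul (hprim hf).neg.rexp) ?_ ?_
    · rw [interior_Icc]
      exact fun t ht => (hd t ht).differentiableAt.differentiableWithinAt
    · rw [interior_Icc]
      intro t ht
      rw [(hd t ht).deriv]
      have h1 := mul_le_mul_of_nonneg_left (h t (Ioo_subset_Icc_self ht))
        (hf0 t (Ioo_subset_Icc_self ht))
      have h2 := mul_le_mul_of_nonneg_right h1 (Real.exp_pos (-F t)).le
      simp only [hU] at h2 ⊢
      linarith
  have h0 := hanti ⟨le_rfl, hT⟩ ht ht.1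
  simp only [hU, hF, intervalIntegral.integral_same, add_zero, neg_zero, Real.exp_zero,
    mul_one] at h0
  have hmono : F t ≤ F T := by
    simp only [hF]
    refine intervalIntegral.integral_mono_interval le_rfl ht.1 ht.2 ?_
      (hf.mono (by rw [uIcc_of_le hT])).intervalIntegrable
    rw [Filter.EventuallyLE, ae_restrict_iff' measurableSet_Ioc]
    exact Eventually.of_forall fun s hs => hf0 s ⟨hs.1.le, hs.2⟩
  have hUt : U t ≤ K * Real.exp (F t) := by
    have := mul_le_mul_of_nonneg_right h0 (Real.exp_pos (F t)).le
    rwa [mul_assoc, ← Real.exp_add, neg_add_cancel, Real.exp_zero, mul_one] at this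
  exact (h t ht).trans (hUt.trans (by gcongr))

/-! ### Paths in `L⁴(I)` -/

lemma tendsto_zero_of_pow_four {ι : Type*} {F : Filter ι} {f : ι → ℝ≥0∞}
    (h : Tendsto (fun i => f i ^ 4) F (𝓝 0)) : Tendsto f F (𝓝 0) := by
  have h3 := (ENNReal.continuous_rpow_const (y := 1 / 4)).tendsto 0 |>.comp h
  rw [ENNReal.zero_rpow_of_pos (by norm_num)] at h3
  refine h3.congr fun s => ?_
  rw [Function.comp_apply, ← ENNReal.rpow_natCast, ← ENNReal.rpow_mul]
  norm_num

section Paths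

variable {l T : ℝ}

lemma ContinuousInL4.lt_top {u : ℝ → H l} (h : ContinuousInL4 T u) {t : ℝ} (ht : t ∈ Icc 0 T) :
    L4e (u t) < ∞ := (h t ht).1

lemma ContinuousInL4.continuousOn {u : ℝ → H l} (h : ContinuousInL4 T u) :
    ContinuousOn u (Icc 0 T) := by
  obtain ⟨K, hK⟩ := exists_enorm_le_L4e l
  intro t ht
  rw [ContinuousWithinAt, tendsto_iff_edist_tendsto_0]
  refine tendsto_of_tendsto_of_tendsto_of_le_of_le tendsto_const_nhds ?_ (fun _ => zero_le)
    (fun s => (edist_eq_enorm_sub (u s) (u t)).trans_le (hK _))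
  simpa using ENNReal.Tendsto.const_mul (h t ht).2 (Or.inr ENNReal.coe_ne_top)

lemma ContinuousInL4.continuousOn_L4 {u : ℝ → H l} (h : ContinuousInL4 T u) :
    ContinuousOn (fun t => L4 (u t)) (Icc 0 T) := by
  intro t ht
  rw [ContinuousWithinAt, tendsto_iff_norm_sub_tendsto_zero]
  have h0 : Tendsto (fun s => L4 (u s - u t)) (𝓝[Icc 0 T] t) (𝓝 0) := by
    exact (ENNReal.tendsto_toReal ENNReal.zero_ne_top).comp (h t ht).2
  refine squeeze_zero' (Eventually.of_forall fun _ => norm_nonneg _) ?_ h0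
  filter_upwards [self_mem_nhdsWithin] with s hs
  exact abs_L4_sub_le (h.lt_top hs) (h.lt_top ht)

lemma ContinuousInL4.add {u v : ℝ → H l} (hu : ContinuousInL4 T u) (hv : ContinuousInL4 T v) :
    ContinuousInL4 T (fun t => u t + v t) := by
  refine fun t ht => ⟨L4e_add_lt_top (hu.lt_top ht) (hv.lt_top ht), ?_⟩
  have h := (hu t ht).2.add (hv t ht).2
  rw [add_zero] at h
  refine tendsto_of_tendsto_of_tendsto_of_le_of_le tendsto_const_nhds h (fun _ => zero_le)
    fun s => ?_
  rw [add_sub_add_comm]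
  exact L4e_add_le _ _

lemma ContinuousInL4.sub {u v : ℝ → H l} (hu : ContinuousInL4 T u) (hv : ContinuousInL4 T v) :
    ContinuousInL4 T (fun t => u t - v t) := by
  refine fun t ht => ⟨L4e_sub_lt_top (hu.lt_top ht) (hv.lt_top ht), ?_⟩
  have h := (hu t ht).2.add (hv t ht).2
  rw [add_zero] at h
  refine tendsto_of_tendsto_of_tendsto_of_le_of_le tendsto_const_nhds h (fun _ => zero_le)
    fun s => ?_
  rw [sub_sub_sub_comm]
  exact L4e_sub_le _ _

lemma L4e_Vfn_pow_le_norm (v : V l) : L4e (Vfn v) ^ 4 ≤ 2 * ‖v‖ₑ ^ 4 := by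
  refine (L4e_Vfn_pow_le v).trans ?_
  have e : 2 * ‖v‖ₑ ^ 4 = ENNReal.ofReal (2 * ‖v‖ ^ 4) := by
    rw [ENNReal.ofReal_mul (by norm_num), ENNReal.ofReal_pow (norm_nonneg _), ofReal_norm]
    simp
  rw [e]
  refine ENNReal.ofReal_le_ofReal ?_
  calc 2 * ‖Vfn v‖ ^ 3 * ‖Vdx v‖ ≤ 2 * ‖v‖ ^ 3 * ‖v‖ := by
        gcongr
        · exact norm_Vfn_le v
        · exact norm_Vdx_le v
    _ = _ := by ring

lemma continuousInL4_Vfn {z : ℝ → V l} (hz : Continuous z) :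
    ContinuousInL4 T (fun t => Vfn (z t)) := by
  refine fun t _ => ⟨L4e_Vfn_lt_top _, ?_⟩
  have h1 : Tendsto (fun s => 2 * ‖z s - z t‖ₑ ^ 4) (𝓝[Icc 0 T] t) (𝓝 0) := by
    have hc : Tendsto (fun s => ‖z s - z t‖ₑ) (𝓝[Icc 0 T] t) (𝓝 0) := by
      simpa only [edist_eq_enorm_sub] using tendsto_iff_edist_tendsto_0.1
        ((hz.tendsto t).mono_left (nhdsWithin_le_nhds (s := Icc 0 T)))
    simpa using ENNReal.Tendsto.const_mul (ENNReal.Tendsto.pow (n := 4) hc)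
      (Or.inr (by norm_num : (2 : ℝ≥0∞) ≠ ∞))
  have h2 : Tendsto (fun s => L4e (Vfn (z s) - Vfn (z t)) ^ 4) (𝓝[Icc 0 T] t) (𝓝 0) :=
    tendsto_of_tendsto_of_tendsto_of_le_of_le tendsto_const_nhds h1 (fun _ => zero_le)
      fun s => by rw [← Vfn_sub]; exact L4e_Vfn_pow_le_norm _
  exact tendsto_zero_of_pow_four h2

lemma ContinuousInL4.intervalIntegrable_pow (hT : 0 ≤ T) {u : ℝ → H l} (h : ContinuousInL4 T u) :
    IntervalIntegrable (fun t => L4 (u t) ^ 4) volume 0 T := by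
  refine ContinuousOn.intervalIntegrable ?_
  rw [uIcc_of_le hT]
  exact h.continuousOn_L4.pow 4

lemma lintegral_L4e_eq (hT : 0 ≤ T) {u : ℝ → H l} (h : ContinuousInL4 T u) :
    ∫⁻ t in Ioo 0 T, L4e (u t) ^ 4 = ENNReal.ofReal (∫ t in (0 : ℝ)..T, L4 (u t) ^ 4) := by
  have hc : ContinuousOn (fun t => L4 (u t) ^ 4) (Icc 0 T) := h.continuousOn_L4.pow 4
  rw [intervalIntegral.integral_of_le hT, integral_Ioc_eq_integral_Ioo,
    ofReal_integral_eq_lintegral_ofReal (hc.integrableOn_Icc.mono_set Ioo_subset_Icc_self)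
      (Eventually.of_forall fun t => pow_nonneg (L4_nonneg _) 4)]
  refine setLIntegral_congr_fun measurableSet_Ioo fun t ht => ?_
  rw [ENNReal.ofReal_pow (L4_nonneg _), ofReal_L4 (h.lt_top (Ioo_subset_Icc_self ht))]

lemma ennreal_add_pow_four_le (a b : ℝ≥0∞) : (a + b) ^ 4 ≤ 16 * (a ^ 4 + b ^ 4) := by
  have h1 : a + b ≤ 2 * max a b := by
    rw [two_mul]
    exact add_le_add (le_max_left _ _) (le_max_right _ _)
  calc (a + b) ^ 4 ≤ (2 * max a b) ^ 4 := by gcongr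
    _ = 16 * max a b ^ 4 := by rw [mul_pow]; norm_num
    _ ≤ 16 * (a ^ 4 + b ^ 4) := by
        gcongr
        rcases max_choice a b with h | h <;> rw [h]
        · exact le_self_add
        · exact le_add_self

/-- The triangle inequality in `E`, for the fourth power of the norm. -/
lemma lintegral_L4e_add_le {u v : ℝ → H l}
    (hu : AEStronglyMeasurable u (volume.restrict (Ioo 0 T))) :
    ∫⁻ t in Ioo 0 T, L4e (u t + v t) ^ 4 ≤
      16 * ((∫⁻ t in Ioo 0 T, L4e (u t) ^ 4) + ∫⁻ t in Ioo 0 T, L4e (v t) ^ 4) := by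
  have hm : AEMeasurable (fun t => L4e (u t) ^ 4) (volume.restrict (Ioo 0 T)) :=
    ((measurable_L4e l).comp_aemeasurable hu.aemeasurable).pow_const 4
  rw [← lintegral_add_left' hm, ← lintegral_const_mul' _ _ (by norm_num)]
  refine lintegral_mono fun t => ?_
  exact (pow_le_pow_left' (L4e_add_le _ _) 4).trans (ennreal_add_pow_four_le _ _)

end Paths

/-! ### The forcing tested against an approximation -/

/-- The part of the forcing that the energy estimate does not absorb: it is small if `v` is close
to `z + w` in `L⁴` and `k` to the nonlinearity at `v` in `H`. -/
def defect {l : ℝ} (c : ℝ) (z v : V l) (w k : H l) : ℝ :=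
  L4 (Vfn v - Vfn z - w) * L4 (Vfn v + Vfn z + w) * ‖Vdx z‖ +
    2 * c * (‖Vfn v - Vfn z - w‖ * ‖Vfn z‖) + 2 * (‖k - G0 c v‖ * ‖Vfn z‖)

/-- The forcing `k` of an approximation `z`, tested against `z`. Here `v` is the argument of the
nonlinearity, which in the limit is `z + w`. -/
lemma two_inner_forcing_le {l c : ℝ} (hl : 0 < l) (hc : 0 ≤ c) (z v : V l) {w : H l} (k : H l)
    (hw : L4e w < ∞) : 2 * inner ℝ k (Vfn z) ≤
      noiseTerm z w + 2 * c * ‖Vfn z‖ ^ 2 + 2 * c * inner ℝ w (Vfn z) + defect c z v w k := by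
  have hv4 := L4e_Vfn_lt_top v
  have hz4 := L4e_Vfn_lt_top z
  set e : H l := Vfn v - Vfn z - w with he
  have he4 : L4e e < ∞ := L4e_sub_lt_top (L4e_sub_lt_top hv4 hz4) hw
  have hs4 : L4e (Vfn v + Vfn z + w) < ∞ := L4e_add_lt_top (L4e_add_lt_top hv4 hz4) hw
  have hzw : L4e (Vfn z + w) < ∞ := L4e_add_lt_top hz4 hw
  have hv : Vfn v = e + (Vfn z + w) := by rw [he]; abel
  have t1 : triple (Vfn v) (Vfn v) (Vdx z) = triple e (Vfn v + Vfn z + w) (Vdx z) +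
      noiseTerm z w := by
    have a1 : triple e (Vfn v + Vfn z + w) (Vdx z) =
        triple (Vfn v) (Vfn v) (Vdx z) - triple (Vfn z + w) (Vfn z + w) (Vdx z) := by
      rw [add_assoc, triple_comm, triple_add_left hv4 hzw he4, triple_comm (Vfn v) e,
        triple_comm (Vfn z + w) e, show e = Vfn v - (Vfn z + w) by rw [he]; abel,
        triple_sub_left hv4 hzw hv4, triple_sub_left hv4 hzw hzw, triple_comm (Vfn z + w) (Vfn v)]
      ring
    have a2 : triple (Vfn z + w) (Vfn z + w) (Vdx z) = noiseTerm z w := by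
      rw [triple_add_left hz4 hw hzw, triple_comm (Vfn z), triple_comm w (Vfn z + w),
        triple_add_left hz4 hw hz4, triple_add_left hz4 hw hw, triple_self_Vdx hl, noiseTerm,
        triple_comm w (Vfn z)]
      ring
    rw [a1, a2]
    ring
  have t2 := (le_abs_self _).trans (abs_triple_le he4 hs4 (Vdx z))
  have t3 := inner_G0 hl c v z
  have t4 : inner ℝ (Vfn v) (Vfn z) =
      inner ℝ e (Vfn z) + ‖Vfn z‖ ^ 2 + inner ℝ w (Vfn z) := by
    rw [hv, inner_add_left, inner_add_left, real_inner_self_eq_norm_sq, add_assoc]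
  have t5 := mul_le_mul_of_nonneg_left (real_inner_le_norm e (Vfn z)) hc
  have t6 := real_inner_le_norm (k - G0 c v) (Vfn z)
  rw [inner_sub_left] at t6
  rw [defect, ← he]
  rw [t1, t4] at t3
  linarith

/-! ### Comparison of two approximations -/

section Comparison

variable {l c T : ℝ} {bc : BC} {S : ℝ → H l →L[ℝ] H l}

/-- A bound of what the forcings `G₀(v)` and `G₀(v')` contribute to the energy of the difference of
two approximations; it is small if `v - v'` is small in `L⁴`. -/
def forcingGap (c : ℝ) (v v' : V l) : ℝ :=
  1 / 4 * (L4 (Vfn v - Vfn v') ^ 2 * L4 (Vfn v + Vfn v') ^ 2) + c * ‖Vfn v - Vfn v'‖ ^ 2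

lemma forcingGap_nonneg (hc : 0 ≤ c) (v v' : V l) : 0 ≤ forcingGap c v v' := by
  unfold forcingGap
  positivity

lemma continuousOn_forcingGap {v v' : ℝ → V l} (hv : Continuous v) (hv' : Continuous v') :
    ContinuousOn (fun t => forcingGap c (v t) (v' t)) (Icc 0 T) := by
  have h1 : ContinuousInL4 T fun t => Vfn (v t) := continuousInL4_Vfn hv
  have h2 : ContinuousInL4 T fun t => Vfn (v' t) := continuousInL4_Vfn hv'
  exact (continuousOn_const.mul (((h1.sub h2).continuousOn_L4.pow 2).mul
    ((h1.add h2).continuousOn_L4.pow 2))).add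
      (continuousOn_const.mul ((h1.sub h2).continuousOn.norm.pow 2))

/-- The forcing `G₀(v) - G₀(v')` tested against `δ ∈ V`. -/
lemma two_inner_G0_sub_le (hl : 0 < l) (hc : 0 ≤ c) (v v' δ : V l) :
    2 * inner ℝ (G0 c v - G0 c v') (Vfn δ) ≤
      ‖Vdx δ‖ ^ 2 + c * ‖Vfn δ‖ ^ 2 + forcingGap c v v' := by
  have h1 := L4e_Vfn_lt_top v
  have h2 := L4e_Vfn_lt_top v'
  have hs := L4e_add_lt_top h1 h2
  have hd := L4e_sub_lt_top h1 h2
  have e : triple (Vfn v) (Vfn v) (Vdx δ) - triple (Vfn v') (Vfn v') (Vdx δ) =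
      triple (Vfn v - Vfn v') (Vfn v + Vfn v') (Vdx δ) := by
    rw [triple_sub_left h1 h2 hs, triple_comm (Vfn v) (Vfn v + Vfn v'),
      triple_comm (Vfn v') (Vfn v + Vfn v'),
      triple_add_left h1 h2 h1, triple_add_left h1 h2 h2, triple_comm (Vfn v') (Vfn v)]
    ring
  have t1 := (le_abs_self _).trans (abs_triple_le hd hs (Vdx δ))
  have t2 := real_inner_le_norm (Vfn v - Vfn v') (Vfn δ)
  have t3 : 2 * (c * inner ℝ (Vfn v - Vfn v') (Vfn δ)) ≤
      c * ‖Vfn δ‖ ^ 2 + c * ‖Vfn v - Vfn v'‖ ^ 2 := by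
    nlinarith [mul_nonneg hc (sq_nonneg (‖Vfn v - Vfn v'‖ - ‖Vfn δ‖)),
      mul_le_mul_of_nonneg_left t2 hc]
  rw [inner_sub_left, inner_G0 hl, inner_G0 hl, forcingGap]
  rw [inner_sub_left] at t3
  nlinarith [sq_nonneg (‖Vdx δ‖ - 1 / 2 * (L4 (Vfn v - Vfn v') * L4 (Vfn v + Vfn v')))]

/-- The energy estimate for the difference of two approximations. -/
lemma IsClassical.norm_sub_le (hl : 0 < l) (hc : 0 ≤ c) (hT : 0 ≤ T)
    (hS : IsSemigroup (IsA l c bc) S) {z z' v v' : ℝ → V l} {a a' k k' : ℝ → H l}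
    (h : IsClassical (IsA l c bc) z a k) (h' : IsClassical (IsA l c bc) z' a' k')
    (hv : Continuous v) (hv' : Continuous v') {η : ℝ}
    (hk : ∀ t ∈ Icc 0 T, ‖(k t - G0 c (v t)) - (k' t - G0 c (v' t))‖ ≤ η)
    (h0 : ‖Vfn (z 0) - Vfn (z' 0)‖ ≤ η) {R : ℝ}
    (hR : (1 + T) * η ^ 2 + (∫ t in (0 : ℝ)..T, forcingGap c (v t) (v' t)) ≤ R) :
    (∀ t ∈ Icc 0 T, ‖Vfn (z t) - Vfn (z' t)‖ ^ 2 ≤ R * Real.exp (3 * T)) ∧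
      ∫ t in (0 : ℝ)..T, ‖z t - z' t‖ ^ 2 ≤ R * (1 + 4 * T * Real.exp (3 * T)) := by
  set δ : ℝ → V l := fun t => z t - z' t with hδ
  have hcl := h.sub hS h'
  have hη : 0 ≤ η := (norm_nonneg _).trans h0
  have cδ : Continuous δ := hcl.continuous
  have cf : Continuous fun t => Vfn (δ t) := continuous_Vfn.comp cδ
  have cd : Continuous fun t => Vdx (δ t) := continuous_Vdx.comp cδ
  have cg : ContinuousOn (fun t => forcingGap c (v t) (v' t)) (Icc 0 T) :=
    continuousOn_forcingGap hv hv'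
  have cgT : ∀ t ∈ Icc 0 T, IntervalIntegrable (fun t => forcingGap c (v t) (v' t)) volume 0 t :=
    fun t ht =>
      (cg.mono (by rw [uIcc_of_le ht.1]; exact Icc_subset_Icc_right ht.2)).intervalIntegrable
  have hR0 : 0 ≤ R := le_trans (add_nonneg (by positivity)
    (intervalIntegral.integral_nonneg hT fun t _ => forcingGap_nonneg hc _ _)) hR
  -- the choice `b = 4` leaves `-2 ‖δ'‖²`, half of which absorbs the forcing
  have key : ∀ t ∈ Icc 0 T, ‖Vfn (δ t)‖ ^ 2 + ∫ s in (0 : ℝ)..t, ‖Vdx (δ s)‖ ^ 2 ≤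
      R + ∫ s in (0 : ℝ)..t, 3 * ‖Vfn (δ s)‖ ^ 2 := by
    intro t ht
    have he := hcl.energy hl 4 ht.1
    have i1 : IntervalIntegrable (fun s => ‖Vdx (δ s)‖ ^ 2) volume 0 t :=
      (cd.norm.pow 2).intervalIntegrable _ _
    have i2 : IntervalIntegrable (fun s => 3 * ‖Vfn (δ s)‖ ^ 2) volume 0 t :=
      (continuous_const.mul (cf.norm.pow 2)).intervalIntegrable _ _
    have i3 : IntervalIntegrable (fun _ : ℝ => η ^ 2) volume 0 t :=
      continuous_const.intervalIntegrable _ _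
    have hle : ∫ s in (0 : ℝ)..t, (-(4 - 2) * ‖Vdx (δ s)‖ ^ 2 +
        (4 ^ 2 / 8 - 2 * c) * ‖Vfn (δ s)‖ ^ 2 + 2 * inner ℝ (k s - k' s) (Vfn (δ s))) ≤
        ∫ s in (0 : ℝ)..t, (3 * ‖Vfn (δ s)‖ ^ 2 - ‖Vdx (δ s)‖ ^ 2 + η ^ 2 +
          forcingGap c (v s) (v' s)) := by
      have ck := hcl.continuous_forcing
      refine intervalIntegral.integral_mono_on ht.1 (Continuous.intervalIntegrable (by fun_prop) _ _)
        (((i2.sub i1).add i3).add (cgT t ht)) fun s hs => ?_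
      have hs' : s ∈ Icc 0 T := ⟨hs.1, hs.2.trans ht.2⟩
      have e1 := two_inner_G0_sub_le hl hc (v s) (v' s) (δ s)
      have e2 := (real_inner_le_norm ((k s - G0 c (v s)) - (k' s - G0 c (v' s)))
        (Vfn (δ s))).trans (mul_le_mul_of_nonneg_right (hk s hs') (norm_nonneg _))
      have e3 : inner ℝ (k s - k' s) (Vfn (δ s)) =
          inner ℝ ((k s - G0 c (v s)) - (k' s - G0 c (v' s))) (Vfn (δ s)) +
            inner ℝ (G0 c (v s) - G0 c (v' s)) (Vfn (δ s)) := by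
        rw [← inner_add_left]
        congr 1
        abel
      rw [e3]
      nlinarith [sq_nonneg (η - ‖Vfn (δ s)‖), mul_nonneg hc (sq_nonneg ‖Vfn (δ s)‖)]
    rw [intervalIntegral.integral_add ((i2.sub i1).add i3) (cgT t ht),
      intervalIntegral.integral_add (i2.sub i1) i3, intervalIntegral.integral_sub i2 i1,
      intervalIntegral.integral_const] at hle
    have hmono : ∫ s in (0 : ℝ)..t, forcingGap c (v s) (v' s) ≤
        ∫ s in (0 : ℝ)..T, forcingGap c (v s) (v' s) :=
      intervalIntegral.integral_mono_interval le_rfl ht.1 ht.2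
        (Eventually.of_forall fun s => forcingGap_nonneg hc _ _) (cgT T ⟨hT, le_rfl⟩)
    have h00 : ‖Vfn (δ 0)‖ ^ 2 ≤ η ^ 2 := by
      gcongr
      exact h0
    have htT : t * η ^ 2 ≤ T * η ^ 2 := by
      gcongr
      exact ht.2
    simp only [sub_zero, smul_eq_mul] at hle
    simp only [hδ] at he hle h00 htT ⊢
    linarith
  have hsup : ∀ t ∈ Icc 0 T, ‖Vfn (δ t)‖ ^ 2 ≤ R * Real.exp (3 * T) := by
    intro t ht
    have hg := gronwall_integral (T := T) (K := R) (φ := fun t => ‖Vfn (δ t)‖ ^ 2)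
      (f := fun _ => 3) (cf.norm.pow 2).continuousOn continuousOn_const (fun _ _ => by norm_num) hR0
      (fun t ht => by
        have := key t ht
        have hn : 0 ≤ ∫ s in (0 : ℝ)..t, ‖Vdx (δ s)‖ ^ 2 :=
          intervalIntegral.integral_nonneg ht.1 fun s _ => sq_nonneg _
        linarith) ht
    rwa [intervalIntegral.integral_const, sub_zero, smul_eq_mul, mul_comm T 3] at hg
  refine ⟨hsup, ?_⟩
  have i1 : IntervalIntegrable (fun s => ‖Vdx (δ s)‖ ^ 2) volume 0 T :=
    (cd.norm.pow 2).intervalIntegrable _ _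
  have i2 : IntervalIntegrable (fun s => ‖Vfn (δ s)‖ ^ 2) volume 0 T :=
    (cf.norm.pow 2).intervalIntegrable _ _
  have e : ∫ t in (0 : ℝ)..T, ‖z t - z' t‖ ^ 2 =
      (∫ t in (0 : ℝ)..T, ‖Vfn (δ t)‖ ^ 2) + ∫ t in (0 : ℝ)..T, ‖Vdx (δ t)‖ ^ 2 := by
    rw [← intervalIntegral.integral_add i2 i1]
    exact intervalIntegral.integral_congr fun t _ => norm_V_sq _
  have hT' := key T ⟨hT, le_rfl⟩
  have hint : ∫ t in (0 : ℝ)..T, ‖Vfn (δ t)‖ ^ 2 ≤ T * (R * Real.exp (3 * T)) := by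
    have := intervalIntegral.integral_mono_on hT i2
      (continuous_const.intervalIntegrable _ _) hsup
    rwa [intervalIntegral.integral_const, sub_zero, smul_eq_mul] at this
  rw [intervalIntegral.integral_const_mul] at hT'
  rw [e]
  nlinarith [sq_nonneg ‖Vfn (δ T)‖]

/-- The forcings of a sequence that is Cauchy in `E` are close to each other. -/
lemma exists_forcingGap_le (hc : 0 ≤ c) (hT : 0 ≤ T) {v : ℕ → ℝ → V l}
    (hv : ∀ n, Continuous (v n))
    (hE : ∀ ε > 0, ∃ N, ∀ n ≥ N, ∀ m ≥ N,
      ∫ t in (0 : ℝ)..T, L4 (Vfn (v n t) - Vfn (v m t)) ^ 4 ≤ ε) {ε : ℝ} (hε : 0 < ε) :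
    ∃ N, ∀ n ≥ N, ∀ m ≥ N, ∫ t in (0 : ℝ)..T, forcingGap c (v n t) (v m t) ≤ ε := by
  obtain ⟨K, hK0, hK⟩ := exists_norm_le_L4 l
  have h4 : ∀ n, ContinuousInL4 T fun t => Vfn (v n t) := fun n => continuousInL4_Vfn (hv n)
  have hii : ∀ {g : ℝ → ℝ}, ContinuousOn g (Icc 0 T) → IntervalIntegrable g volume 0 T :=
    fun hg => (hg.mono (by rw [uIcc_of_le hT])).intervalIntegrable
  -- the sums `v n + v m` are bounded in `E`
  obtain ⟨N₁, hN₁⟩ := hE 1 one_pos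
  set B : ℝ := ∫ t in (0 : ℝ)..T, L4 (Vfn (v N₁ t)) ^ 4 with hB
  have hB0 : 0 ≤ B := intervalIntegral.integral_nonneg hT fun t _ => pow_nonneg (L4_nonneg _) 4
  have hsum : ∀ n ≥ N₁, ∀ m ≥ N₁,
      ∫ t in (0 : ℝ)..T, L4 (Vfn (v n t) + Vfn (v m t)) ^ 4 ≤ 27 * (2 + 16 * B) := by
    intro n hn m hm
    have hle : ∀ t ∈ Icc 0 T, L4 (Vfn (v n t) + Vfn (v m t)) ^ 4 ≤
        27 * ((L4 (Vfn (v n t) - Vfn (v N₁ t)) ^ 4 + L4 (Vfn (v m t) - Vfn (v N₁ t)) ^ 4) +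
          16 * L4 (Vfn (v N₁ t)) ^ 4) := by
      intro t ht
      have kn := (h4 n).lt_top ht
      have km := (h4 m).lt_top ht
      have kN := (h4 N₁).lt_top ht
      have e : Vfn (v n t) + Vfn (v m t) = (Vfn (v n t) - Vfn (v N₁ t)) +
          ((Vfn (v m t) - Vfn (v N₁ t)) + (Vfn (v N₁ t) + Vfn (v N₁ t))) := by abel
      have a1 := L4_add_le (L4e_sub_lt_top kn kN)
        (L4e_add_lt_top (L4e_sub_lt_top km kN) (L4e_add_lt_top kN kN))
      have a2 := L4_add_le (L4e_sub_lt_top km kN) (L4e_add_lt_top kN kN)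
      have a3 := L4_add_le kN kN
      rw [← e] at a1
      set p := L4 (Vfn (v n t) - Vfn (v N₁ t))
      set q := L4 (Vfn (v m t) - Vfn (v N₁ t))
      set r := L4 (Vfn (v N₁ t))
      have hp : 0 ≤ p := L4_nonneg _
      have hq : 0 ≤ q := L4_nonneg _
      have hr : 0 ≤ r := L4_nonneg _
      have b1 : L4 (Vfn (v n t) + Vfn (v m t)) ≤ p + q + 2 * r := by linarith
      have b2 : (p + q + 2 * r) ^ 2 ≤ 3 * (p ^ 2 + q ^ 2 + (2 * r) ^ 2) := by
        nlinarith [sq_nonneg (p - q), sq_nonneg (p - 2 * r), sq_nonneg (q - 2 * r)]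
      calc L4 (Vfn (v n t) + Vfn (v m t)) ^ 4 ≤ (p + q + 2 * r) ^ 4 :=
            pow_le_pow_left₀ (L4_nonneg _) b1 4
        _ = ((p + q + 2 * r) ^ 2) ^ 2 := by ring
        _ ≤ (3 * (p ^ 2 + q ^ 2 + (2 * r) ^ 2)) ^ 2 := by gcongr
        _ ≤ 27 * ((p ^ 4 + q ^ 4) + 16 * r ^ 4) := by
            nlinarith [sq_nonneg (p ^ 2 - q ^ 2), sq_nonneg (p ^ 2 - (2 * r) ^ 2),
              sq_nonneg (q ^ 2 - (2 * r) ^ 2)]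
    have i1 := ((h4 n).sub (h4 N₁)).intervalIntegrable_pow hT
    have i2 := ((h4 m).sub (h4 N₁)).intervalIntegrable_pow hT
    have i3 := ((h4 N₁).intervalIntegrable_pow hT).const_mul 16
    have h := intervalIntegral.integral_mono_on hT
      (((h4 n).add (h4 m)).intervalIntegrable_pow hT) (((i1.add i2).add i3).const_mul 27) hle
    rw [intervalIntegral.integral_const_mul, intervalIntegral.integral_add (i1.add i2) i3,
      intervalIntegral.integral_add i1 i2, intervalIntegral.integral_const_mul] at h
    have := hN₁ n hn N₁ le_rfl
    have := hN₁ m hm N₁ le_rfl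
    linarith
  set D : ℝ := 27 * (2 + 16 * B) + c * K ^ 2 * T with hD
  have hD0 : 0 ≤ D := by positivity
  set τ : ℝ := ε / (2 * (D + 1)) with hτ
  have hτ0 : 0 < τ := by positivity
  set M : ℝ := 1 + c * K ^ 2 with hM
  have hM0 : 0 < M := by positivity
  obtain ⟨N₂, hN₂⟩ := hE (ε * τ / (2 * M)) (by positivity)
  refine ⟨max N₁ N₂, fun n hn m hm => ?_⟩
  have hle : ∀ t ∈ Icc 0 T, forcingGap c (v n t) (v m t) ≤
      τ * L4 (Vfn (v n t) + Vfn (v m t)) ^ 4 + τ * (c * K ^ 2) +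
        M / τ * L4 (Vfn (v n t) - Vfn (v m t)) ^ 4 := by
    intro t ht
    have b0 := hK _ (L4e_sub_lt_top ((h4 n).lt_top ht) ((h4 m).lt_top ht))
    rw [forcingGap]
    set X := L4 (Vfn (v n t) - Vfn (v m t))
    set Z := L4 (Vfn (v n t) + Vfn (v m t))
    have b1 : ‖Vfn (v n t) - Vfn (v m t)‖ ^ 2 ≤ K ^ 2 * X ^ 2 := by
      rw [← mul_pow]
      gcongr
    have young : ∀ r : ℝ, X ^ 2 * r ≤ τ * r ^ 2 + 1 / τ * X ^ 4 := by
      intro r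
      have h0 : 0 ≤ 1 / τ * ((X ^ 2 - τ * r / 2) ^ 2 + 3 / 4 * (τ * r) ^ 2) := by positivity
      have e : 1 / τ * ((X ^ 2 - τ * r / 2) ^ 2 + 3 / 4 * (τ * r) ^ 2) =
          1 / τ * X ^ 4 - X ^ 2 * r + τ * r ^ 2 := by
        field_simp
        ring
      linarith
    have b2 := young (Z ^ 2)
    have b3 := young 1
    have b4 : c * ‖Vfn (v n t) - Vfn (v m t)‖ ^ 2 ≤ c * K ^ 2 * (τ + 1 / τ * X ^ 4) := by
      calc c * ‖Vfn (v n t) - Vfn (v m t)‖ ^ 2 ≤ c * (K ^ 2 * X ^ 2) := by gcongr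
        _ = c * K ^ 2 * (X ^ 2 * 1) := by ring
        _ ≤ c * K ^ 2 * (τ + 1 / τ * X ^ 4) := by
            gcongr
            linarith
    have e : M / τ * X ^ 4 = 1 / τ * X ^ 4 + c * K ^ 2 * (1 / τ * X ^ 4) := by
      rw [hM]
      ring
    have b5 : 0 ≤ X ^ 2 * Z ^ 2 := by positivity
    rw [e]
    nlinarith
  have i1 := (((h4 n).add (h4 m)).intervalIntegrable_pow hT).const_mul τ
  have i2 : IntervalIntegrable (fun _ : ℝ => τ * (c * K ^ 2)) volume 0 T :=
    continuous_const.intervalIntegrable _ _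
  have i3 := (((h4 n).sub (h4 m)).intervalIntegrable_pow hT).const_mul (M / τ)
  have h := intervalIntegral.integral_mono_on hT
    (hii (continuousOn_forcingGap (hv n) (hv m))) ((i1.add i2).add i3) hle
  rw [intervalIntegral.integral_add (i1.add i2) i3, intervalIntegral.integral_add i1 i2] at h
  simp only [intervalIntegral.integral_const_mul, intervalIntegral.integral_const, sub_zero,
    smul_eq_mul] at h
  have h1 := hsum n ((le_max_left _ _).trans hn) m ((le_max_left _ _).trans hm)
  have h2 := hN₂ n ((le_max_right _ _).trans hn) m ((le_max_right _ _).trans hm)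
  have h3 : τ * D ≤ ε / 2 := by
    rw [hτ, div_mul_eq_mul_div, div_le_div_iff₀ (by positivity) (by norm_num)]
    nlinarith
  have h4' : M / τ * (ε * τ / (2 * M)) = ε / 2 := by
    field_simp
  have h5 := mul_le_mul_of_nonneg_left h2 (by positivity : 0 ≤ M / τ)
  have h6 := mul_le_mul_of_nonneg_left h1 hτ0.le
  rw [hD] at h3
  linarith

end Comparison

/-! ### The limit of the approximations -/

section Limit

variable {l c T : ℝ} {bc : BC} {S : ℝ → H l →L[ℝ] H l}

/-- Completeness of `L²`, in terms of functions. -/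
lemma exists_L2_limit {E : Type*} [NormedAddCommGroup E] [InnerProductSpace ℝ E] [CompleteSpace E]
    {μ : Measure ℝ} {z : ℕ → ℝ → E} (hz : ∀ n, MemLp (z n) 2 μ)
    (hc : ∀ ε > 0, ∃ N, ∀ n ≥ N, ∀ m ≥ N, ∫ t, ‖z n t - z m t‖ ^ 2 ∂μ ≤ ε) :
    ∃ z' : ℝ → E, MemLp z' 2 μ ∧
      Tendsto (fun n => ∫ t, ‖z n t - z' t‖ ^ 2 ∂μ) atTop (𝓝 0) ∧
      Tendsto (fun n => ∫ t, ‖z n t‖ ^ 2 ∂μ) atTop (𝓝 (∫ t, ‖z' t‖ ^ 2 ∂μ)) ∧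
      ∃ ns : ℕ → ℕ, StrictMono ns ∧
        ∀ᵐ t ∂μ, Tendsto (fun n => z (ns n) t) atTop (𝓝 (z' t)) := by
  have hsq : ∀ f : Lp E 2 μ, ‖f‖ ^ 2 = ∫ t, ‖f t‖ ^ 2 ∂μ := fun f => by
    rw [← real_inner_self_eq_norm_sq, L2.inner_def]
    simp only [real_inner_self_eq_norm_sq]
  set ζ : ℕ → Lp E 2 μ := fun n => (hz n).toLp with hζ
  have hζae : ∀ n, ζ n =ᵐ[μ] z n := fun n => (hz n).coeFn_toLp
  have hζc : CauchySeq ζ := by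
    rw [Metric.cauchySeq_iff]
    intro ε hε
    obtain ⟨N, hN⟩ := hc ((ε / 2) ^ 2) (by positivity)
    refine ⟨N, fun n hn m hm => ?_⟩
    have e : ‖ζ n - ζ m‖ ^ 2 = ∫ t, ‖z n t - z m t‖ ^ 2 ∂μ := by
      rw [hsq]
      refine integral_congr_ae ?_
      filter_upwards [hζae n, hζae m, Lp.coeFn_sub (ζ n) (ζ m)] with t e1 e2 e3
      rw [e3, Pi.sub_apply, e1, e2]
    have := abs_le_of_sq_le_sq (e.trans_le (hN n hn m hm)) (by positivity)
    rw [dist_eq_norm]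
    linarith [le_abs_self ‖ζ n - ζ m‖]
  obtain ⟨ζ', hζ'⟩ := cauchySeq_tendsto_of_complete hζc
  refine ⟨ζ', Lp.memLp ζ', ?_, ?_, ?_⟩
  · have h1 := (tendsto_iff_norm_sub_tendsto_zero.1 hζ').pow 2
    rw [zero_pow two_ne_zero] at h1
    refine h1.congr fun n => ?_
    rw [hsq]
    refine integral_congr_ae ?_
    filter_upwards [hζae n, Lp.coeFn_sub (ζ n) ζ'] with t e1 e3
    rw [e3, Pi.sub_apply, e1]
  · have h1 := hζ'.norm.pow 2
    rw [hsq] at h1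
    refine h1.congr fun n => ?_
    rw [hsq]
    refine integral_congr_ae ?_
    filter_upwards [hζae n] with t e1
    rw [e1]
  · obtain ⟨ns, hns, hae⟩ := (tendstoInMeasure_of_tendsto_Lp hζ').exists_seq_tendsto_ae
    refine ⟨ns, hns, ?_⟩
    filter_upwards [hae, ae_all_iff.2 hζae] with t ht hall
    exact ht.congr fun n => hall (ns n)

lemma memLp_path {E : Type*} [NormedAddCommGroup E] {z : ℝ → E} (hz : Continuous z) :
    MemLp z 2 (volume.restrict (Ioo 0 T)) := by
  obtain ⟨B, hB⟩ := (isCompact_Icc (a := 0) (b := T)).exists_bound_of_continuousOn hz.continuousOn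
  refine MemLp.of_bound hz.aestronglyMeasurable B ?_
  filter_upwards [ae_restrict_mem measurableSet_Ioo] with t ht
  exact hB t (Ioo_subset_Icc_self ht)

lemma integral_Ioo_eq (hT : 0 ≤ T) (g : ℝ → ℝ) :
    ∫ t in Ioo 0 T, g t = ∫ t in (0 : ℝ)..T, g t := by
  rw [intervalIntegral.integral_of_le hT, integral_Ioc_eq_integral_Ioo]

/-- A sequence of approximations of the mild solution `y`, and its limit: uniformly in `H` to a
continuous representative `Y` of `y`, and in `L²(0, T; V)` to a representative `V'` with values in
`V`. -/
lemma exists_limit (hl : 0 < l) (hc : 0 ≤ c) (hT : 0 ≤ T) (hS : IsSemigroup (IsA l c bc) S)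
    {v : ℕ → ℝ → V l} (hv : ∀ n, Continuous (v n))
    (hE : ∀ ε > 0, ∃ N, ∀ n ≥ N, ∀ m ≥ N,
      ∫ t in (0 : ℝ)..T, L4 (Vfn (v n t) - Vfn (v m t)) ^ 4 ≤ ε) (u₀ : H l) {y : ℝ → H l}
    (hy : AEStronglyMeasurable y (volume.restrict (Ioo 0 T)))
    (hlim : Tendsto (fun n => distE T (mild S u₀ fun t => G0 c (v n t)) y) atTop (𝓝 0)) :
    ∃ (z : ℕ → ℝ → V l) (a k : ℕ → ℝ → H l) (Y : ℝ → H l) (V' : ℝ → V l),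
      (∀ n, IsClassical (IsA l c bc) (z n) (a n) (k n)) ∧
      (∀ n, ∀ t ∈ Icc 0 T, ‖k n t - G0 c (v n t)‖ ≤ 1 / ((n : ℝ) + 1)) ∧
      (∀ n, ‖Vfn (z n 0) - u₀‖ ≤ 1 / ((n : ℝ) + 1)) ∧
      ContinuousOn Y (Icc 0 T) ∧
      TendstoUniformlyOn (fun n t => Vfn (z n t)) Y atTop (Icc 0 T) ∧
      (∀ᵐ t ∂(volume.restrict (Ioo 0 T)), Y t = y t) ∧
      MemLp V' 2 (volume.restrict (Ioo 0 T)) ∧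
      (∀ᵐ t ∂(volume.restrict (Ioo 0 T)), Vfn (V' t) = Y t) ∧
      Tendsto (fun n => ∫ t in Ioo 0 T, ‖z n t - V' t‖ ^ 2) atTop (𝓝 0) ∧
      Tendsto (fun n => ∫ t in Ioo 0 T, ‖z n t‖ ^ 2) atTop (𝓝 (∫ t in Ioo 0 T, ‖V' t‖ ^ 2)) := by
  have hη : ∀ n : ℕ, 0 < 1 / ((n : ℝ) + 1) := fun n => by positivity
  have hη0 : Tendsto (fun n : ℕ => 1 / ((n : ℝ) + 1)) atTop (𝓝 0) :=
    tendsto_one_div_add_atTop_nhds_zero_nat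
  choose z a k hcl hclose using fun n =>
    exists_classical hl hc hS u₀ ((continuous_G0 c).comp (hv n)) T (hη n)
  have h0T : (0 : ℝ) ∈ Icc 0 T := ⟨le_rfl, hT⟩
  have hz0 : ∀ n, ‖Vfn (z n 0) - u₀‖ ≤ 1 / ((n : ℝ) + 1) := fun n => by
    have := (hclose n 0 h0T).1
    rwa [mild_zero hS] at this
  have hcauchy : ∀ ε > 0, ∃ N, ∀ n ≥ N, ∀ m ≥ N,
      (∀ t ∈ Icc 0 T, ‖Vfn (z n t) - Vfn (z m t)‖ ^ 2 ≤ ε) ∧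
        ∫ t in (0 : ℝ)..T, ‖z n t - z m t‖ ^ 2 ≤ ε := by
    intro ε hε
    set Q : ℝ := (1 + 4 * T) * Real.exp (3 * T) with hQ
    have hQ0 : 0 < Q := by positivity
    have h1exp : 1 ≤ Real.exp (3 * T) := Real.one_le_exp (by positivity)
    obtain ⟨N₁, hN₁⟩ := exists_forcingGap_le hc hT hv hE (ε := ε / (2 * Q)) (by positivity)
    have hsq : Tendsto (fun n : ℕ => (1 + T) * (2 * (1 / ((n : ℝ) + 1))) ^ 2) atTop (𝓝 0) := by
      simpa using ((hη0.const_mul 2).pow 2).const_mul (1 + T)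
    obtain ⟨N₂, hN₂⟩ := eventually_atTop.1
      (hsq.eventually (ge_mem_nhds (show 0 < ε / (2 * Q) by positivity)))
    refine ⟨max N₁ N₂, fun n hn m hm => ?_⟩
    have hle : ∀ j ≥ max N₁ N₂, 1 / ((j : ℝ) + 1) ≤ 1 / ((N₂ : ℝ) + 1) := fun j hj => by
      gcongr
      exact (le_max_right _ _).trans hj
    have hnm := hN₁ n ((le_max_left _ _).trans hn) m ((le_max_left _ _).trans hm)
    obtain ⟨r1, r2⟩ := (hcl n).norm_sub_le hl hc hT hS (hcl m) (hv n) (hv m)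
      (η := 2 * (1 / ((N₂ : ℝ) + 1))) (R := ε / Q)
      (fun t ht => (norm_sub_le _ _).trans (by
        have a1 := (hclose n t ht).2
        have a2 := (hclose m t ht).2
        simp only [Function.comp_apply] at a1 a2
        linarith [hle n hn, hle m hm]))
      (by
        have e : Vfn (z n 0) - Vfn (z m 0) = (Vfn (z n 0) - u₀) - (Vfn (z m 0) - u₀) := by abel
        rw [e]
        refine (norm_sub_le _ _).trans ?_
        linarith [hz0 n, hz0 m, hle n hn, hle m hm])
      (by
        have a1 := hN₂ N₂ le_rfl
        have a2 : ε / Q = ε / (2 * Q) + ε / (2 * Q) := by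
          field_simp
          norm_num
        rw [a2]
        exact add_le_add a1 hnm)
    have hεQ : 0 ≤ ε / Q := by positivity
    constructor
    · intro t ht
      refine (r1 t ht).trans ?_
      calc ε / Q * Real.exp (3 * T) ≤ ε / Q * Q := by
            gcongr
            rw [hQ]
            exact le_mul_of_one_le_left (by positivity) (by linarith)
        _ = ε := by field_simp
    · refine r2.trans ?_
      calc ε / Q * (1 + 4 * T * Real.exp (3 * T)) ≤ ε / Q * Q := by
            gcongr
            rw [hQ]
            linarith
        _ = ε := by field_simp
  -- the limit in `C([0, T]; H)`
  have hunif : UniformCauchySeqOn (fun n t => Vfn (z n t)) atTop (Icc 0 T) := by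
    rw [Metric.uniformCauchySeqOn_iff]
    intro ε hε
    obtain ⟨N, hN⟩ := hcauchy ((ε / 2) ^ 2) (by positivity)
    refine ⟨N, fun n hn m hm t ht => ?_⟩
    rw [dist_eq_norm]
    have := abs_le_of_sq_le_sq ((hN n hn m hm).1 t ht) (by positivity)
    linarith [le_abs_self ‖Vfn (z n t) - Vfn (z m t)‖]
  set Y : ℝ → H l := fun t => limUnder atTop fun n => Vfn (z n t) with hY
  have hYt : ∀ t ∈ Icc 0 T, Tendsto (fun n => Vfn (z n t)) atTop (𝓝 (Y t)) := fun t ht =>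
    (hunif.cauchySeq ht).tendsto_limUnder
  have hYu := hunif.tendstoUniformlyOn_of_tendsto hYt
  have hYc : ContinuousOn Y (Icc 0 T) := hYu.continuousOn
    (Frequently.of_forall fun n => (continuous_Vfn.comp (hcl n).continuous).continuousOn)
  -- the limit in `L²(0, T; V)`
  have hmem : ∀ n, MemLp (z n) 2 (volume.restrict (Ioo 0 T)) := fun n =>
    memLp_path (hcl n).continuous
  obtain ⟨V', hV'm, hV'1, hV'2, ns, hns, hae⟩ := exists_L2_limit hmem fun ε hε => by
    obtain ⟨N, hN⟩ := hcauchy ε hε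
    refine ⟨N, fun n hn m hm => ?_⟩
    rw [integral_Ioo_eq hT]
    exact (hN n hn m hm).2
  refine ⟨z, a, k, Y, V', hcl, fun n t ht => (hclose n t ht).2, hz0, hYc, hYu, ?_, hV'm,
    ?_, hV'1, hV'2⟩
  · obtain ⟨K, hK⟩ := exists_enorm_le_L4e l
    have hmc : ∀ n, Continuous (mild S u₀ fun t => G0 c (v n t)) := fun n =>
      hS.continuous_mild u₀ ((continuous_G0 c).comp (hv n))
    have hp : Tendsto (fun n => eLpNorm ((mild S u₀ fun t => G0 c (v n t)) - y) 4
        (volume.restrict (Ioo 0 T))) atTop (𝓝 0) := by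
      refine tendsto_zero_of_pow_four ?_
      have hK4 : Tendsto (fun n => (K : ℝ≥0∞) ^ 4 *
          distE T (mild S u₀ fun t => G0 c (v n t)) y) atTop (𝓝 0) := by
        simpa using ENNReal.Tendsto.const_mul hlim
          (Or.inr (ENNReal.pow_ne_top ENNReal.coe_ne_top))
      refine tendsto_of_tendsto_of_tendsto_of_le_of_le tendsto_const_nhds hK4 (fun _ => zero_le)
        fun n => ?_
      have e := eLpNorm_nnreal_pow_eq_lintegral
        (f := (mild S u₀ fun t => G0 c (v n t)) - y) (p := 4)
        (μ := volume.restrict (Ioo 0 T)) (by norm_num)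
      rw [show (((4 : ℝ≥0) : ℝ)) = ((4 : ℕ) : ℝ) by norm_num] at e
      simp only [ENNReal.rpow_natCast] at e
      refine (show _ = _ from e).trans_le ?_
      rw [distE, ← lintegral_const_mul' _ _ (ENNReal.pow_ne_top ENNReal.coe_ne_top)]
      refine lintegral_mono fun t => ?_
      rw [← mul_pow]
      exact pow_le_pow_left' (hK _) 4
    obtain ⟨ns, hns, hae⟩ := (tendstoInMeasure_of_tendsto_eLpNorm (by norm_num)
      (fun n => (hmc n).aestronglyMeasurable) hy hp).exists_seq_tendsto_ae
    filter_upwards [hae, ae_restrict_mem measurableSet_Ioo] with t ht htI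
    have htI' := Ioo_subset_Icc_self htI
    refine tendsto_nhds_unique ((hYt t htI').comp hns.tendsto_atTop) ?_
    have hd : Tendsto (fun n => Vfn (z n t) - mild S u₀ (fun t => G0 c (v n t)) t) atTop
        (𝓝 0) := squeeze_zero_norm (fun n => (hclose n t htI').1) hη0
    have := (hd.comp hns.tendsto_atTop).add ht
    rw [zero_add] at this
    refine this.congr fun n => ?_
    simp only [Function.comp_apply, sub_add_cancel]
  · filter_upwards [hae, ae_restrict_mem measurableSet_Ioo] with t ht htI
    exact tendsto_nhds_unique ((continuous_Vfn.tendsto _).comp ht)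
      ((hYt t (Ioo_subset_Icc_self htI)).comp hns.tendsto_atTop)

end Limit

/-! ### The error of the approximations -/

section Error

variable {l c T : ℝ}

lemma defect_nonneg (hc : 0 ≤ c) (z v : V l) (w k : H l) : 0 ≤ defect c z v w k :=
  add_nonneg (add_nonneg (mul_nonneg (mul_nonneg (L4_nonneg _) (L4_nonneg _)) (norm_nonneg _))
    (by positivity)) (by positivity)

lemma continuousOn_defect {z v : ℝ → V l} {w k : ℝ → H l} (hz : Continuous z) (hv : Continuous v)
    (hw : ContinuousInL4 T w) (hk : Continuous k) :
    ContinuousOn (fun t => defect c (z t) (v t) (w t) (k t)) (Icc 0 T) := by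
  have h1 : ContinuousInL4 T fun t => Vfn (v t) := continuousInL4_Vfn hv
  have h2 : ContinuousInL4 T fun t => Vfn (z t) := continuousInL4_Vfn hz
  have he := (h1.sub h2).sub hw
  have hs := (h1.add h2).add hw
  have cz : Continuous fun t => ‖Vfn (z t)‖ := (continuous_Vfn.comp hz).norm
  have cd : Continuous fun t => ‖Vdx (z t)‖ := (continuous_Vdx.comp hz).norm
  have ck : Continuous fun t => ‖k t - G0 c (v t)‖ := (hk.sub ((continuous_G0 c).comp hv)).norm
  exact (((he.continuousOn_L4.mul hs.continuousOn_L4).mul cd.continuousOn).add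
    (continuousOn_const.mul (he.continuousOn.norm.mul cz.continuousOn))).add
    (continuousOn_const.mul (ck.mul cz).continuousOn)

/-- Young's inequality for the terms of the defect. -/
lemma young_defect {τ D : ℝ} (hτ : 0 < τ) (hD : 0 ≤ D) (X Z q p : ℝ) :
    X * Z * q + 2 * D * (X * p) ≤
      τ * (q ^ 2 + Z ^ 4 + D * (p ^ 2 + 1)) + (1 + 16 * D) / τ ^ 3 * X ^ 4 := by
  set x := X / τ with hx
  have hX : X = τ * x := by rw [hx]; field_simp
  have e : (1 + 16 * D) / τ ^ 3 * X ^ 4 = τ * ((1 + 16 * D) * x ^ 4) := by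
    rw [hX]
    field_simp
  have h1 : x * Z * q ≤ q ^ 2 + Z ^ 4 + x ^ 4 := by
    nlinarith [sq_nonneg (x * Z - q), sq_nonneg (x ^ 2 - Z ^ 2), sq_nonneg (x * Z + q),
      sq_nonneg (x ^ 2), sq_nonneg (Z ^ 2)]
  have h2 : 2 * (x * p) ≤ p ^ 2 + 1 + 16 * x ^ 4 := by
    nlinarith [sq_nonneg (x - p), sq_nonneg (x ^ 2 - 1), sq_nonneg (x ^ 2)]
  have h3 := mul_le_mul_of_nonneg_left h2 hD
  rw [e, hX]
  nlinarith [mul_le_mul_of_nonneg_left (add_le_add h1 h3) hτ.le]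

lemma defect_le (hc : 0 ≤ c) {K : ℝ} (hK0 : 0 ≤ K)
    (hK : ∀ u : H l, L4e u < ∞ → ‖u‖ ≤ K * L4 u) {τ B η : ℝ} (hτ : 0 < τ)
    (z v : V l) {w k : H l} (hw : L4e w < ∞) (hB : ‖Vfn z‖ ^ 2 ≤ B)
    (hk : ‖k - G0 c v‖ ≤ η) :
    defect c z v w k ≤ τ * ((1 + 864 * B) * ‖z‖ ^ 2 + 432 * L4 w ^ 4 + c * K * (B + 1)) +
      (27 * τ + (1 + 16 * (c * K)) / τ ^ 3) * L4 (Vfn v - Vfn z - w) ^ 4 + η * (1 + B) := by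
  have hv4 := L4e_Vfn_lt_top v
  have hz4 := L4e_Vfn_lt_top z
  have he4 := L4e_sub_lt_top (L4e_sub_lt_top hv4 hz4) hw
  have hcK : 0 ≤ c * K := mul_nonneg hc hK0
  have hη : 0 ≤ η := (norm_nonneg _).trans hk
  have e : Vfn v + Vfn z + w = (Vfn v - Vfn z - w) + ((Vfn z + Vfn z) + (w + w)) := by abel
  have a1 := L4_add_le he4 (L4e_add_lt_top (L4e_add_lt_top hz4 hz4) (L4e_add_lt_top hw hw))
  have a2 := L4_add_le (L4e_add_lt_top hz4 hz4) (L4e_add_lt_top hw hw)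
  have a3 := L4_add_le hz4 hz4
  have a4 := L4_add_le hw hw
  have a5 := hK _ he4
  have a6 := L4_Vfn_pow_le z
  have a7 := norm_Vfn_le z
  have a8 := norm_Vdx_le z
  rw [← e] at a1
  rw [defect]
  have hX : 0 ≤ L4 (Vfn v - Vfn z - w) := L4_nonneg _
  have hZ : 0 ≤ L4 (Vfn v + Vfn z + w) := L4_nonneg _
  have ha : 0 ≤ L4 (Vfn z) := L4_nonneg _
  have hb : 0 ≤ L4 w := L4_nonneg _
  have hp := norm_nonneg (Vfn z)
  have hq := norm_nonneg (Vdx z)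
  have hr := norm_nonneg z
  have hke := norm_nonneg (k - G0 c v)
  have hee := norm_nonneg (Vfn v - Vfn z - w)
  generalize L4 (Vfn v - Vfn z - w) = X at *
  generalize L4 (Vfn v + Vfn z + w) = Z at *
  generalize L4 (Vfn z) = a at *
  generalize L4 w = b at *
  generalize ‖Vfn z‖ = p at *
  generalize ‖Vdx z‖ = q at *
  generalize ‖z‖ = r at *
  generalize ‖k - G0 c v‖ = κ at *
  generalize ‖Vfn v - Vfn z - w‖ = ξ at *
  have hB0 : 0 ≤ B := (sq_nonneg p).trans hB
  have b1 : Z ≤ X + 2 * a + 2 * b := by linarith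
  have b2 : (X + 2 * a + 2 * b) ^ 2 ≤ 3 * (X ^ 2 + (2 * a) ^ 2 + (2 * b) ^ 2) := by
    nlinarith [sq_nonneg (X - 2 * a), sq_nonneg (X - 2 * b), sq_nonneg (2 * a - 2 * b)]
  have b3 : Z ^ 4 ≤ 27 * (X ^ 4 + 16 * a ^ 4 + 16 * b ^ 4) :=
    calc Z ^ 4 ≤ (X + 2 * a + 2 * b) ^ 4 := pow_le_pow_left₀ hZ b1 4
      _ = ((X + 2 * a + 2 * b) ^ 2) ^ 2 := by ring
      _ ≤ (3 * (X ^ 2 + (2 * a) ^ 2 + (2 * b) ^ 2)) ^ 2 := by gcongr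
      _ ≤ 27 * (X ^ 4 + 16 * a ^ 4 + 16 * b ^ 4) := by
          nlinarith [sq_nonneg (X ^ 2 - (2 * a) ^ 2), sq_nonneg (X ^ 2 - (2 * b) ^ 2),
            sq_nonneg ((2 * a) ^ 2 - (2 * b) ^ 2)]
  have b4 : a ^ 4 ≤ 2 * B * r ^ 2 :=
    calc a ^ 4 ≤ 2 * p ^ 3 * q := a6
      _ = 2 * p ^ 2 * (p * q) := by ring
      _ ≤ 2 * B * (r * r) := by gcongr
      _ = _ := by ring
  have b5 := young_defect hτ hcK X Z q p
  have b6 : 2 * c * (ξ * p) ≤ 2 * (c * K) * (X * p) := by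
    calc 2 * c * (ξ * p) ≤ 2 * c * (K * X * p) := by gcongr
      _ = _ := by ring
  have b7 : 2 * (κ * p) ≤ η * (1 + B) :=
    calc 2 * (κ * p) ≤ 2 * (η * p) := by gcongr
      _ = η * (2 * p) := by ring
      _ ≤ η * (1 + B) := by
          gcongr
          nlinarith [sq_nonneg (p - 1)]
  have b8 : q ^ 2 ≤ r ^ 2 := by gcongr
  have b9 : q ^ 2 + Z ^ 4 + c * K * (p ^ 2 + 1) ≤
      (1 + 864 * B) * r ^ 2 + 432 * b ^ 4 + c * K * (B + 1) + 27 * X ^ 4 := by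
    have : c * K * (p ^ 2 + 1) ≤ c * K * (B + 1) := by gcongr
    linarith
  have b10 := mul_le_mul_of_nonneg_left b9 hτ.le
  linarith

/-- The defect of approximations whose error tends to zero in `E`, tends to zero in `L¹(0, T)`. -/
lemma tendsto_integral_defect (hc : 0 ≤ c) (hT : 0 ≤ T) {z v : ℕ → ℝ → V l} {w : ℝ → H l}
    {k : ℕ → ℝ → H l} (hz : ∀ n, Continuous (z n)) (hv : ∀ n, Continuous (v n))
    (hw : ContinuousInL4 T w) (hk : ∀ n, Continuous (k n))
    (hkG : ∀ n, ∀ t ∈ Icc 0 T, ‖k n t - G0 c (v n t)‖ ≤ 1 / ((n : ℝ) + 1)) {B B' : ℝ}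
    (hB : ∀ᶠ n in atTop, ∀ t ∈ Icc 0 T, ‖Vfn (z n t)‖ ^ 2 ≤ B)
    (hB' : ∀ᶠ n in atTop, ∫ t in (0 : ℝ)..T, ‖z n t‖ ^ 2 ≤ B')
    (he : Tendsto (fun n => ∫ t in (0 : ℝ)..T, L4 (Vfn (v n t) - Vfn (z n t) - w t) ^ 4) atTop
      (𝓝 0)) :
    Tendsto (fun n => ∫ t in (0 : ℝ)..T, defect c (z n t) (v n t) (w t) (k n t)) atTop (𝓝 0) := by
  obtain ⟨K, hK0, hK⟩ := exists_norm_le_L4 l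
  have hB0 : 0 ≤ B := by
    obtain ⟨n, hn⟩ := hB.exists
    exact (sq_nonneg _).trans (hn 0 ⟨le_rfl, hT⟩)
  have hB0' : 0 ≤ B' := by
    obtain ⟨n, hn⟩ := hB'.exists
    exact (intervalIntegral.integral_nonneg hT fun t _ => sq_nonneg _).trans hn
  have h4 : ∀ n, ContinuousInL4 T fun t => Vfn (v n t) - Vfn (z n t) - w t := fun n =>
    ((continuousInL4_Vfn (hv n)).sub (continuousInL4_Vfn (hz n))).sub hw
  set W : ℝ := ∫ t in (0 : ℝ)..T, L4 (w t) ^ 4 with hW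
  have hW0 : 0 ≤ W := intervalIntegral.integral_nonneg hT fun t _ => pow_nonneg (L4_nonneg _) 4
  set Γ : ℝ := (1 + 864 * B) * B' + 432 * W + T * (c * K * (B + 1)) with hΓ
  have hΓ0 : 0 ≤ Γ := by positivity
  have hmain : ∀ τ > 0, ∀ᶠ n in atTop,
      ∫ t in (0 : ℝ)..T, defect c (z n t) (v n t) (w t) (k n t) ≤ τ * Γ +
        ((27 * τ + (1 + 16 * (c * K)) / τ ^ 3) *
          (∫ t in (0 : ℝ)..T, L4 (Vfn (v n t) - Vfn (z n t) - w t) ^ 4) +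
        1 / ((n : ℝ) + 1) * (T * (1 + B))) := by
    intro τ hτ
    filter_upwards [hB, hB'] with n h1 h2
    have i1 : IntervalIntegrable (fun t => (1 + 864 * B) * ‖z n t‖ ^ 2) volume 0 T :=
      (continuous_const.mul ((hz n).norm.pow 2)).intervalIntegrable _ _
    have i2 := (hw.intervalIntegrable_pow hT).const_mul 432
    have i3 : IntervalIntegrable (fun _ : ℝ => c * K * (B + 1)) volume 0 T :=
      continuous_const.intervalIntegrable _ _
    have i4 := ((h4 n).intervalIntegrable_pow hT).const_mul (27 * τ + (1 + 16 * (c * K)) / τ ^ 3)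
    have i5 : IntervalIntegrable (fun _ : ℝ => 1 / ((n : ℝ) + 1) * (1 + B)) volume 0 T :=
      continuous_const.intervalIntegrable _ _
    have i6 := ((i1.add i2).add i3).const_mul τ
    have h := intervalIntegral.integral_mono_on hT
      (((continuousOn_defect (hz n) (hv n) hw (hk n)).mono
        (by rw [uIcc_of_le hT])).intervalIntegrable) ((i6.add i4).add i5) fun t ht =>
      defect_le hc hK0 hK hτ (z n t) (v n t) (hw.lt_top ht) (h1 t ht) (hkG n t ht)
    rw [intervalIntegral.integral_add (i6.add i4) i5, intervalIntegral.integral_add i6 i4,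
      intervalIntegral.integral_const_mul, intervalIntegral.integral_add (i1.add i2) i3,
      intervalIntegral.integral_add i1 i2] at h
    simp only [intervalIntegral.integral_const_mul, intervalIntegral.integral_const, sub_zero,
      smul_eq_mul] at h
    have h3 : (1 + 864 * B) * (∫ t in (0 : ℝ)..T, ‖z n t‖ ^ 2) ≤ (1 + 864 * B) * B' := by gcongr
    have h5 := mul_le_mul_of_nonneg_left h3 hτ.le
    rw [hΓ]
    linarith
  rw [Metric.tendsto_atTop']
  intro ε hε
  have hτ : 0 < ε / (2 * (Γ + 1)) := by positivity
  have hlim := (he.const_mul (27 * (ε / (2 * (Γ + 1))) +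
    (1 + 16 * (c * K)) / (ε / (2 * (Γ + 1))) ^ 3)).add
    ((tendsto_one_div_add_atTop_nhds_zero_nat (𝕜 := ℝ)).mul_const (T * (1 + B)))
  rw [mul_zero, zero_mul, add_zero] at hlim
  have hev := (hmain _ hτ).and (hlim.eventually (gt_mem_nhds (half_pos hε)))
  obtain ⟨N, hN⟩ := eventually_atTop.1 hev
  refine ⟨N, fun n hn => ?_⟩
  obtain ⟨h1, h2⟩ := hN n hn.le
  rw [Real.dist_eq, sub_zero, abs_of_nonneg
    (intervalIntegral.integral_nonneg hT fun t _ => defect_nonneg hc _ _ _ _)]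
  have h3 : ε / (2 * (Γ + 1)) * Γ ≤ ε / 2 := by
    rw [div_mul_eq_mul_div, div_le_div_iff₀ (by positivity) (by norm_num)]
    nlinarith
  linarith

/-- The approximations are close to each other in `E`. -/
lemma exists_integral_L4_sub_le (hT : 0 ≤ T) {v : ℕ → ℝ → V l} (hv : ∀ n, Continuous (v n))
    {u : ℝ → H l} (hu : AEStronglyMeasurable u (volume.restrict (Ioo 0 T)))
    (hlim : Tendsto (fun n => distE T (fun t => Vfn (v n t)) u) atTop (𝓝 0)) {ε : ℝ}
    (hε : 0 < ε) : ∃ N, ∀ n ≥ N, ∀ m ≥ N,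
      ∫ t in (0 : ℝ)..T, L4 (Vfn (v n t) - Vfn (v m t)) ^ 4 ≤ ε := by
  have hpos : (0 : ℝ≥0∞) < ENNReal.ofReal (ε / 32) := ENNReal.ofReal_pos.2 (by positivity)
  obtain ⟨N, hN⟩ := eventually_atTop.1 (hlim.eventually (ge_mem_nhds hpos))
  refine ⟨N, fun n hn m hm => ?_⟩
  have h1 := lintegral_L4e_add_le (T := T) (u := fun t => Vfn (v n t) - u t)
    (v := fun t => u t - Vfn (v m t))
    ((continuous_Vfn.comp (hv n)).aestronglyMeasurable.sub hu)
  simp only [sub_add_sub_cancel] at h1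
  have h2 := hN n hn
  have h3 := hN m hm
  simp only [distE] at h2 h3
  simp only [L4e_sub_comm _ (u _)] at h3
  rw [lintegral_L4e_eq hT ((continuousInL4_Vfn (hv n)).sub (continuousInL4_Vfn (hv m)))] at h1
  have h4 : ENNReal.ofReal (∫ t in (0 : ℝ)..T, L4 (Vfn (v n t) - Vfn (v m t)) ^ 4) ≤
      ENNReal.ofReal ε := by
    refine h1.trans ?_
    calc _ ≤ 16 * (ENNReal.ofReal (ε / 32) + ENNReal.ofReal (ε / 32)) := by gcongr
      _ = ENNReal.ofReal ε := by
        rw [← ENNReal.ofReal_add (by positivity) (by positivity), show (16 : ℝ≥0∞) =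
          ENNReal.ofReal 16 by norm_num, ← ENNReal.ofReal_mul (by norm_num)]
        congr 1
        ring
  exact (ENNReal.ofReal_le_ofReal_iff hε.le).1 h4

/-- The error of the approximations tends to zero in `E`: convergence uniformly in `H` and in
`L²(0, T; V)` implies convergence in `E`, as `‖v‖₄⁴ ≤ 2 ‖v‖³ ‖v'‖` on `V`. -/
lemma tendsto_integral_L4_error (hT : 0 ≤ T) {z v : ℕ → ℝ → V l} {y w Y : ℝ → H l}
    {V' : ℝ → V l} (hz : ∀ n, Continuous (z n)) (hv : ∀ n, Continuous (v n))
    (hw : ContinuousInL4 T w)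
    (hyw : AEStronglyMeasurable (fun t => y t + w t) (volume.restrict (Ioo 0 T)))
    (hlim : Tendsto (fun n => distE T (fun t => Vfn (v n t)) fun t => y t + w t) atTop (𝓝 0))
    (hY : TendstoUniformlyOn (fun n t => Vfn (z n t)) Y atTop (Icc 0 T))
    (hYy : ∀ᵐ t ∂(volume.restrict (Ioo 0 T)), Y t = y t)
    (hV' : MemLp V' 2 (volume.restrict (Ioo 0 T)))
    (hV'Y : ∀ᵐ t ∂(volume.restrict (Ioo 0 T)), Vfn (V' t) = Y t)
    (hzV : Tendsto (fun n => ∫ t in Ioo 0 T, ‖z n t - V' t‖ ^ 2) atTop (𝓝 0)) :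
    Tendsto (fun n => ∫ t in (0 : ℝ)..T, L4 (Vfn (v n t) - Vfn (z n t) - w t) ^ 4) atTop
      (𝓝 0) := by
  have h4 : ∀ n, ContinuousInL4 T fun t => Vfn (v n t) - Vfn (z n t) - w t := fun n =>
    ((continuousInL4_Vfn (hv n)).sub (continuousInL4_Vfn (hz n))).sub hw
  have hnn : ∀ n, 0 ≤ ∫ t in (0 : ℝ)..T, L4 (Vfn (v n t) - Vfn (z n t) - w t) ^ 4 := fun n =>
    intervalIntegral.integral_nonneg hT fun t _ => pow_nonneg (L4_nonneg _) 4
  have hsecond : ∀ᶠ n in atTop, ∫⁻ t in Ioo 0 T, L4e (y t - Vfn (z n t)) ^ 4 ≤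
      ENNReal.ofReal (2 * ∫ t in Ioo 0 T, ‖z n t - V' t‖ ^ 2) := by
    filter_upwards [Metric.tendstoUniformlyOn_iff.1 hY 1 one_pos] with n hn
    have hint : Integrable (fun t => ‖z n t - V' t‖ ^ 2) (volume.restrict (Ioo 0 T)) :=
      ((memLp_path (hz n)).sub hV').integrable_norm_pow two_ne_zero
    rw [← integral_const_mul, ofReal_integral_eq_lintegral_ofReal (hint.const_mul 2)
      (Eventually.of_forall fun t => by positivity)]
    refine lintegral_mono_ae ?_
    filter_upwards [hYy, hV'Y, ae_restrict_mem measurableSet_Ioo] with t e1 e2 ht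
    have e3 : y t - Vfn (z n t) = Vfn (V' t - z n t) := by rw [Vfn_sub, e2, e1]
    have h1 : ‖Vfn (V' t - z n t)‖ ≤ 1 := by
      rw [Vfn_sub, e2, ← dist_eq_norm]
      exact (hn t (Ioo_subset_Icc_self ht)).le
    rw [e3]
    refine (L4e_Vfn_pow_le _).trans (ENNReal.ofReal_le_ofReal ?_)
    have h2 := norm_Vfn_le (V' t - z n t)
    have h3 := norm_Vdx_le (V' t - z n t)
    rw [norm_sub_rev (z n t)]
    calc 2 * ‖Vfn (V' t - z n t)‖ ^ 3 * ‖Vdx (V' t - z n t)‖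
        = 2 * ‖Vfn (V' t - z n t)‖ ^ 2 * (‖Vfn (V' t - z n t)‖ * ‖Vdx (V' t - z n t)‖) := by ring
      _ ≤ 2 * 1 ^ 2 * (‖V' t - z n t‖ * ‖V' t - z n t‖) := by gcongr
      _ = 2 * ‖V' t - z n t‖ ^ 2 := by ring
  have hup : Tendsto (fun n => 16 * (distE T (fun t => Vfn (v n t)) (fun t => y t + w t) +
      ENNReal.ofReal (2 * ∫ t in Ioo 0 T, ‖z n t - V' t‖ ^ 2))) atTop (𝓝 0) := by
    have h1 : Tendsto (fun n => ENNReal.ofReal (2 * ∫ t in Ioo 0 T, ‖z n t - V' t‖ ^ 2)) atTop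
        (𝓝 0) := by
      simpa using ENNReal.tendsto_ofReal (hzV.const_mul 2)
    simpa using ENNReal.Tendsto.const_mul (a := 16) (hlim.add h1) (Or.inr (by norm_num))
  have hE : Tendsto (fun n => ENNReal.ofReal
      (∫ t in (0 : ℝ)..T, L4 (Vfn (v n t) - Vfn (z n t) - w t) ^ 4)) atTop (𝓝 0) := by
    refine tendsto_of_tendsto_of_tendsto_of_le_of_le' tendsto_const_nhds hup
      (Eventually.of_forall fun _ => zero_le) ?_
    filter_upwards [hsecond] with n hn
    rw [← lintegral_L4e_eq hT (h4 n)]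
    have h1 := lintegral_L4e_add_le (T := T) (u := fun t => Vfn (v n t) - (y t + w t))
      (v := fun t => y t - Vfn (z n t))
      ((continuous_Vfn.comp (hv n)).aestronglyMeasurable.sub hyw)
    have e : ∀ t, Vfn (v n t) - (y t + w t) + (y t - Vfn (z n t)) =
        Vfn (v n t) - Vfn (z n t) - w t := fun t => by abel
    simp only [e] at h1
    refine h1.trans ?_
    rw [distE]
    gcongr
  have := (ENNReal.tendsto_toReal ENNReal.zero_ne_top).comp hE
  refine this.congr fun n => ?_
  rw [Function.comp_apply, ENNReal.toReal_ofReal (hnn n)]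

end Error

/-! ### Passage to the limit in the energy inequality -/

section Energy

variable {l c T : ℝ} {bc : BC} {S : ℝ → H l →L[ℝ] H l}

/-- The energy inequality of an approximation, for a weight `θ` of the energy and a weight `σ` of
the norm in `L²(0, T; V)` for which the pointwise differential inequality holds. -/
lemma IsClassical.energy_le (hl : 0 < l) (hc : 0 ≤ c) {z v : ℝ → V l}
    {w a k : ℝ → H l} (h : IsClassical (IsA l c bc) z a k) (hv : Continuous v)
    (hw : ContinuousInL4 T w) {θ σ b : ℝ} (hθ : 0 ≤ θ) {f g : ℝ → ℝ}
    (hf : ContinuousOn f (Icc 0 T)) (hg : ContinuousOn g (Icc 0 T))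
    (hrate : ∀ t ∈ Icc 0 T, ∀ z : V l,
      θ * (-(b - 2) * ‖Vdx z‖ ^ 2 + (b ^ 2 / 8 - 2 * c) * ‖Vfn z‖ ^ 2 +
        noiseTerm z (w t) + 2 * c * ‖Vfn z‖ ^ 2 + 2 * c * inner ℝ (w t) (Vfn z)) +
        σ * ‖z‖ ^ 2 ≤ f t * ‖Vfn z‖ ^ 2 + g t) {t : ℝ} (ht : t ∈ Icc 0 T) :
    θ * ‖Vfn (z t)‖ ^ 2 + σ * (∫ s in (0 : ℝ)..t, ‖z s‖ ^ 2) ≤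
      θ * ‖Vfn (z 0)‖ ^ 2 + (∫ s in (0 : ℝ)..t, f s * ‖Vfn (z s)‖ ^ 2) +
        (∫ s in (0 : ℝ)..t, g s) + θ * ∫ s in (0 : ℝ)..T, defect c (z s) (v s) (w s) (k s) := by
  have cz : Continuous fun s => Vfn (z s) := continuous_Vfn.comp h.continuous
  have cd : Continuous fun s => Vdx (z s) := continuous_Vdx.comp h.continuous
  have ck := h.continuous_forcing
  have hii : ∀ {g : ℝ → ℝ}, ContinuousOn g (Icc 0 T) → IntervalIntegrable g volume 0 t :=
    fun hg =>
      (hg.mono (by rw [uIcc_of_le ht.1]; exact Icc_subset_Icc_right ht.2)).intervalIntegrable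
  have cdef := continuousOn_defect (c := c) h.continuous hv hw ck
  have i0 : IntervalIntegrable (fun s => -(b - 2) * ‖Vdx (z s)‖ ^ 2 +
      (b ^ 2 / 8 - 2 * c) * ‖Vfn (z s)‖ ^ 2 + 2 * inner ℝ (k s) (Vfn (z s))) volume 0 t :=
    Continuous.intervalIntegrable (by fun_prop) _ _
  have i1 : IntervalIntegrable (fun s => σ * ‖z s‖ ^ 2) volume 0 t :=
    (continuous_const.mul (h.continuous.norm.pow 2)).intervalIntegrable _ _
  have i2 : IntervalIntegrable (fun s => f s * ‖Vfn (z s)‖ ^ 2) volume 0 t :=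
    hii (hf.mul (cz.norm.pow 2).continuousOn)
  have i3 := hii hg
  have i4 := (hii cdef).const_mul θ
  have hmono := intervalIntegral.integral_mono_on ht.1 ((i0.const_mul θ).add i1)
    ((i2.add i3).add i4) fun s hs => by
      have hs' : s ∈ Icc 0 T := ⟨hs.1, hs.2.trans ht.2⟩
      have e1 := hrate s hs' (z s)
      have e2 := mul_le_mul_of_nonneg_left
        (two_inner_forcing_le hl hc (z s) (v s) (k s) (hw.lt_top hs')) hθ
      show θ * _ + _ ≤ _ + _ + θ * _
      linarith
  rw [intervalIntegral.integral_add (i0.const_mul θ) i1,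
    intervalIntegral.integral_add (i2.add i3) i4, intervalIntegral.integral_add i2 i3] at hmono
  simp only [intervalIntegral.integral_const_mul] at hmono
  have hdef : ∫ s in (0 : ℝ)..t, defect c (z s) (v s) (w s) (k s) ≤
      ∫ s in (0 : ℝ)..T, defect c (z s) (v s) (w s) (k s) :=
    intervalIntegral.integral_mono_interval le_rfl ht.1 ht.2
      (Eventually.of_forall fun s => defect_nonneg hc _ _ _ _)
      ((cdef.mono (by rw [uIcc_of_le (ht.1.trans ht.2)])).intervalIntegrable)
  have he := mul_le_mul_of_nonneg_left (h.energy hl b ht.1) hθ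
  have hd := mul_le_mul_of_nonneg_left hdef hθ
  linarith

lemma tendsto_integral_mul_norm_sq {z : ℕ → ℝ → H l} {Y : ℝ → H l} {f : ℝ → ℝ}
    (hz : ∀ n, Continuous (z n)) (hf : ContinuousOn f (Icc 0 T)) (hY : ContinuousOn Y (Icc 0 T))
    (h : TendstoUniformlyOn z Y atTop (Icc 0 T)) {t : ℝ} (ht : t ∈ Icc 0 T) :
    Tendsto (fun n => ∫ s in (0 : ℝ)..t, f s * ‖z n s‖ ^ 2) atTop
      (𝓝 (∫ s in (0 : ℝ)..t, f s * ‖Y s‖ ^ 2)) := by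
  obtain ⟨M, hM⟩ := isCompact_Icc.exists_bound_of_continuousOn hf
  obtain ⟨B, hB⟩ := isCompact_Icc.exists_bound_of_continuousOn hY
  have hsub : uIoc 0 t ⊆ Icc 0 T := by
    rw [uIoc_of_le ht.1]
    exact Ioc_subset_Icc_self.trans (Icc_subset_Icc_right ht.2)
  refine intervalIntegral.tendsto_integral_filter_of_dominated_convergence
    (fun _ => M * (B + 1) ^ 2) (Eventually.of_forall fun n => ?_) ?_ (by simp) ?_
  · exact ((hf.mul ((hz n).norm.pow 2).continuousOn).mono hsub).aestronglyMeasurable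
      measurableSet_uIoc
  · filter_upwards [Metric.tendstoUniformlyOn_iff.1 h 1 one_pos] with n hn
    refine Eventually.of_forall fun s hs => ?_
    have hs' := hsub hs
    have h1 : ‖z n s‖ ≤ B + 1 := by
      have e : z n s = Y s + (z n s - Y s) := by abel
      have e2 := (hn s hs').le
      rw [dist_comm, dist_eq_norm] at e2
      rw [e]
      exact (norm_add_le _ _).trans (add_le_add (hB s hs') e2)
    have hM0 : 0 ≤ M := (norm_nonneg _).trans (hM s hs')
    rw [norm_mul, norm_pow, norm_norm]
    gcongr
    exact hM s hs'
  · exact Eventually.of_forall fun s hs =>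
      ((h.tendsto_at (hsub hs)).norm.pow 2).const_mul (f s)

lemma continuousOn_fCoef {C₁ C₂ : ℝ} {w : ℝ → H l} (hw : ContinuousInL4 T w) :
    ContinuousOn (fCoef c C₁ C₂ w) (Icc 0 T) :=
  continuousOn_const.mul (continuousOn_const.add
    (continuousOn_const.mul (hw.continuousOn_L4.pow 4)))

lemma continuousOn_gCoef {w : ℝ → H l} (hw : ContinuousInL4 T w) :
    ContinuousOn (gCoef c w) (Icc 0 T) :=
  (continuousOn_const.mul (hw.continuousOn.norm.pow 2)).add
    (continuousOn_const.mul (hw.continuousOn_L4.pow 4))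

lemma gCoef_nonneg (hc : 0 ≤ c) (w : ℝ → H l) (t : ℝ) : 0 ≤ gCoef c w t := by
  have := L4_nonneg (w t)
  unfold gCoef
  positivity

lemma fCoef_nonneg {C₁ C₂ : ℝ} (hc : 0 ≤ c) (hC : 0 ≤ C₁ * C₂) (w : ℝ → H l) (t : ℝ) :
    0 ≤ fCoef c C₁ C₂ w t := by
  have := L4_nonneg (w t)
  unfold fCoef
  positivity

lemma fCoef_mono {κ C₁ C₂ : ℝ} (hκ : 0 ≤ κ) (h : κ ≤ C₁ * C₂) (w : ℝ → H l) (t : ℝ) :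
    1 / 2 * (2 * c + (2 + 3 / 4 * κ) ^ 2 + κ * L4 (w t) ^ 4) ≤ fCoef c C₁ C₂ w t := by
  have := L4_nonneg (w t)
  unfold fCoef
  gcongr

/-- The two energy inequalities for limits of mild solutions whose forcings `G₀(v n)` are those of
paths `v n` with the limit `y + w` in `E`. -/
theorem exists_energy_inequalities (hl : 0 < l) (hc : 0 ≤ c) (hT : 0 ≤ T)
    (hS : IsSemigroup (IsA l c bc) S) {C₁ C₂ : ℝ} (hC₀ : 0 ≤ C₁ * C₂)
    (hC : ∀ v : V l, L4e (Vfn v) ≤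
      ENNReal.ofReal (C₁ * C₂ * ‖Vfn v‖ ^ (1 / 2 : ℝ) * ‖v‖ ^ (1 / 2 : ℝ)))
    {w : ℝ → H l} (hw : ContinuousInL4 T w) (u₀ : H l) {y : ℝ → H l}
    (hy : AEStronglyMeasurable y (volume.restrict (Ioo 0 T)))
    (hyw : AEStronglyMeasurable (fun t => y t + w t) (volume.restrict (Ioo 0 T)))
    {v : ℕ → ℝ → V l} (hv : ∀ n, Continuous (v n))
    (hlim : Tendsto (fun n => distE T (fun t => Vfn (v n t)) fun t => y t + w t) atTop (𝓝 0))
    (hmild : Tendsto (fun n => distE T (mild S u₀ fun t => G0 c (v n t)) y) atTop (𝓝 0)) :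
    ∃ (Y : ℝ → H l) (V' : ℝ → V l), ContinuousOn Y (Icc 0 T) ∧
      (∀ᵐ t ∂(volume.restrict (Ioo 0 T)), Y t = y t) ∧
      MemLp V' 2 (volume.restrict (Ioo 0 T)) ∧
      (∀ᵐ t ∂(volume.restrict (Ioo 0 T)), Vfn (V' t) = Y t) ∧
      (∀ t ∈ Icc 0 T, ‖Y t‖ ^ 2 ≤ ‖u₀‖ ^ 2 +
        (∫ s in (0 : ℝ)..t, fCoef c C₁ C₂ w s * ‖Y s‖ ^ 2) + ∫ s in (0 : ℝ)..t, gCoef c w s) ∧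
      ∫ t in (0 : ℝ)..T, ‖V' t‖ ^ 2 ≤ ‖u₀‖ ^ 2 +
        (∫ s in (0 : ℝ)..T, fCoef c C₁ C₂ w s * ‖Y s‖ ^ 2) +
          ∫ s in (0 : ℝ)..T, gCoef c w s := by
  obtain ⟨z, a, k, Y, V', hcl, hkG, hz0, hYc, hYu, hYy, hV'm, hV'Y, hzV, hzV2⟩ :=
    exists_limit hl hc hT hS hv (fun ε hε => exists_integral_L4_sub_le hT hv hyw hlim hε) u₀ hy
      hmild
  have cz : ∀ n, Continuous (z n) := fun n => (hcl n).continuous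
  have herr := tendsto_integral_L4_error hT cz hv hw hyw hlim hYu hYy hV'm hV'Y hzV
  simp only [integral_Ioo_eq hT] at hzV2
  obtain ⟨B, hB⟩ := isCompact_Icc.exists_bound_of_continuousOn hYc
  have hBz : ∀ᶠ n in atTop, ∀ t ∈ Icc 0 T, ‖Vfn (z n t)‖ ^ 2 ≤ (B + 1) ^ 2 := by
    filter_upwards [Metric.tendstoUniformlyOn_iff.1 hYu 1 one_pos] with n hn t ht
    have e : Vfn (z n t) = Y t + (Vfn (z n t) - Y t) := by abel
    have e2 := (hn t ht).le
    rw [dist_comm, dist_eq_norm] at e2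
    gcongr
    rw [e]
    exact (norm_add_le _ _).trans (add_le_add (hB t ht) e2)
  have hdef := tendsto_integral_defect hc hT cz hv hw (fun n => (hcl n).continuous_forcing) hkG hBz
    (hzV2.eventually (ge_mem_nhds (lt_add_one _))) herr
  have hinit : Tendsto (fun n => ‖Vfn (z n 0)‖ ^ 2) atTop (𝓝 (‖u₀‖ ^ 2)) := by
    refine (Tendsto.norm ?_).pow 2
    exact tendsto_iff_norm_sub_tendsto_zero.2 (squeeze_zero (fun _ => norm_nonneg _) hz0
      tendsto_one_div_add_atTop_nhds_zero_nat)
  -- the pointwise inequalities are applied with a constant `κ ≤ 1` and a rate below `f`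
  set κ : ℝ := min (C₁ * C₂) 1 with hκ
  have hκ0 : 0 ≤ κ := le_min hC₀ zero_le_one
  have hκ1 : κ ≤ 1 := min_le_right _ _
  have hκC : κ ≤ C₁ * C₂ := min_le_left _ _
  have hint := L4_pow_le_min hC₀ hC
  have hrhs : ∀ t ∈ Icc 0 T, ∀ θ : ℝ, Tendsto (fun n => θ * ‖Vfn (z n 0)‖ ^ 2 +
      (∫ s in (0 : ℝ)..t, fCoef c C₁ C₂ w s * ‖Vfn (z n s)‖ ^ 2) + (∫ s in (0 : ℝ)..t, gCoef c w s) +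
      θ * ∫ s in (0 : ℝ)..T, defect c (z n s) (v n s) (w s) (k n s)) atTop
      (𝓝 (θ * ‖u₀‖ ^ 2 + (∫ s in (0 : ℝ)..t, fCoef c C₁ C₂ w s * ‖Y s‖ ^ 2) +
        ∫ s in (0 : ℝ)..t, gCoef c w s)) := fun t ht θ => by
    have := (((hinit.const_mul θ).add (tendsto_integral_mul_norm_sq
      (fun n => continuous_Vfn.comp (cz n)) (continuousOn_fCoef (c := c) (C₁ := C₁) (C₂ := C₂) hw)
      hYc hYu ht)).add_const (∫ s in (0 : ℝ)..t, gCoef c w s)).add (hdef.const_mul θ)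
    rwa [mul_zero, add_zero] at this
  refine ⟨Y, V', hYc, hYy, hV'm, hV'Y, fun t ht => ?_, ?_⟩
  · have hlhs : Tendsto (fun n => 1 * ‖Vfn (z n t)‖ ^ 2 + 0 * (∫ s in (0 : ℝ)..t, ‖z n s‖ ^ 2))
        atTop (𝓝 (‖Y t‖ ^ 2)) := by
      simpa using (hYu.tendsto_at ht).norm.pow 2
    have := le_of_tendsto_of_tendsto' hlhs (hrhs t ht 1) fun n =>
      (hcl n).energy_le hl hc (hv n) hw (b := 3 + 3 / 2 * κ) zero_le_one
        (continuousOn_fCoef hw) (continuousOn_gCoef hw) (fun t ht z => by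
          have h1 := energy_rate_le hc hκ0 hκ1 hint z (hw.lt_top ht)
          have h2 := mul_le_mul_of_nonneg_right (fCoef_mono (c := c) hκ0 hκC w t)
            (sq_nonneg ‖Vfn z‖)
          rw [gCoef]
          linarith) ht
    rwa [one_mul] at this
  · obtain ⟨b, hb⟩ := half_energy_rate_add_le (c := c) hl hc hκ0 hκ1 hint
    have hTT : T ∈ Icc 0 T := ⟨hT, le_rfl⟩
    have hlhs : Tendsto (fun n => 1 / 2 * ‖Vfn (z n T)‖ ^ 2 +
        1 * (∫ s in (0 : ℝ)..T, ‖z n s‖ ^ 2)) atTop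
        (𝓝 (1 / 2 * ‖Y T‖ ^ 2 + 1 * ∫ s in (0 : ℝ)..T, ‖V' s‖ ^ 2)) :=
      (((hYu.tendsto_at hTT).norm.pow 2).const_mul _).add (hzV2.const_mul 1)
    have := le_of_tendsto_of_tendsto' hlhs (hrhs T hTT (1 / 2)) fun n =>
      (hcl n).energy_le hl hc (hv n) hw (b := b) (by norm_num)
        (continuousOn_fCoef hw) (continuousOn_gCoef hw) (fun t ht z => by
          have h1 := hb z (hw.lt_top ht)
          have h2 := mul_le_mul_of_nonneg_right (fCoef_mono (c := c) hκ0 hκC w t)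
            (sq_nonneg ‖Vfn z‖)
          rw [gCoef]
          linarith) hTT
    have h1 := sq_nonneg ‖Y T‖
    have h2 := sq_nonneg ‖u₀‖
    linarith

end Energy

/-! ### Solutions of the equation -/

section Solution

variable {l c T : ℝ} {bc : BC} {S : ℝ → H l →L[ℝ] H l}

/-- Solutions in `E` are limits of mild solutions with regular forcing. -/
lemma IsSolution.exists_mild (hT : 0 ≤ T) {u₀ : H l} {w y : ℝ → H l}
    (h : IsSolution S c T u₀ w y) :
    AEStronglyMeasurable y (volume.restrict (Ioo 0 T)) ∧
    AEStronglyMeasurable (fun t => y t + w t) (volume.restrict (Ioo 0 T)) ∧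
    ∃ v : ℕ → ℝ → V l, (∀ n, Continuous (v n)) ∧
      Tendsto (fun n => distE T (fun t => Vfn (v n t)) fun t => y t + w t) atTop (𝓝 0) ∧
      Tendsto (fun n => distE T (mild S u₀ fun t => G0 c (v n t)) y) atTop (𝓝 0) := by
  obtain ⟨hy, ζ, ⟨hyw, -, v, hv, hlim, hF⟩, hsol⟩ := h
  -- the paths are extended to the real line by constants, to make them continuous everywhere
  have hproj : ∀ n, ∀ t ∈ Icc 0 T, v n (projIcc 0 T hT t) = v n t := fun n t ht => by
    rw [projIcc_of_mem hT ht]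
  refine ⟨hy.1, hyw.1, fun n t => v n (projIcc 0 T hT t), fun n => ?_, ?_, ?_⟩
  · exact (continuousOn_iff_continuous_domRestrict.1 (hv n).continuousOn).comp continuous_projIcc
  · refine hlim.congr fun n => setLIntegral_congr_fun measurableSet_Ioo fun t ht => ?_
    simp only [hproj n t (Ioo_subset_Icc_self ht)]
  · refine hF.congr fun n => ?_
    refine lintegral_congr_ae ?_
    filter_upwards [hsol, ae_restrict_mem measurableSet_Ioo] with t ht htI
    have e : mild S u₀ (fun t => G0 c (v n (projIcc 0 T hT t))) t =
        S t u₀ + F0 S c (v n) t := by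
      rw [mild, F0, max_eq_left htI.1.le]
      congr 1
      refine intervalIntegral.integral_congr fun s hs => ?_
      rw [uIcc_of_le htI.1.le] at hs
      simp only [max_eq_left (sub_nonneg.2 hs.2), hproj n s ⟨hs.1, hs.2.trans htI.2.le⟩]
    rw [e, ht, add_sub_add_left_eq_sub]

end Solution

end

end KS

theorem lemma4p2 (l : ℝ) (hl : 0 < l) (c : ℝ) (hc : 0 ≤ c) (bc : KS.BC)
    (S : ℝ → KS.H l →L[ℝ] KS.H l) (hS : KS.IsSemigroup (KS.IsA l c bc) S)
    (C₁ C₂ : ℝ) (hC₁ : 0 < C₁) (hC₂ : 0 < C₂)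
    (hC : ∀ v : KS.V l,
      KS.L4e (KS.Vfn v) ≤ ENNReal.ofReal (C₁ * C₂ * ‖KS.Vfn v‖ ^ (1 / 2 : ℝ) * ‖v‖ ^ (1 / 2 : ℝ)))
    {Ω : Type*} [MeasurableSpace Ω] (P : Measure Ω) [IsProbabilityMeasure P]
    (Q : KS.H l →L[ℝ] KS.H l) (W : ℝ → Ω → KS.H l) (hW : KS.IsQWiener P Q W)
    (T : ℝ) (hT : 0 < T) (wA : ℝ → Ω → KS.H l)
    (hwA : KS.IsStochasticConvolution P S T W wA) :
    ∀ᵐ ω ∂P, ∀ (u₀ : KS.H l) (y : ℝ → KS.H l),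
      KS.IsSolution S c T u₀ (fun t => wA t ω) y →
      ∃ Y : ℝ → KS.H l, ContinuousOn Y (Icc 0 T) ∧
        (∀ᵐ t ∂(volume.restrict (Ioo 0 T)), Y t = y t) ∧
        sSup ((fun t => ‖Y t‖ ^ 2) '' Icc 0 T) ≤
          ‖u₀‖ ^ 2 * Real.exp (∫ s in (0 : ℝ)..T, KS.fCoef c C₁ C₂ (fun t => wA t ω) s) +
          ∫ τ in (0 : ℝ)..T, Real.exp (∫ s in (0 : ℝ)..T, KS.fCoef c C₁ C₂ (fun t => wA t ω) s) *
            KS.gCoef c (fun t => wA t ω) τ ∧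
        ∃ v : ℝ → KS.V l, (∀ᵐ t ∂(volume.restrict (Ioo 0 T)), KS.Vfn (v t) = y t) ∧
          IntervalIntegrable (fun t => ‖v t‖ ^ 2) volume 0 T ∧
          ∫ t in (0 : ℝ)..T, ‖v t‖ ^ 2 ≤
            ‖u₀‖ ^ 2 +
            sSup ((fun t => ‖Y t‖ ^ 2) '' Icc 0 T) *
              (∫ τ in (0 : ℝ)..T, KS.fCoef c C₁ C₂ (fun t => wA t ω) τ) +
            ∫ τ in (0 : ℝ)..T, KS.gCoef c (fun t => wA t ω) τ := by
  filter_upwards [hwA.continuous] with ω hω u₀ y hsol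
  set w : ℝ → KS.H l := fun t => wA t ω
  have hC₀ : 0 ≤ C₁ * C₂ := by positivity
  obtain ⟨hy, hyw, v, hv, hlim, hmild⟩ := hsol.exists_mild hT.le
  obtain ⟨Y, V', hYc, hYy, hV'm, hV'Y, hsup, hint⟩ :=
    KS.exists_energy_inequalities hl hc hT.le hS hC₀ hC hω u₀ hy hyw hv hlim hmild
  have hf := KS.continuousOn_fCoef (c := c) (C₁ := C₁) (C₂ := C₂) hω
  have hg := KS.continuousOn_gCoef (c := c) hω
  have hf0 := KS.fCoef_nonneg hc hC₀ w
  have hii : ∀ {g : ℝ → ℝ}, ContinuousOn g (Icc 0 T) → IntervalIntegrable g volume 0 T :=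
    fun hg => (hg.mono (by rw [uIcc_of_le hT.le])).intervalIntegrable
  have hg0 : 0 ≤ ∫ s in (0 : ℝ)..T, KS.gCoef c w s :=
    intervalIntegral.integral_nonneg hT.le fun t _ => KS.gCoef_nonneg hc w t
  have hne : ((fun t => ‖Y t‖ ^ 2) '' Icc 0 T).Nonempty := (nonempty_Icc.2 hT.le).image _
  have hbdd : BddAbove ((fun t => ‖Y t‖ ^ 2) '' Icc 0 T) :=
    (isCompact_Icc.image_of_continuousOn (hYc.norm.pow 2)).bddAbove
  refine ⟨Y, hYc, hYy, ?_, V', ?_, ?_, ?_⟩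
  · refine csSup_le hne ?_
    rintro _ ⟨t, ht, rfl⟩
    have hgron := KS.gronwall_integral (K := ‖u₀‖ ^ 2 + ∫ s in (0 : ℝ)..T, KS.gCoef c w s)
      (hYc.norm.pow 2) hf (fun t _ => hf0 t) (by positivity) (fun t ht => by
        have h1 := hsup t ht
        have h2 : ∫ s in (0 : ℝ)..t, KS.gCoef c w s ≤ ∫ s in (0 : ℝ)..T, KS.gCoef c w s :=
          intervalIntegral.integral_mono_interval le_rfl ht.1 ht.2
            (Eventually.of_forall fun s => KS.gCoef_nonneg hc w s) (hii hg)
        show ‖Y t‖ ^ 2 ≤ _ + ∫ s in (0 : ℝ)..t, KS.fCoef c C₁ C₂ w s * ‖Y s‖ ^ 2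
        linarith) ht
    rw [intervalIntegral.integral_const_mul]
    refine (show ‖Y t‖ ^ 2 ≤ _ from hgron).trans_eq ?_
    ring
  · filter_upwards [hYy, hV'Y] with t h1 h2
    rw [h2, h1]
  · rw [intervalIntegrable_iff_integrableOn_Ioo_of_le hT.le]
    exact hV'm.integrable_norm_pow two_ne_zero
  · have hle : ∫ s in (0 : ℝ)..T, KS.fCoef c C₁ C₂ w s * ‖Y s‖ ^ 2 ≤
        sSup ((fun t => ‖Y t‖ ^ 2) '' Icc 0 T) * ∫ s in (0 : ℝ)..T, KS.fCoef c C₁ C₂ w s := by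
      rw [← intervalIntegral.integral_const_mul]
      refine intervalIntegral.integral_mono_on hT.le (hii (hf.mul (hYc.norm.pow 2)))
        ((hii hf).const_mul _) fun s hs => ?_
      rw [mul_comm]
      exact mul_le_mul_of_nonneg_right (le_csSup hbdd ⟨s, hs, rfl⟩) (hf0 s)
    linarith
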